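/- Let $k$ be a field, and let $(S,L)$ be a Lie–Rinehart algebra over $k$: $S$ is a commutative $k$-algebra, $L$ is a $k$-Lie algebra and an $S$-module (with compatible $k$-structures), and $L$ acts on $S$ by $k$-linear derivations $\alpha\mapsto\alpha_S$ through a morphism of Lie algebras $L\to\mathrm{Der}_k(S)$, in such a way that $(s\alpha)_S(t)=s\,\alpha_S(t)$ and $[\alpha,s\beta]=s[\alpha,\beta]+\alpha_S(s)\beta$ for all $s,t\in S$, $\alpha,\beta\in L$. Assume that $L$ is projective as an $S$-module. Let $U$ be the universal enveloping algebra of $(S,L)$, that is, the universal $k$-algebra with a morphism of algebras $i:S\to U$ and a morphism of Lie algebras $j:L\to U$ such that $i(s)j(\alpha)=j(s\alpha)$ and $j(\alpha)i(s)-i(s)j(\alpha)=i(\alpha_S(s))$. Write $A^e=A\otimes_k A^{op}$ and $H^n(A,M)=\mathrm{Ext}^n_{A^e}(A,M)$ for the Hochschild cohomology of a $k$-algebra $A$ with values in an $A$-bimodule $M$, and $H^n_S(L,N)=\mathrm{Ext}^n_U(S,N)$ for the Lie–Rinehart cohomology with values in a left $U$-module $N$; here $S$ is a left $U$-module, $S$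 acting by multiplication and $L$ by derivations. For a $U$-bimodule $M$ let $U$ act on $\mathrm{Hom}_{S^e}(S,M)$ by $$(t\cdot\varphi)(s)=t\varphi(s),\qquad (\alpha\cdot\varphi)(s)=\alpha\varphi(s)-\varphi(s)\alpha-\varphi(\alpha_S(s))\qquad(s,t\in S,\ \alpha\in L).$$ 1. For every $U$-bimodule $M$ and every injective resolution $M\to I^\bullet$ of $U$-bimodules, the canonical map sending a cocycle of the complex $\mathrm{Hom}_{S^e}(S,I^\bullet)$ to its class in $H^\bullet(S,M)=\mathrm{Ext}^\bullet_{S^e}(S,M)$ is surjective, and its kernel consists of the coboundaries. 2. There are $U$-module structures on the spaces $H^q(S,M)$, for all $U$-bimodules $M$ and all $q\ge 0$, such that $u\cdot[\varphi]=[u\cdot\varphi]$ for all $u\in U$, every injective resolution $M\to I^\bullet$ of $U$-bimodules and every cocycle $\varphi\in\mathrm{Hom}_{S^e}(S,I^q)$. They are natural: each morphism of $U$-bimodules $M\to M'$ induces $U$-linear maps $H^q(S,M)\to H^q(S,M')$. 3. With these structures, for every $U$-bimodule $M$ there is a first-quadrant cohomological spectral sequence of $k$-vector spaces with second page $$E_2^{p,q}\cong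 H_S^p(L,H^q(S,M))$$ that converges to $H^{p+q}(U,M)$: for each $n$ there is a filtration $H^n(U,M)=F^0\supseteq F^1\supseteq\cdots\supseteq F^{n+1}=0$ by subspaces such that $F^p/F^{p+1}\cong E_\infty^{p,n-p}$ for $0\le p\le n$. -/

import Mathlib

open CategoryTheory CategoryTheory.Abelian CategoryTheory.Limits TensorProduct MulOpposite

universe u

noncomputable section

namespace LieRinehart

/-! ### The enveloping algebra of a Lie–Rinehart algebra -/

section Enveloping

attribute [local instance 100] LieRing.ofAssociativeRing

variable (k S L : Type u) [Field k] [CommRing S] [Algebra k S] [LieRing L] [LieAlgebra k L]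
  [Module S L] [LieRingModule L S]

/-- The relations imposed on the free `k`-algebra on the disjoint union of `S` and `L`: the map
from `S` is a morphism of algebras, the map from `L` is a morphism of Lie algebras,
`i(s) j(α) = j(s α)` and `j(α) i(s) - i(s) j(α) = i(α_S(s))`. -/
inductive Rel : FreeAlgebra k (S ⊕ L) → FreeAlgebra k (S ⊕ L) → Prop
  | add (s t : S) : Rel (FreeAlgebra.ι k (Sum.inl (s + t)))
      (FreeAlgebra.ι k (Sum.inl s) + FreeAlgebra.ι k (Sum.inl t))
  | mul (s t : S) : Rel (FreeAlgebra.ι k (Sum.inl (s * t)))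
      (FreeAlgebra.ι k (Sum.inl s) * FreeAlgebra.ι k (Sum.inl t))
  | algebraMap (c : k) : Rel (FreeAlgebra.ι k (Sum.inl (algebraMap k S c)))
      (algebraMap k (FreeAlgebra k (S ⊕ L)) c)
  | lieAdd (α β : L) : Rel (FreeAlgebra.ι k (Sum.inr (α + β)))
      (FreeAlgebra.ι k (Sum.inr α) + FreeAlgebra.ι k (Sum.inr β))
  | lieSMul (c : k) (α : L) : Rel (FreeAlgebra.ι k (Sum.inr (c • α)))
      (c • FreeAlgebra.ι k (Sum.inr α))
  | lie (α β : L) : Rel (FreeAlgebra.ι k (Sum.inr ⁅α, β⁆))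
      (FreeAlgebra.ι k (Sum.inr α) * FreeAlgebra.ι k (Sum.inr β)
        - FreeAlgebra.ι k (Sum.inr β) * FreeAlgebra.ι k (Sum.inr α))
  | smul (s : S) (α : L) :
      Rel (FreeAlgebra.ι k (Sum.inl s) * FreeAlgebra.ι k (Sum.inr α))
        (FreeAlgebra.ι k (Sum.inr (s • α)))
  | anchor (α : L) (s : S) :
      Rel (FreeAlgebra.ι k (Sum.inr α) * FreeAlgebra.ι k (Sum.inl s)
        - FreeAlgebra.ι k (Sum.inl s) * FreeAlgebra.ι k (Sum.inr α))
        (FreeAlgebra.ι k (Sum.inl ⁅α, s⁆))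

/-- The universal enveloping algebra `U = U(S, L)`. -/
def Env : Type u := RingQuot (Rel k S L)

instance : Ring (Env k S L) := inferInstanceAs (Ring (RingQuot (Rel k S L)))

instance : Algebra k (Env k S L) := inferInstanceAs (Algebra k (RingQuot (Rel k S L)))

/-- The projection of the free algebra onto `U`. -/
def mkEnv : FreeAlgebra k (S ⊕ L) →ₐ[k] Env k S L := RingQuot.mkAlgHom k (Rel k S L)

variable {k S L} in
theorem mkEnv_rel {x y : FreeAlgebra k (S ⊕ L)} (h : Rel k S L x y) :
    mkEnv k S L x = mkEnv k S L y := RingQuot.mkAlgHom_rel k h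

/-- The morphism of algebras `i : S → U`. -/
def inS : S →ₐ[k] Env k S L where
  toFun s := mkEnv k S L (FreeAlgebra.ι k (Sum.inl s))
  map_one' := by
    have h := mkEnv_rel (Rel.algebraMap (S := S) (L := L) (1 : k))
    simpa using h
  map_mul' s t := by simpa using mkEnv_rel (Rel.mul (k := k) (L := L) s t)
  map_zero' := by
    have h := mkEnv_rel (Rel.algebraMap (S := S) (L := L) (0 : k))
    simpa using h
  map_add' s t := by simpa using mkEnv_rel (Rel.add (k := k) (L := L) s t)
  commutes' c := by simpa using mkEnv_rel (Rel.algebraMap (S := S) (L := L) c)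

/-- The morphism of Lie algebras `j : L → U`. -/
def inL : L →ₗ⁅k⁆ Env k S L where
  toFun α := mkEnv k S L (FreeAlgebra.ι k (Sum.inr α))
  map_add' α β := by simpa using mkEnv_rel (Rel.lieAdd (k := k) (S := S) α β)
  map_smul' c α := by simpa using mkEnv_rel (Rel.lieSMul (k := k) (S := S) c α)
  map_lie' {α β} := by
    simpa [Ring.lie_def] using mkEnv_rel (Rel.lie (k := k) (S := S) α β)

theorem inS_mul_inL (s : S) (α : L) :
    inS k S L s * inL k S L α = inL k S L (s • α) := by
  have h := mkEnv_rel (Rel.smul (k := k) s α)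
  rw [map_mul] at h
  exact h

theorem inL_mul_inS (α : L) (s : S) :
    inL k S L α * inS k S L s = inS k S L s * inL k S L α + inS k S L ⁅α, s⁆ := by
  have h := mkEnv_rel (Rel.anchor (k := k) α s)
  simp only [map_sub, map_mul] at h
  rw [sub_eq_iff_eq_add'] at h
  exact h

variable {k S L}

/-- The universal property of `U`. -/
def lift {B : Type u} [Ring B] [Algebra k B] (f : S →ₐ[k] B) (g : L →ₗ⁅k⁆ B)
    (h₁ : ∀ s α, f s * g α = g (s • α))
    (h₂ : ∀ α s, g α * f s - f s * g α = f ⁅α, s⁆) : Env k S L →ₐ[k] B :=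
  RingQuot.liftAlgHom k ⟨FreeAlgebra.lift k (Sum.elim f g), by
    intro x y h
    cases h with
    | anchor α s => simpa using h₂ α s
    | _ => simp [h₁, Ring.lie_def]⟩

section lift

variable {B : Type u} [Ring B] [Algebra k B] (f : S →ₐ[k] B) (g : L →ₗ⁅k⁆ B)
    (h₁ : ∀ s α, f s * g α = g (s • α))
    (h₂ : ∀ α s, g α * f s - f s * g α = f ⁅α, s⁆)

@[simp]
theorem lift_inS (s : S) : lift f g h₁ h₂ (inS k S L s) = f s := by
  change RingQuot.liftAlgHom k _ (RingQuot.mkAlgHom k _ _) = _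
  simp

@[simp]
theorem lift_inL (α : L) : lift f g h₁ h₂ (inL k S L α) = g α := by
  change RingQuot.liftAlgHom k _ (RingQuot.mkAlgHom k _ _) = _
  simp

end lift

theorem algHom_ext {B : Type u} [Ring B] [Algebra k B] {f g : Env k S L →ₐ[k] B}
    (h₁ : ∀ s, f (inS k S L s) = g (inS k S L s))
    (h₂ : ∀ α, f (inL k S L α) = g (inL k S L α)) : f = g := by
  apply RingQuot.ringQuot_ext'
  apply FreeAlgebra.hom_ext
  funext x
  rcases x with s | α
  · exact h₁ s
  · exact h₂ α

theorem Env.induction {P : Env k S L → Prop} (inS : ∀ s, P (inS k S L s))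
    (inL : ∀ α, P (inL k S L α)) (algebraMap : ∀ c : k, P (algebraMap k _ c))
    (mul : ∀ a b, P a → P b → P (a * b)) (add : ∀ a b, P a → P b → P (a + b))
    (a : Env k S L) : P a := by
  obtain ⟨x, rfl⟩ := RingQuot.mkAlgHom_surjective k (Rel k S L) a
  change P (mkEnv k S L x)
  induction x using FreeAlgebra.induction with
  | grade0 c => rw [AlgHom.commutes]; exact algebraMap c
  | grade1 x =>
    rcases x with s | α
    · exact inS s
    · exact inL α
  | mul a b ha hb => rw [map_mul]; exact mul _ _ ha hb
  | add a b ha hb => rw [map_add]; exact add _ _ ha hb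

end Enveloping

/-! ### Bimodules and Hochschild cohomology -/

/-- The algebra `A^e = A ⊗ A^op`; left `A^e`-modules are `A`-bimodules. -/
abbrev Ae (k A : Type u) [Field k] [Ring A] [Algebra k A] : Type u := A ⊗[k] Aᵐᵒᵖ

/-- `A` as a bimodule over itself: `(a ⊗ b) x = a x b`. -/
def regular (k A : Type u) [Field k] [Ring A] [Algebra k A] : ModuleCat.{u} (Ae k A) :=
  letI : Module (Ae k A) A := TensorProduct.Algebra.module
  ModuleCat.of (Ae k A) A

/-- Hochschild cohomology `H^n(A, M) = Ext^n_{A^e}(A, M)`. -/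
abbrev HH (k A : Type u) [Field k] [Ring A] [Algebra k A] (M : ModuleCat.{u} (Ae k A)) (n : ℕ) :
    Type u :=
  Ext (regular k A) M n

/-! ### The module structures used in the statement -/

section Modules

attribute [local instance 100] LieRing.ofAssociativeRing

variable (k S L : Type u) [Field k] [CommRing S] [Algebra k S] [LieRing L] [LieAlgebra k L]
  [Module S L] [LieRingModule L S]

/-- The morphism of algebras `S^e → U^e` induced by `i : S → U`. -/
def inSe : Ae k S →ₐ[k] Ae k (Env k S L) :=
  Algebra.TensorProduct.map (inS k S L) (AlgHom.op (inS k S L))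

/-- A `U`-bimodule regarded as an `S`-bimodule. -/
abbrev res : ModuleCat.{u} (Ae k (Env k S L)) ⥤ ModuleCat.{u} (Ae k S) :=
  ModuleCat.restrictScalars (inSe k S L).toRingHom

theorem res_map_exact (X : ShortComplex (ModuleCat.{u} (Ae k (Env k S L)))) (h : X.Exact) :
    (X.map (res k S L)).Exact := by
  rw [ShortComplex.ShortExact.moduleCat_exact_iff_function_exact] at h ⊢
  exact h

theorem res_preserves :
    PreservesFiniteLimits (res k S L) ∧ PreservesFiniteColimits (res k S L) :=
  ((Functor.exact_tfae (res k S L)).out 1 3).mp (res_map_exact k S L)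

instance : PreservesFiniteLimits (res k S L) := (res_preserves k S L).1

instance : PreservesFiniteColimits (res k S L) := (res_preserves k S L).2

variable {k S L}

/-- The value at `s` of a morphism of `S`-bimodules from `S` to a `U`-bimodule `M`. -/
def val {M : ModuleCat.{u} (Ae k (Env k S L))} (φ : regular k S ⟶ (res k S L).obj M) :
    S →+ M where
  toFun s := φ.hom s
  map_zero' := φ.hom.map_zero
  map_add' := φ.hom.map_add

theorem val_ext {M : ModuleCat.{u} (Ae k (Env k S L))}
    {φ ψ : regular k S ⟶ (res k S L).obj M} (h : ∀ s, val φ s = val ψ s) : φ = ψ := by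
  ext s
  exact h s

theorem regular_smul (a b s : S) :
    (a ⊗ₜ[k] op b : Ae k S) • @id (regular k S) s = @id (regular k S) (a * s * b : S) := by
  let : Module (Ae k S) S := TensorProduct.Algebra.module
  change (a ⊗ₜ[k] op b : Ae k S) • s = a * s * b
  rw [TensorProduct.Algebra.smul_def]
  simp [mul_assoc]

theorem val_bimod {M : ModuleCat.{u} (Ae k (Env k S L))}
    (φ : regular k S ⟶ (res k S L).obj M) (a b s : S) :
    val φ (a * s * b) =
      (inS k S L a ⊗ₜ[k] op (inS k S L b) : Ae k (Env k S L)) • val φ s := by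
  have h := φ.hom.map_smul (a ⊗ₜ[k] op b : Ae k S) (@id (regular k S) s)
  rw [regular_smul] at h
  exact h

/-- An additive map `S → M` compatible with the two actions of `S`, as a morphism. -/
def mkHom {M : ModuleCat.{u} (Ae k (Env k S L))} (f : S →+ M)
    (h : ∀ a b s : S, f (a * s * b) =
      (inS k S L a ⊗ₜ[k] op (inS k S L b) : Ae k (Env k S L)) • f s) :
    regular k S ⟶ (res k S L).obj M :=
  ModuleCat.ofHom (X := regular k S) (Y := (res k S L).obj M)
    { toFun := f
      map_add' := f.map_add
      map_smul' := by
        intro x s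
        induction x using TensorProduct.induction_on with
        | zero =>
          exact (congrArg f (zero_smul (Ae k S) s)).trans
            (f.map_zero.trans (zero_smul (Ae k S) (A := (res k S L).obj M) (f s)).symm)
        | tmul a b =>
          have h' := h a b.unop s
          have h'' := regular_smul (k := k) a b.unop s
          exact (congrArg f h'').trans h'
        | add x y hx hy =>
          exact (congrArg f (add_smul x y s)).trans
            (((f.map_add _ _).trans (congrArg₂ (· + ·) hx hy)).trans
              (add_smul x y (M := (res k S L).obj M) (f s)).symm) }

theorem val_mkHom {M : ModuleCat.{u} (Ae k (Env k S L))} (f : S →+ M) (h) (s : S) :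
    val (mkHom f h) s = f s := rfl

theorem val_add {M : ModuleCat.{u} (Ae k (Env k S L))}
    (φ ψ : regular k S ⟶ (res k S L).obj M) (s : S) : val (φ + ψ) s = val φ s + val ψ s := rfl

theorem val_sub {M : ModuleCat.{u} (Ae k (Env k S L))}
    (φ ψ : regular k S ⟶ (res k S L).obj M) (s : S) : val (φ - ψ) s = val φ s - val ψ s := rfl

theorem val_smul {M : ModuleCat.{u} (Ae k (Env k S L))} (c : k)
    (φ : regular k S ⟶ (res k S L).obj M) (s : S) :
    val (c • φ) s = (algebraMap k (Ae k (Env k S L)) c) • val φ s := by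
  have h : val (c • φ) s = (inSe k S L (algebraMap k (Ae k S) c)) • val φ s := rfl
  rw [h, AlgHom.commutes]

theorem val_comp {M N : ModuleCat.{u} (Ae k (Env k S L))}
    (φ : regular k S ⟶ (res k S L).obj M) (g : M ⟶ N) (s : S) :
    val (φ ≫ (res k S L).map g) s = g.hom (val φ s) := rfl

variable (k S L) in
/-- The element `u ⊗ 1` of `U^e`. -/
abbrev lft (u : Env k S L) : Ae k (Env k S L) := u ⊗ₜ[k] 1

variable (k S L) in
/-- The element `1 ⊗ u` of `U^e`. -/
abbrev rgt (u : Env k S L) : Ae k (Env k S L) := 1 ⊗ₜ[k] op u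

variable (k S L) in
theorem rgt_mul_rgt (u v : Env k S L) : rgt k S L u * rgt k S L v = rgt k S L (v * u) := by
  simp [rgt]

variable (k S L) in
theorem lft_mul_lft (u v : Env k S L) : lft k S L u * lft k S L v = lft k S L (u * v) := by
  simp [lft]

variable (k S L) in
theorem lft_mul_rgt (u v : Env k S L) : lft k S L u * rgt k S L v = u ⊗ₜ[k] op v := by
  simp [lft, rgt]

variable (k S L) in
theorem rgt_mul_lft (u v : Env k S L) : rgt k S L v * lft k S L u = u ⊗ₜ[k] op v := by
  simp [lft, rgt]

theorem val_left {M : ModuleCat.{u} (Ae k (Env k S L))}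
    (φ : regular k S ⟶ (res k S L).obj M) (a s : S) :
    val φ (a * s) = lft k S L (inS k S L a) • val φ s := by
  simpa using val_bimod φ a 1 s

theorem val_right {M : ModuleCat.{u} (Ae k (Env k S L))}
    (φ : regular k S ⟶ (res k S L).obj M) (a s : S) :
    val φ (a * s) = rgt k S L (inS k S L a) • val φ s := by
  simpa [mul_comm] using val_bimod φ 1 a s

/-- The action of `t ∈ S` on `Hom_{S^e}(S, M)`: `(t φ)(s) = (t ⊗ 1) φ(s)`. -/
def homActS (M : ModuleCat.{u} (Ae k (Env k S L))) (t : S)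
    (φ : regular k S ⟶ (res k S L).obj M) : regular k S ⟶ (res k S L).obj M :=
  mkHom ((DistribSMul.toAddMonoidHom M (lft k S L (inS k S L t))).comp (val φ)) (by
    intro a b s
    simp only [AddMonoidHom.comp_apply, DistribSMul.toAddMonoidHom_apply]
    rw [← val_left, ← val_left, ← val_bimod]
    congr 1
    ring)

theorem val_homActS (M : ModuleCat.{u} (Ae k (Env k S L))) (t : S)
    (φ : regular k S ⟶ (res k S L).obj M) (s : S) :
    val (homActS M t φ) s = lft k S L (inS k S L t) • val φ s := rfl

variable [LieRinehartRing S L]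

/-- The action of `α ∈ L` on `Hom_{S^e}(S, M)`:
`(α φ)(s) = (α ⊗ 1) φ(s) - (1 ⊗ α) φ(s) - φ(α_S(s))`. -/
def homActL (M : ModuleCat.{u} (Ae k (Env k S L))) (α : L)
    (φ : regular k S ⟶ (res k S L).obj M) : regular k S ⟶ (res k S L).obj M :=
  mkHom
    { toFun := fun s => lft k S L (inL k S L α) • val φ s - rgt k S L (inL k S L α) • val φ s
        - val φ ⁅α, s⁆
      map_zero' := by simp
      map_add' := by
        intro s t
        simp only [map_add, smul_add, lie_add]
        abel } (by
    intro a b s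
    have hl : ⁅α, a * s * b⁆ = a * s * ⁅α, b⁆ + (a * ⁅α, s⁆ * b + ⁅α, a⁆ * s * b) := by
      simp only [LieRinehartRing.leibniz_mul_right, smul_eq_mul]
      ring
    have e₁ := inL_mul_inS k S L α a
    have e₂ := inL_mul_inS k S L α b
    simp only [AddMonoidHom.coe_mk, ZeroHom.coe_mk, hl, map_add, val_bimod, smul_sub, ← mul_smul]
    have key : lft k S L (inL k S L α) * (inS k S L a ⊗ₜ[k] op (inS k S L b))
        - rgt k S L (inL k S L α) * (inS k S L a ⊗ₜ[k] op (inS k S L b))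
        - inS k S L a ⊗ₜ[k] op (inS k S L ⁅α, b⁆) - inS k S L ⁅α, a⁆ ⊗ₜ[k] op (inS k S L b)
        = (inS k S L a ⊗ₜ[k] op (inS k S L b)) * lft k S L (inL k S L α)
          - (inS k S L a ⊗ₜ[k] op (inS k S L b)) * rgt k S L (inL k S L α) := by
      simp only [Algebra.TensorProduct.tmul_mul_tmul, one_mul, mul_one, ← op_mul, e₁, e₂,
        TensorProduct.add_tmul, TensorProduct.tmul_add, MulOpposite.op_add]
      abel
    have key' := congrArg (· • val φ s) key
    simp only [sub_smul] at key'
    rw [← key']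
    abel)

theorem val_homActL (M : ModuleCat.{u} (Ae k (Env k S L))) (α : L)
    (φ : regular k S ⟶ (res k S L).obj M) (s : S) :
    val (homActL M α φ) s = lft k S L (inL k S L α) • val φ s
      - rgt k S L (inL k S L α) • val φ s - val φ ⁅α, s⁆ := rfl

variable (k S L)
variable [LieRinehartAlgebra k S L]

/-- The action of `U` on `S`: `S` acts by multiplication and `L` by derivations. -/
def baseAction : Env k S L →ₐ[k] Module.End k S :=
  lift (Algebra.lmul k S) (LieModule.toEnd k L S)
    (fun s α => by ext t; simp) (fun α s => by ext t; simp)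

/-- `S` as a left `U`-module. -/
def base : ModuleCat.{u} (Env k S L) :=
  letI : Module (Env k S L) S := Module.compHom S (baseAction k S L).toRingHom
  ModuleCat.of (Env k S L) S

/-- Lie–Rinehart cohomology `H_S^n(L, N) = Ext_U^n(S, N)`. -/
abbrev LRCohomology (N : ModuleCat.{u} (Env k S L)) (n : ℕ) : Type u :=
  Ext (base k S L) N n

variable {k S L}

/-- The action of `S` on `Hom_{S^e}(S, M)` as a morphism of algebras. -/
def homActSAlg (M : ModuleCat.{u} (Ae k (Env k S L))) :
    S →ₐ[k] Module.End k (regular k S ⟶ (res k S L).obj M) where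
  toFun t :=
    { toFun := homActS M t
      map_add' := fun φ ψ => val_ext fun s => by simp only [val_homActS, val_add, smul_add]
      map_smul' := fun c φ => val_ext fun s => by
        simp only [val_homActS, val_smul, RingHom.id_apply, ← mul_smul, Algebra.commutes] }
  map_one' := LinearMap.ext fun φ => val_ext fun s => by
    change val (homActS M 1 φ) s = val φ s
    rw [val_homActS, ← val_left, one_mul]
  map_mul' t t' := LinearMap.ext fun φ => val_ext fun s => by
    change val (homActS M (t * t') φ) s = val (homActS M t (homActS M t' φ)) s
    simp only [val_homActS, ← mul_smul, lft_mul_lft, map_mul]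
  map_zero' := LinearMap.ext fun φ => val_ext fun s => by
    change val (homActS M 0 φ) s = 0
    rw [val_homActS, ← val_left, zero_mul, map_zero]
  map_add' t t' := LinearMap.ext fun φ => val_ext fun s => by
    change val (homActS M (t + t') φ) s = val (homActS M t φ + homActS M t' φ) s
    simp only [val_add, val_homActS, map_add, lft, TensorProduct.add_tmul, add_smul]
  commutes' c := LinearMap.ext fun φ => val_ext fun s => by
    change val (homActS M (algebraMap k S c) φ) s = val (c • φ) s
    rw [val_homActS, val_smul, AlgHom.commutes]
    rfl

/-- The action of `L` on `Hom_{S^e}(S, M)` as a morphism of Lie algebras. -/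
def homActLLie (M : ModuleCat.{u} (Ae k (Env k S L))) :
    L →ₗ⁅k⁆ Module.End k (regular k S ⟶ (res k S L).obj M) where
  toFun α :=
    { toFun := homActL M α
      map_add' := fun φ ψ => val_ext fun s => by
        simp only [val_homActL, val_add, smul_add]
        abel
      map_smul' := fun c φ => val_ext fun s => by
        simp only [val_homActL, val_smul, RingHom.id_apply, ← mul_smul, smul_sub,
          Algebra.commutes] }
  map_add' α β := LinearMap.ext fun φ => val_ext fun s => by
    change val (homActL M (α + β) φ) s = val (homActL M α φ + homActL M β φ) s
    simp only [val_add, val_homActL, map_add, lft, rgt, TensorProduct.add_tmul, MulOpposite.op_add,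
      TensorProduct.tmul_add, add_smul, add_lie]
    abel
  map_smul' c α := LinearMap.ext fun φ => val_ext fun s => by
    change val (homActL M (c • α) φ) s = val (c • homActL M α φ) s
    have h : val φ (c • ⁅α, s⁆) = algebraMap k (Ae k (Env k S L)) c • val φ ⁅α, s⁆ := by
      rw [Algebra.smul_def, val_left, AlgHom.commutes]
      rfl
    simp only [val_homActL, val_smul, map_smul, smul_lie, h, smul_sub, lft, rgt,
      MulOpposite.op_smul, TensorProduct.tmul_smul, ← TensorProduct.smul_tmul']
    have hc (x : Ae k (Env k S L)) (m : M) :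
        (c • x) • m = algebraMap k (Ae k (Env k S L)) c • x • m :=
      (congrArg (· • m) (Algebra.smul_def c x)).trans (mul_smul _ _ _)
    exact congrArg (· - algebraMap k (Ae k (Env k S L)) c • val φ ⁅α, s⁆)
      (congrArg₂ (· - ·) (hc _ _) (hc _ _))
  map_lie' {α β} := LinearMap.ext fun φ => val_ext fun s => by
    change val (homActL M ⁅α, β⁆ φ) s
      = val (homActL M α (homActL M β φ) - homActL M β (homActL M α φ)) s
    simp only [val_sub, val_homActL, smul_sub, ← mul_smul, lft_mul_lft, rgt_mul_rgt,
      lft_mul_rgt, rgt_mul_lft, LieHom.map_lie, Ring.lie_def, lft, rgt, TensorProduct.sub_tmul,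
      TensorProduct.tmul_sub, MulOpposite.op_sub, sub_smul, lie_lie, map_sub]
    abel

/-- The action of `U` on `Hom_{S^e}(S, M)`. -/
def homAction (M : ModuleCat.{u} (Ae k (Env k S L))) :
    Env k S L →ₐ[k] Module.End k (regular k S ⟶ (res k S L).obj M) :=
  lift (homActSAlg M) (homActLLie M)
    (fun t α => LinearMap.ext fun φ => val_ext fun s => by
      change val (homActS M t (homActL M α φ)) s = val (homActL M (t • α) φ) s
      simp only [val_homActS, val_homActL, smul_sub, ← inS_mul_inL, LieRinehartRing.lie_smul_eq_mul,
        val_left, ← lft_mul_lft, ← rgt_mul_rgt, mul_smul]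
      rw [← val_right, val_left, ← mul_smul (lft k S L (inS k S L t)) (rgt k S L _),
        ← mul_smul (rgt k S L _), lft_mul_rgt, rgt_mul_lft])
    (fun α t => LinearMap.ext fun φ => val_ext fun s => by
      change val (homActL M α (homActS M t φ) - homActS M t (homActL M α φ)) s
        = val (homActS M ⁅α, t⁆ φ) s
      simp only [val_sub, val_homActS, val_homActL, smul_sub, ← mul_smul, lft_mul_lft,
        lft_mul_rgt, rgt_mul_lft, inL_mul_inS, lft, TensorProduct.add_tmul, add_smul]
      abel)

theorem homAction_comp {M N : ModuleCat.{u} (Ae k (Env k S L))} (g : M ⟶ N) (a : Env k S L)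
    (φ : regular k S ⟶ (res k S L).obj M) :
    homAction M a φ ≫ (res k S L).map g = homAction N a (φ ≫ (res k S L).map g) := by
  induction a using Env.induction generalizing φ with
  | inS t =>
    simp only [homAction, lift_inS]
    refine val_ext fun s => ?_
    change g.hom (lft k S L (inS k S L t) • val φ s) = _
    rw [map_smul]
    rfl
  | inL α =>
    simp only [homAction, lift_inL]
    refine val_ext fun s => ?_
    change g.hom (lft k S L (inL k S L α) • val φ s - rgt k S L (inL k S L α) • val φ s
      - val φ ⁅α, s⁆) = _
    rw [map_sub, map_sub, map_smul, map_smul]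
    rfl
  | algebraMap c =>
    simp only [AlgHom.commutes, Module.algebraMap_end_apply]
    refine val_ext fun s => ?_
    rw [val_comp, val_smul, val_smul, map_smul, val_comp]
  | mul a b ha hb => simp only [map_mul, Module.End.mul_apply, ha, hb]
  | add a b ha hb =>
    simp only [map_add, LinearMap.add_apply, ← ha, ← hb, Preadditive.add_comp]

theorem homAction_cocycle {M N : ModuleCat.{u} (Ae k (Env k S L))} (g : M ⟶ N) (a : Env k S L)
    (φ : regular k S ⟶ (res k S L).obj M) (h : φ ≫ (res k S L).map g = 0) :
    homAction M a φ ≫ (res k S L).map g = 0 := by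
  rw [homAction_comp, h, map_zero]

end Modules

section CocycleClass

variable {k S L : Type u} [Field k] [CommRing S] [Algebra k S] [LieRing L] [LieAlgebra k L]
  [Module S L] [LieRingModule L S]

/-- Let `M → I` be an injective resolution of a `U`-bimodule `M`. This is the class in
`H^q(S, M) = Ext^q_{S^e}(S, M)` of a cocycle `f` of degree `q` of `Hom_{S^e}(S, I)`. With `Z^q` the
kernel of `I^q → I^{q+1}`, it is the composition of the morphism `S → Z^q` given by `f` with the
class in `Ext^q_{S^e}(Z^q, M)` of the exact sequence `M → I^0 → ⋯ → I^{q-1} → Z^q`; the latter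
class is the restriction to `S^e` of the class in `Ext^q_{U^e}(Z^q, M)` of the inclusion
`Z^q → I^q`. -/
def cocycleClass {M : ModuleCat.{u} (Ae k (Env k S L))} (I : InjectiveResolution M) (q : ℕ)
    (f : regular k S ⟶ (res k S L).obj (I.cocomplex.X q))
    (hf : f ≫ (res k S L).map (I.cocomplex.d q (q + 1)) = 0) :
    HH k S ((res k S L).obj M) q :=
  (Ext.mk₀ (kernel.lift ((res k S L).map (I.cocomplex.d q (q + 1))) f hf ≫
      (PreservesKernel.iso (res k S L) (I.cocomplex.d q (q + 1))).inv)).comp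
    ((I.extMk (kernel.ι (I.cocomplex.d q (q + 1))) (q + 1) rfl
      (kernel.condition _)).mapExactFunctor (res k S L)) (zero_add q)

end CocycleClass

/-! ### Convergence of first-quadrant spectral sequences -/

/-- A first-quadrant cohomological spectral sequence `E` of `k`-vector spaces converges to `H`:
every `H n` has a finite decreasing filtration `H n = F 0 ⊇ F 1 ⊇ ⋯ ⊇ F (n + 1) = 0` with
`F p / F (p + 1) ≅ E_∞^{p, n - p}`. For `r ≥ max (p + 1) (q + 2)` no non-zero differential of the
page `E_r` starts or ends at `(p, q)`, and therefore `E_∞^{p,q} = E_r^{p,q}`. -/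
def ConvergesTo {k : Type u} [Field k] (E : E₂CohomologicalSpectralSequenceNat (ModuleCat.{u} k))
    (H : ℕ → ModuleCat.{u} k) : Prop :=
  ∀ n : ℕ, ∃ F : ℕ → Submodule k (H n),
    Antitone F ∧ F 0 = ⊤ ∧ F (n + 1) = ⊥ ∧
    ∀ p q : ℕ, p + q = n → ∀ (r : ℤ) (hr : 2 ≤ r), (p : ℤ) + 1 ≤ r → (q : ℤ) + 2 ≤ r →
      Nonempty ((E.page r hr).X (p, q) ≃ₗ[k] (F p ⧸ (F (p + 1)).submoduleOf (F p)))

end LieRinehart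
end

/-! Write `G M` for the `U`-module of `S^e`-morphisms from `S` to a `U`-bimodule `M`. The spectral
sequence is a Grothendieck spectral sequence and rests on two facts. First, `Hom_U(S, G M)` is
naturally `Hom_{U^e}(U, M)` (`baseHomEquiv`), because both are the space of those `m` in `M` with `u
m = m u` for all `u`. Second, `G` preserves injective objects (`injective_homFunctor_obj`), because
it is right adjoint to `N ↦ U ⊗_S N`, which is exact as soon as `U` is flat as a right `S`-module.

Let `I` be an injective resolution of `M`. Then `K = G I` is a complex of injective `U`-modules, and
`Hom_U(S, K)` computes `H^*(U, M)`. The cohomology of `K` is `H^*(S, M)`, because `U^e` is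
projective over `S^e` and so `I` stays an injective resolution after restriction to `S^e`. Applying
`Hom(S, -)` in the derived category of `U` to the truncations of `K` gives a first-quadrant spectral
object (`homSpectralObject`). The part of `K` in the single degree `q` is `H^q(K)[-q]`, which
produces `Ext^p_U(S, H^q(K))` on the second page. Convergence is a general property of
first-quadrant spectral objects (`convergesTo_of_isFirstQuadrant`, `exists_spectralSequence`).

Projectivity of `U` over `S` comes from a Poincaré–Birkhoff–Witt theorem. If `L` is free over `S`,
the ordered monomials in a basis form a basis of `U` over `S` on the left and on the right
(`pbwLeft_bijective`, `pbwRight_bijective`). If `L` is only projective, then `L ⊕ S^(B)` is free for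
a suitable `B`. It is again a Lie–Rinehart algebra, and `U` is a retract of its enveloping algebra,
compatibly with `S`.

For the first two assertions, every cocycle class is a pullback of one class in `Ext^q_{U^e}(Z^q,
M)`, restricted to `S^e`. An exact functor that preserves injectives preserves the property that
pullbacks of this class give all classes and vanish exactly on coboundaries (`IsUniversalClass`).
Since `U` acts on `Hom_{S^e}(S, M)` naturally in `M`, the action preserves cocycles and
coboundaries, and comparison maps show that the induced action does not depend on the resolution. -/

noncomputable section

namespace LieRinehart

/-! ### The Poincaré–Birkhoff–Witt representation on the free module on multisets. -/

section PBW

set_option linter.unusedSectionVars false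

attribute [local instance 100] LieRing.ofAssociativeRing

variable {S L X : Type u} [CommRing S] [LieRing L] [Module S L] [LieRingModule L S]

/-- The operator on the free module with basis `z_M`, with `M` a multiset, that sends `s z_M` to
`α_S(s) z_M + s c_M(α)`. -/
def opOf (c : Multiset X → L →ₗ[S] (Multiset X →₀ S)) (α : L) :
    (Multiset X →₀ S) →+ (Multiset X →₀ S) :=
  Finsupp.liftAddHom fun M => (Finsupp.singleAddHom M).comp
    (AddMonoidHom.mk' (fun s : S => ⁅α, s⁆) (lie_add α)) +
      (LinearMap.toSpanSingleton S _ (c M α)).toAddMonoidHom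

theorem opOf_single (c : Multiset X → L →ₗ[S] (Multiset X →₀ S)) (α : L) (M : Multiset X) (s : S) :
    opOf c α (Finsupp.single M s) = Finsupp.single M ⁅α, s⁆ + s • c M α := by
  simp [opOf]

variable (S X) in
/-- The elements of degree less than `n` of the free module on the multisets. -/
abbrev degLT (n : ℕ) : Submodule S (Multiset X →₀ S) :=
  Finsupp.supported S S {M | M.card < n}

theorem single_mem_degLT {n : ℕ} {M : Multiset X} (h : M.card < n) (s : S) :
    Finsupp.single M s ∈ degLT S X n :=
  Finsupp.single_mem_supported S s h

theorem degLT_mono {m n : ℕ} (h : m ≤ n) : degLT S X m ≤ degLT S X n :=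
  Finsupp.supported_mono fun _ hM => lt_of_lt_of_le hM h

theorem exists_mem_degLT (v : Multiset X →₀ S) : ∃ n, v ∈ degLT S X n := by
  refine ⟨v.support.sup Multiset.card + 1, fun M hM => ?_⟩
  exact Nat.lt_succ_of_le (Finset.le_sup (f := Multiset.card) hM)

theorem degLT_induction {n : ℕ} {P : (Multiset X →₀ S) → Prop} (zero : P 0)
    (add : ∀ v w, P v → P w → P (v + w))
    (single : ∀ (M : Multiset X) (s : S), M.card < n → P (Finsupp.single M s))
    {v : Multiset X →₀ S} (hv : v ∈ degLT S X n) : P v := by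
  have h : ∀ M ∈ v.support, M.card < n := fun M hM => hv hM
  rw [← Finsupp.sum_single v]
  exact Finset.sum_induction _ P add zero fun M hM => single M _ (h M hM)

theorem opOf_congr {c c' : Multiset X → L →ₗ[S] (Multiset X →₀ S)} {n : ℕ}
    (h : ∀ M : Multiset X, M.card < n → c M = c' M) (α : L) {v : Multiset X →₀ S}
    (hv : v ∈ degLT S X n) : opOf c α v = opOf c' α v := by
  refine degLT_induction (P := fun v => opOf c α v = opOf c' α v) (by simp)
    (fun v w hv hw => ?_) (fun M s hM => ?_) hv
  · rw [map_add, map_add, hv, hw]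
  · simp [opOf_single, h M hM]

theorem opOf_mem_degLT {c : Multiset X → L →ₗ[S] (Multiset X →₀ S)} {n : ℕ}
    (h : ∀ M : Multiset X, M.card < n → ∀ α, c M α ∈ degLT S X (M.card + 2)) (α : L)
    {v : Multiset X →₀ S} (hv : v ∈ degLT S X n) : opOf c α v ∈ degLT S X (n + 1) := by
  refine degLT_induction (P := fun v => opOf c α v ∈ degLT S X (n + 1)) (by simp)
    (fun v w hv hw => ?_) (fun M s hM => ?_) hv
  · rw [map_add]
    exact add_mem hv hw
  · rw [opOf_single]
    exact add_mem (single_mem_degLT (by omega) _)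
      (Submodule.smul_mem _ _ (degLT_mono (by omega) (h M hM α)))

theorem opOf_add (c : Multiset X → L →ₗ[S] (Multiset X →₀ S)) (α β : L) (v : Multiset X →₀ S) :
    opOf c (α + β) v = opOf c α v + opOf c β v := by
  induction v using Finsupp.induction_linear with
  | zero => simp
  | add v w hv hw => simp only [map_add, hv, hw]; abel
  | single M s => simp only [opOf_single, add_lie, map_add, Finsupp.single_add, smul_add]; abel

variable [LinearOrder X] (b : Module.Basis X S L)

/-- The coefficients of the action of the enveloping algebra on the free module on the multisets:
`pbwCoeff b M α` is `α z_M`. -/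
def pbwCoeff (M : Multiset X) : L →ₗ[S] (Multiset X →₀ S) :=
  b.constr S fun i =>
    if h : ∀ j ∈ M, i ≤ j then Finsupp.single (i ::ₘ M) 1 else
      have hM : M.toFinset.Nonempty := by
        obtain ⟨j, hj, -⟩ := not_forall₂.mp h
        exact ⟨j, by simpa using hj⟩
      let j := M.toFinset.min' hM
      -- The truncation makes the recursion visibly well-founded. It discards nothing that is used,
      -- by the degree bound `pbwCoeff_basis_sub_mem`.
      let c : Multiset X → L →ₗ[S] (Multiset X →₀ S) := fun N =>
        if N.card < M.card then pbwCoeff N else 0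
      -- With `N = M.erase j` this is `b_j (b_i z_N) + [b_i, b_j] z_N`. The leading part `z_{i + N}`
      -- of `b_i z_N` is treated separately: `b_j` sends it to `z_{i + M}` because `j` is minimal.
      -- What remains has degree at most `|N|`.
      Finsupp.single (i ::ₘ M) 1
        + opOf c (b j) (c (M.erase j) (b i) - Finsupp.single (i ::ₘ M.erase j) 1)
        + c (M.erase j) ⁅b i, b j⁆
termination_by M.card

theorem pbwCoeff_of_le {M : Multiset X} {i : X} (h : ∀ j ∈ M, i ≤ j) :
    pbwCoeff b M (b i) = Finsupp.single (i ::ₘ M) 1 := by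
  rw [pbwCoeff, Module.Basis.constr_basis, dif_pos h]

/-- The truncated family is kept as an unknown `c` here, because replacing it by `pbwCoeff` inside
`opOf` needs the degree bound, which is itself proved from this recursion. -/
theorem pbwCoeff_cons_aux {N : Multiset X} {i j : X} (hj : ∀ l ∈ N, j ≤ l) (hij : j < i) :
    ∃ c : Multiset X → L →ₗ[S] (Multiset X →₀ S), (∀ P, P.card < N.card + 1 → c P = pbwCoeff b P) ∧
    pbwCoeff b (j ::ₘ N) (b i) = Finsupp.single (i ::ₘ j ::ₘ N) 1
      + opOf c (b j) (c N (b i) - Finsupp.single (i ::ₘ N) 1) + c N ⁅b i, b j⁆ := by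
  refine ⟨fun P => if P.card < (j ::ₘ N).card then pbwCoeff b P else 0, fun P hP => ?_, ?_⟩
  · simp [hP]
  · have h : ¬ ∀ l ∈ j ::ₘ N, i ≤ l := fun h => not_lt_of_ge (h j (by simp)) hij
    have hmin (hM : (j ::ₘ N).toFinset.Nonempty) : (j ::ₘ N).toFinset.min' hM = j := by
      refine le_antisymm (Finset.min'_le _ _ (by simp)) (Finset.le_min' _ _ _ fun l hl => ?_)
      simp only [Multiset.mem_toFinset, Multiset.mem_cons] at hl
      rcases hl with rfl | hl
      · exact le_rfl
      · exact hj l hl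
    rw [pbwCoeff, Module.Basis.constr_basis, dif_neg h]
    simp only [hmin, Multiset.erase_cons_head]

theorem exists_eq_cons_of_ne_zero {M : Multiset X} (h : M ≠ 0) :
    ∃ j N, M = j ::ₘ N ∧ ∀ l ∈ N, j ≤ l := by
  have hM : M.toFinset.Nonempty := by simpa [Finset.nonempty_iff_ne_empty] using h
  have hj := Multiset.mem_toFinset.mp (M.toFinset.min'_mem hM)
  refine ⟨M.toFinset.min' hM, M.erase (M.toFinset.min' hM), (Multiset.cons_erase hj).symm,
    fun l hl => Finset.min'_le _ _ ?_⟩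
  exact Multiset.mem_toFinset.mpr (Multiset.mem_of_mem_erase hl)

theorem exists_eq_cons_of_not_le {M : Multiset X} {i : X} (h : ¬ ∀ j ∈ M, i ≤ j) :
    ∃ j N, M = j ::ₘ N ∧ (∀ l ∈ N, j ≤ l) ∧ j < i := by
  obtain ⟨j, N, rfl, hN⟩ := exists_eq_cons_of_ne_zero (M := M) (by rintro rfl; simp at h)
  refine ⟨j, N, rfl, hN, lt_of_not_ge fun hij => h fun l hl => ?_⟩
  rcases Multiset.mem_cons.mp hl with rfl | hl
  · exact hij
  · exact hij.trans (hN l hl)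

theorem mem_of_basis_mem {V : Type*} [AddCommGroup V] [Module S V] (f : L →ₗ[S] V)
    (W : Submodule S V) (h : ∀ i, f (b i) ∈ W) (α : L) : f α ∈ W := by
  have : (⊤ : Submodule S L) ≤ W.comap f := by
    rw [← b.span_eq, Submodule.span_le]
    rintro _ ⟨i, rfl⟩
    exact h i
  exact this trivial

/-- Acting by an element of `L` raises the degree by at most one. By induction the argument of
`opOf` in the recursion has degree at most `|N|`, so both correction terms have degree at most `|N|
+ 1 = |M|`. -/
theorem pbwCoeff_basis_sub_mem (M : Multiset X) (i : X) :
    pbwCoeff b M (b i) - Finsupp.single (i ::ₘ M) 1 ∈ degLT S X (M.card + 1) := by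
  by_cases h : ∀ j ∈ M, i ≤ j
  · simp [pbwCoeff_of_le b h]
  · obtain ⟨j, N, rfl, hN, hij⟩ := exists_eq_cons_of_not_le h
    obtain ⟨c, hc, e⟩ := pbwCoeff_cons_aux b hN hij
    have hc' (P : Multiset X) (hP : P.card < N.card + 1) (α : L) :
        c P α ∈ degLT S X (P.card + 2) := by
      rw [hc P hP]
      refine mem_of_basis_mem b _ _ (fun l => ?_) α
      rw [← sub_add_cancel (pbwCoeff b P (b l)) (Finsupp.single (l ::ₘ P) 1)]
      exact add_mem (degLT_mono (by omega) (pbwCoeff_basis_sub_mem P l))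
        (single_mem_degLT (by simp) _)
    rw [e, add_assoc, add_sub_cancel_left, Multiset.card_cons]
    refine add_mem (opOf_mem_degLT hc' _ ?_) (hc' N (by omega) _)
    rw [hc N (by omega)]
    exact pbwCoeff_basis_sub_mem N i
termination_by M.card
decreasing_by all_goals (subst_vars; simp only [Multiset.card_cons]; omega)

theorem pbwCoeff_mem (M : Multiset X) (α : L) : pbwCoeff b M α ∈ degLT S X (M.card + 2) := by
  refine mem_of_basis_mem b _ _ (fun l => ?_) α
  rw [← sub_add_cancel (pbwCoeff b M (b l)) (Finsupp.single (l ::ₘ M) 1)]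
  exact add_mem (degLT_mono (by omega) (pbwCoeff_basis_sub_mem b M l))
    (single_mem_degLT (by simp) _)

/-- The action of `L` on the free module on the multisets. -/
abbrev pbwAct (α : L) : (Multiset X →₀ S) →+ (Multiset X →₀ S) := opOf (pbwCoeff b) α

theorem pbwAct_mem (α : L) {n : ℕ} {v : Multiset X →₀ S} (hv : v ∈ degLT S X n) :
    pbwAct b α v ∈ degLT S X (n + 1) :=
  opOf_mem_degLT (fun M _ => pbwCoeff_mem b M) α hv

variable [LieRinehartRing S L]

theorem opOf_smul (c : Multiset X → L →ₗ[S] (Multiset X →₀ S)) (t : S) (α : L)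
    (v : Multiset X →₀ S) : opOf c (t • α) v = t • opOf c α v := by
  induction v using Finsupp.induction_linear with
  | zero => simp
  | add v w hv hw => simp only [map_add, hv, hw, smul_add]
  | single M s => simp [opOf_single, smul_comm t s]

theorem opOf_apply_smul (c : Multiset X → L →ₗ[S] (Multiset X →₀ S)) (t : S) (α : L)
    (v : Multiset X →₀ S) : opOf c α (t • v) = ⁅α, t⁆ • v + t • opOf c α v := by
  induction v using Finsupp.induction_linear with
  | zero => simp
  | add v w hv hw => simp only [map_add, hv, hw, smul_add]; abel
  | single M s =>
    simp only [Finsupp.smul_single, smul_eq_mul, opOf_single, LieRinehartRing.leibniz_mul_right,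
      Finsupp.single_add, smul_add, mul_smul]
    abel

theorem lie_one_eq_zero (α : L) : ⁅α, (1 : S)⁆ = 0 := by
  simpa using LieRinehartRing.leibniz_mul_right α (1 : S) 1

theorem pbwAct_single_one (α : L) (M : Multiset X) :
    pbwAct b α (Finsupp.single M 1) = pbwCoeff b M α := by
  rw [opOf_single, lie_one_eq_zero, Finsupp.single_zero, zero_add, one_smul]

theorem pbwAct_single_of_le {M : Multiset X} {i : X} (h : ∀ j ∈ M, i ≤ j) :
    pbwAct b (b i) (Finsupp.single M 1) = Finsupp.single (i ::ₘ M) 1 := by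
  rw [pbwAct_single_one, pbwCoeff_of_le b h]

/-- The recursion in its intended form: passing `b i` across the smaller `b j` costs a bracket. The
degree bound removes the truncation, and the separated leading term is reabsorbed. -/
theorem pbwAct_cons {N : Multiset X} {i j : X} (hj : ∀ l ∈ N, j ≤ l) (hij : j < i) :
    pbwAct b (b i) (Finsupp.single (j ::ₘ N) 1) =
      pbwAct b (b j) (pbwAct b (b i) (Finsupp.single N 1))
        + pbwAct b ⁅b i, b j⁆ (Finsupp.single N 1) := by
  obtain ⟨c, hc, e⟩ := pbwCoeff_cons_aux b hj hij
  have hj' : ∀ l ∈ i ::ₘ N, j ≤ l := by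
    intro l hl
    rcases Multiset.mem_cons.mp hl with rfl | hl
    · exact hij.le
    · exact hj l hl
  rw [hc N (by omega), opOf_congr hc _ (pbwCoeff_basis_sub_mem b N i), map_sub,
    pbwAct_single_of_le b hj', Multiset.cons_swap] at e
  rw [pbwAct_single_one, pbwAct_single_one, pbwAct_single_one, e]
  abel

/-- The bracket of the operators attached to `α` and `β` is, on `v`, the one attached to
`⁅α, β⁆`. -/
def CommAt (α β : L) (v : Multiset X →₀ S) : Prop :=
  pbwAct b α (pbwAct b β v) - pbwAct b β (pbwAct b α v) = pbwAct b ⁅α, β⁆ v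

variable {b}

theorem CommAt.symm {α β : L} {v : Multiset X →₀ S} (h : CommAt b α β v) : CommAt b β α v := by
  have := opOf_smul (pbwCoeff b) (-1) ⁅α, β⁆ v
  rw [neg_one_smul, neg_one_smul, lie_skew] at this
  rw [CommAt, this, ← h, neg_sub]

theorem commAt_refl (α : L) (v : Multiset X →₀ S) : CommAt b α α v := by
  have := opOf_smul (pbwCoeff b) 0 α v
  rw [zero_smul, zero_smul] at this
  rw [CommAt, sub_self, lie_self, this]

theorem CommAt.add {α β : L} {v w : Multiset X →₀ S} (h : CommAt b α β v) (h' : CommAt b α β w) :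
    CommAt b α β (v + w) := by
  simp only [CommAt, map_add] at h h' ⊢
  rw [← h, ← h']
  abel

theorem CommAt.smul {α β : L} {v : Multiset X →₀ S} (h : CommAt b α β v) (s : S) :
    CommAt b α β (s • v) := by
  simp only [CommAt, opOf_apply_smul, map_add] at h ⊢
  rw [← h, leibniz_lie α β s, add_smul, smul_sub]
  abel

theorem CommAt.add_right {α β γ : L} {v : Multiset X →₀ S} (h : CommAt b α β v)
    (h' : CommAt b α γ v) : CommAt b α (β + γ) v := by
  simp only [CommAt, opOf_add, map_add, lie_add] at h h' ⊢
  rw [← h, ← h']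
  abel

theorem CommAt.smul_right {α β : L} {v : Multiset X →₀ S} (h : CommAt b α β v) (s : S) :
    CommAt b α (s • β) v := by
  simp only [CommAt, opOf_smul, opOf_apply_smul, LieRinehartRing.leibniz_smul_right, opOf_add]
    at h ⊢
  rw [← h, smul_sub]
  abel

theorem CommAt.of_basis_right {α : L} {v : Multiset X →₀ S} (h : ∀ i, CommAt b α (b i) v) (β : L) :
    CommAt b α β v := by
  have hβ : β ∈ Submodule.span S (Set.range b) := by rw [b.span_eq]; trivial
  induction hβ using Submodule.span_induction with
  | mem x hx => obtain ⟨i, rfl⟩ := hx; exact h i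
  | zero => simpa using (commAt_refl (b := b) α v).smul_right 0
  | add x y _ _ hx hy => exact hx.add_right hy
  | smul s x _ hx => exact hx.smul_right s

/-- The commutation relation at a fixed vector is closed under `S`-linear combinations in either
argument: the anchor terms match the Leibniz rule of the bracket. Antisymmetry then leaves only the
pairs with `j < i`. -/
theorem CommAt.of_basis {v : Multiset X →₀ S} (h : ∀ i j, j < i → CommAt b (b i) (b j) v)
    (α β : L) : CommAt b α β v := by
  refine CommAt.of_basis_right (fun i => CommAt.symm (CommAt.of_basis_right (fun j => ?_) α)) β
  rcases lt_trichotomy j i with hij | rfl | hij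
  · exact h i j hij
  · exact commAt_refl _ _
  · exact (h j i hij).symm

theorem CommAt.of_degLT {n : ℕ} {α β : L}
    (h : ∀ M : Multiset X, M.card < n → CommAt b α β (Finsupp.single M 1))
    {v : Multiset X →₀ S} (hv : v ∈ degLT S X n) : CommAt b α β v := by
  refine degLT_induction (P := CommAt b α β) (by simp [CommAt]) (fun v w => CommAt.add)
    (fun M s hM => ?_) hv
  simpa using (h M hM).smul s

theorem commAt_single_of_le {N : Multiset X} {i j : X} (hj : ∀ l ∈ N, j ≤ l) (hij : j < i) :
    CommAt b (b i) (b j) (Finsupp.single N 1) := by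
  rw [CommAt, pbwAct_single_of_le b hj, pbwAct_cons b hj hij, add_sub_cancel_left]

/-- Induction on the size of `M`. If `j ≤ M`, the relation for `b_i` and `b_j` is the definition of
the action. Otherwise `M = m + N` with `m` minimal and `m < j < i`. In both orders of `b_i` and
`b_j` the factor `b_m` can be moved to the front, and the results agree by the Jacobi identity. -/
theorem commAt_single (M : Multiset X) (α β : L) : CommAt b α β (Finsupp.single M 1) := by
  refine CommAt.of_basis (fun i j hij => ?_) α β
  by_cases h : ∀ l ∈ M, j ≤ l
  · exact commAt_single_of_le h hij
  · obtain ⟨m, N, rfl, hN, hm⟩ := exists_eq_cons_of_not_le h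
    have ih {n : ℕ} (hn : n ≤ N.card + 1) {v : Multiset X →₀ S} (hv : v ∈ degLT S X n) (α β : L) :
        CommAt b α β v :=
      CommAt.of_degLT (fun P hP => commAt_single P α β) hv
    have hz : Finsupp.single N (1 : S) ∈ degLT S X (N.card + 1) := single_mem_degLT (by simp) _
    have key (i j : X) (hi : m < i) (hj : m < j) :
        pbwAct b (b i) (pbwAct b (b m) (pbwAct b (b j) (Finsupp.single N 1))) =
        pbwAct b (b m) (pbwAct b (b i) (pbwAct b (b j) (Finsupp.single N 1)))
        + pbwAct b ⁅b i, b m⁆ (pbwAct b (b j) (Finsupp.single N 1)) := by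
      -- The vector `b_j z_N` is too large for the induction hypothesis. Its leading term `z_{j +
      -- N}` falls under the easy case, as `m` is minimal, and the rest has degree at most `|N|`.
      have h₁ : CommAt b (b i) (b m) (Finsupp.single (j ::ₘ N) 1) := by
        refine commAt_single_of_le (fun l hl => ?_) hi
        rcases Multiset.mem_cons.mp hl with rfl | hl
        · exact hj.le
        · exact hN l hl
      have h₂ := h₁.add (ih le_rfl (pbwCoeff_basis_sub_mem b N j) (b i) (b m))
      rw [add_sub_cancel, ← pbwAct_single_one] at h₂
      exact sub_eq_iff_eq_add'.mp h₂
    have swap (α β : L) := sub_eq_iff_eq_add'.mp (ih le_rfl hz α β)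
    have expand (i j : X) (hi : m < i) (hj : m < j) :
        pbwAct b (b i) (pbwAct b (b j) (Finsupp.single (m ::ₘ N) 1)) =
        pbwAct b (b m) (pbwAct b (b i) (pbwAct b (b j) (Finsupp.single N 1)))
        + pbwAct b ⁅b i, b m⁆ (pbwAct b (b j) (Finsupp.single N 1))
        + pbwAct b ⁅b j, b m⁆ (pbwAct b (b i) (Finsupp.single N 1))
        + pbwAct b ⁅b i, ⁅b j, b m⁆⁆ (Finsupp.single N 1) := by
      rw [pbwAct_cons b hN hj, map_add, key i j hi hj, swap (b i) ⁅b j, b m⁆]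
      abel
    -- Jacobi matches the double brackets of the two expansions; all other terms cancel or are
    -- covered by the induction hypothesis on `z_N`.
    have hlie : ⁅⁅b i, b j⁆, b m⁆ + ⁅b j, ⁅b i, b m⁆⁆ = ⁅b i, ⁅b j, b m⁆⁆ := by
      rw [leibniz_lie (b i) (b j) (b m)]
    rw [CommAt, expand i j (hm.trans hij) hm, expand j i hm (hm.trans hij),
      ← pbwAct_single_of_le b hN, swap ⁅b i, b j⁆ (b m), ← hlie, opOf_add,
      ← ih le_rfl hz (b i) (b j), map_sub]
    abel
termination_by M.card
decreasing_by subst_vars; simp only [Multiset.card_cons]; omega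

theorem commAt (α β : L) (v : Multiset X →₀ S) : CommAt b α β v := by
  obtain ⟨n, hn⟩ := exists_mem_degLT v
  exact CommAt.of_degLT (fun M _ => commAt_single M α β) hn

end PBW

/-! ### The ordered monomials form a basis of `U` over `S` on either side. -/

section PBWBasis

set_option linter.unusedSectionVars false

attribute [local instance 100] LieRing.ofAssociativeRing

variable {k S L X : Type u} [Field k] [CommRing S] [Algebra k S] [LieRing L] [LieAlgebra k L]
  [Module S L] [LieRingModule L S] [LieRinehartRing S L] [LieRinehartAlgebra k S L]
  [LinearOrder X] (b : Module.Basis X S L)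

theorem pbwAct_smul (α : L) (c : k) (v : Multiset X →₀ S) :
    pbwAct b α (c • v) = c • pbwAct b α v := by
  have h : ⁅α, algebraMap k S c⁆ = 0 := by
    rw [Algebra.algebraMap_eq_smul_one]
    exact (lie_smul c α (1 : S)).trans (by rw [lie_one_eq_zero, smul_zero])
  rw [← algebraMap_smul S c v, opOf_apply_smul, h, zero_smul, zero_add, algebraMap_smul]

variable (k) in
/-- The action of `L` on the free module on the multisets, as a morphism of Lie algebras. -/
def pbwLie : L →ₗ⁅k⁆ Module.End k (Multiset X →₀ S) where
  toFun α :=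
    { toFun := pbwAct b α
      map_add' := map_add _
      map_smul' := pbwAct_smul b α }
  map_add' α β := LinearMap.ext fun v => opOf_add _ α β v
  map_smul' c α := LinearMap.ext fun v => by
    change pbwAct b (c • α) v = c • pbwAct b α v
    rw [← algebraMap_smul S c α, opOf_smul, algebraMap_smul]
  map_lie' {α β} := LinearMap.ext fun v => Eq.symm (commAt (b := b) α β v)

/-- The representation of `U` on the free module on the multisets. -/
def pbwRep : Env k S L →ₐ[k] Module.End k (Multiset X →₀ S) :=
  lift (Algebra.lsmul k k (Multiset X →₀ S)) (pbwLie k b)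
    (fun s α => LinearMap.ext fun v => by
      exact Eq.symm (opOf_smul (pbwCoeff b) s α v))
    (fun α s => LinearMap.ext fun v => by
      change pbwAct b α (s • v) - s • pbwAct b α v = ⁅α, s⁆ • v
      rw [opOf_apply_smul, add_sub_cancel_right])

theorem pbwRep_inS (s : S) (v : Multiset X →₀ S) :
    pbwRep (k := k) b (inS k S L s) v = s • v := by
  simp [pbwRep]

theorem pbwRep_inL (α : L) (v : Multiset X →₀ S) :
    pbwRep (k := k) b (inL k S L α) v = pbwAct b α v := by
  rw [pbwRep, lift_inL]
  rfl

variable (k) in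
/-- The ordered monomial attached to a multiset. -/
def pbwMonomial (M : Multiset X) : Env k S L :=
  ((M.sort (· ≤ ·)).map fun i => inL k S L (b i)).prod

theorem pbwMonomial_cons {M : Multiset X} {i : X} (h : ∀ j ∈ M, i ≤ j) :
    pbwMonomial k b (i ::ₘ M) = inL k S L (b i) * pbwMonomial k b M := by
  rw [pbwMonomial, Multiset.sort_cons i M (r := (· ≤ ·)) h, List.map_cons, List.prod_cons,
    pbwMonomial]

theorem pbwMonomial_zero : pbwMonomial k b 0 = 1 := by
  simp [pbwMonomial]

variable (k) in
/-- The map that sends `s z_M` to `i(s) z_M`. -/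
def pbwLeft : (Multiset X →₀ S) →+ Env k S L :=
  Finsupp.liftAddHom fun M =>
    (AddMonoidHom.mulRight (pbwMonomial k b M)).comp (inS k S L).toRingHom.toAddMonoidHom

theorem pbwLeft_single (M : Multiset X) (s : S) :
    pbwLeft k b (Finsupp.single M s) = inS k S L s * pbwMonomial k b M := by
  simp [pbwLeft]

theorem pbwLeft_smul (s : S) (v : Multiset X →₀ S) :
    pbwLeft k b (s • v) = inS k S L s * pbwLeft k b v := by
  induction v using Finsupp.induction_linear with
  | zero => simp
  | add v w hv hw => rw [smul_add, map_add, map_add, mul_add, hv, hw]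
  | single M t => rw [Finsupp.smul_single, pbwLeft_single, pbwLeft_single, smul_eq_mul, map_mul,
      mul_assoc]

/-- `pbwLeft` commutes with the action of `α` on `v`. -/
def LeftAt (α : L) (v : Multiset X →₀ S) : Prop :=
  pbwLeft k b (pbwAct b α v) = inL k S L α * pbwLeft k b v

variable {b}

theorem LeftAt.of_basis {v : Multiset X →₀ S} (h : ∀ i, LeftAt (k := k) b (b i) v) (α : L) :
    LeftAt (k := k) b α v := by
  have hα : α ∈ Submodule.span S (Set.range b) := by rw [b.span_eq]; trivial
  induction hα using Submodule.span_induction with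
  | mem x hx => obtain ⟨i, rfl⟩ := hx; exact h i
  | zero =>
    have := opOf_smul (pbwCoeff b) 0 (0 : L) v
    rw [zero_smul, zero_smul] at this
    rw [LeftAt, this, map_zero, map_zero, zero_mul]
  | add x y _ _ hx hy => rw [LeftAt, opOf_add, map_add, hx, hy, map_add, add_mul]
  | smul s x _ hx => rw [LeftAt, opOf_smul, pbwLeft_smul, hx, ← inS_mul_inL, mul_assoc]

theorem LeftAt.add {α : L} {v w : Multiset X →₀ S} (hv : LeftAt (k := k) b α v)
    (hw : LeftAt (k := k) b α w) : LeftAt (k := k) b α (v + w) := by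
  rw [LeftAt, map_add, map_add, hv, hw, map_add, mul_add]

theorem LeftAt.smul {α : L} {v : Multiset X →₀ S} (hv : LeftAt (k := k) b α v) (s : S) :
    LeftAt (k := k) b α (s • v) := by
  rw [LeftAt, opOf_apply_smul, map_add, pbwLeft_smul, pbwLeft_smul, hv, pbwLeft_smul,
    ← mul_assoc, ← mul_assoc, inL_mul_inS, add_mul, add_comm]

theorem LeftAt.of_degLT {n : ℕ} {α : L}
    (h : ∀ M : Multiset X, M.card < n → LeftAt (k := k) b α (Finsupp.single M 1))
    {v : Multiset X →₀ S} (hv : v ∈ degLT S X n) : LeftAt (k := k) b α v := by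
  refine degLT_induction (P := LeftAt (k := k) b α) (by simp [LeftAt]) (fun v w => LeftAt.add)
    (fun M s hM => ?_) hv
  simpa using (h M hM).smul s

theorem leftAt_single_of_le {M : Multiset X} {i : X} (h : ∀ j ∈ M, i ≤ j) :
    LeftAt (k := k) b (b i) (Finsupp.single M 1) := by
  rw [LeftAt, pbwAct_single_of_le b h, pbwLeft_single, pbwLeft_single, pbwMonomial_cons b h]
  simp

/-- The monomials in `U` obey the reordering rule by which the action was defined, so the induction
follows the same split into leading term and lower terms. -/
theorem leftAt_single (M : Multiset X) (α : L) : LeftAt (k := k) b α (Finsupp.single M 1) := by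
  refine LeftAt.of_basis (fun i => ?_) α
  by_cases h : ∀ j ∈ M, i ≤ j
  · exact leftAt_single_of_le h
  · obtain ⟨j, N, rfl, hN, hij⟩ := exists_eq_cons_of_not_le h
    have ih {v : Multiset X →₀ S} (hv : v ∈ degLT S X (N.card + 1)) (α : L) :
        LeftAt (k := k) b α v :=
      LeftAt.of_degLT (fun P hP => leftAt_single P α) hv
    have hz : Finsupp.single N (1 : S) ∈ degLT S X (N.card + 1) := single_mem_degLT (by simp) _
    have h₁ : LeftAt (k := k) b (b j) (Finsupp.single (i ::ₘ N) 1) := by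
      refine leftAt_single_of_le fun l hl => ?_
      rcases Multiset.mem_cons.mp hl with rfl | hl
      · exact hij.le
      · exact hN l hl
    have h₂ := h₁.add (ih (pbwCoeff_basis_sub_mem b N i) (b j))
    rw [add_sub_cancel, ← pbwAct_single_one] at h₂
    rw [LeftAt, pbwAct_cons b hN hij, map_add, h₂, ih hz, ih hz, LieHom.map_lie, Ring.lie_def,
      ← pbwAct_single_of_le b hN, ih hz]
    noncomm_ring
termination_by M.card
decreasing_by subst_vars; simp only [Multiset.card_cons]; omega

theorem leftAt (α : L) (v : Multiset X →₀ S) : LeftAt (k := k) b α v := by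
  obtain ⟨n, hn⟩ := exists_mem_degLT v
  exact LeftAt.of_degLT (fun M _ => leftAt_single M α) hn

theorem pbwLeft_rep (a : Env k S L) (v : Multiset X →₀ S) :
    pbwLeft k b (pbwRep b a v) = a * pbwLeft k b v := by
  induction a using Env.induction generalizing v with
  | inS s => rw [pbwRep_inS, pbwLeft_smul]
  | inL α => rw [pbwRep_inL]; exact leftAt α v
  | algebraMap c =>
    rw [AlgHom.commutes, Module.algebraMap_end_apply, ← algebraMap_smul S c v, pbwLeft_smul,
      AlgHom.commutes]
  | mul a a' h h' => rw [map_mul, Module.End.mul_apply, h, h', mul_assoc]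
  | add a a' h h' => rw [map_add, LinearMap.add_apply, map_add, h, h', add_mul]

variable (b) in
/-- The element of the free module on the multisets attached to an element of `U`. -/
def pbwSymbol : Env k S L →+ (Multiset X →₀ S) :=
  AddMonoidHom.mk' (fun a => pbwRep b a (Finsupp.single 0 1)) fun a a' => by
    rw [map_add, LinearMap.add_apply]

/-- `pbwLeft` intertwines the representation with left multiplication and sends `z_0` to `1`. So the
ordered monomials span `U` over `S` on the left. -/
theorem pbwLeft_symbol (a : Env k S L) : pbwLeft k b (pbwSymbol b a) = a := by
  change pbwLeft k b (pbwRep b a (Finsupp.single 0 1)) = a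
  rw [pbwLeft_rep, pbwLeft_single, pbwMonomial_zero]
  simp

/-- Moving a scalar to the left through a monomial only creates terms with fewer factors, one for
each differentiation. This triangularity carries the basis property from left to right. -/
theorem pbwRep_monomial_sub_mem (M : Multiset X) (s : S) :
    pbwRep b (pbwMonomial k b M) (Finsupp.single 0 s) - Finsupp.single M s
      ∈ degLT S X M.card := by
  by_cases h : M = 0
  · simp [h, pbwMonomial_zero]
  · obtain ⟨i, N, rfl, hN⟩ := exists_eq_cons_of_ne_zero h
    have ih := pbwRep_monomial_sub_mem N s
    have e : Finsupp.single (i ::ₘ N) s = s • pbwCoeff b N (b i) := by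
      rw [pbwCoeff_of_le b hN, Finsupp.smul_single_one]
    have := pbwAct_mem b (b i) ih
    rw [map_sub, opOf_single, ← e, sub_add_eq_sub_sub_swap] at this
    rw [pbwMonomial_cons b hN, map_mul, Module.End.mul_apply, pbwRep_inL, Multiset.card_cons]
    have h' : Finsupp.single N ⁅b i, s⁆ ∈ degLT S X (N.card + 1) := single_mem_degLT (by simp) _
    simpa using add_mem this h'
termination_by M.card
decreasing_by subst_vars; simp only [Multiset.card_cons]; omega

theorem pbwRep_monomial (M : Multiset X) :
    pbwRep b (pbwMonomial k b M) (Finsupp.single 0 1) = Finsupp.single M 1 := by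
  by_cases h : M = 0
  · simp [h, pbwMonomial_zero]
  · obtain ⟨i, N, rfl, hN⟩ := exists_eq_cons_of_ne_zero h
    rw [pbwMonomial_cons b hN, map_mul, Module.End.mul_apply, pbwRep_monomial N, pbwRep_inL,
      pbwAct_single_of_le b hN]
termination_by M.card
decreasing_by subst_vars; simp only [Multiset.card_cons]; omega

theorem pbwSymbol_left (v : Multiset X →₀ S) : pbwSymbol b (pbwLeft k b v) = v := by
  induction v using Finsupp.induction_linear with
  | zero => simp
  | add v w hv hw => rw [map_add, map_add, hv, hw]
  | single M s =>
    rw [pbwLeft_single]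
    change pbwRep b _ _ = _
    rw [map_mul, Module.End.mul_apply, pbwRep_inS, pbwRep_monomial, Finsupp.smul_single_one]

variable (k b) in
/-- The map that sends `s z_M` to `z_M i(s)`. -/
def pbwRight : (Multiset X →₀ S) →+ Env k S L :=
  Finsupp.liftAddHom fun M =>
    (AddMonoidHom.mulLeft (pbwMonomial k b M)).comp (inS k S L).toRingHom.toAddMonoidHom

theorem pbwRight_single (M : Multiset X) (s : S) :
    pbwRight k b (Finsupp.single M s) = pbwMonomial k b M * inS k S L s := by
  simp [pbwRight]

theorem pbwRight_smul (s : S) (v : Multiset X →₀ S) :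
    pbwRight k b (s • v) = pbwRight k b v * inS k S L s := by
  induction v using Finsupp.induction_linear with
  | zero => simp
  | add v w hv hw => rw [smul_add, map_add, map_add, add_mul, hv, hw]
  | single M t => rw [Finsupp.smul_single, pbwRight_single, pbwRight_single, smul_eq_mul,
      mul_comm s t, map_mul, mul_assoc]

theorem pbwSymbol_right_sub_mem (M : Multiset X) (s : S) :
    pbwSymbol b (pbwRight k b (Finsupp.single M s)) - Finsupp.single M s ∈ degLT S X M.card := by
  rw [pbwRight_single]
  change pbwRep b _ _ - _ ∈ _
  rw [map_mul, Module.End.mul_apply, pbwRep_inS, Finsupp.smul_single_one]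
  exact pbwRep_monomial_sub_mem M s

/-- An additive endomorphism of the free module on the multisets that is the identity up to
terms of lower degree is bijective. -/
theorem bijective_of_sub_mem_degLT (T : (Multiset X →₀ S) →+ (Multiset X →₀ S))
    (hT : ∀ M s, T (Finsupp.single M s) - Finsupp.single M s ∈ degLT S X M.card) :
    Function.Bijective T := by
  have h (n : ℕ) {v : Multiset X →₀ S} (hv : v ∈ degLT S X (n + 1)) : T v - v ∈ degLT S X n := by
    refine degLT_induction (P := fun v => T v - v ∈ degLT S X n) (by simp) (fun v w hv hw => ?_)
      (fun M s hM => degLT_mono (by omega) (hT M s)) hv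
    rw [map_add, add_sub_add_comm]
    exact add_mem hv hw
  have zero {v : Multiset X →₀ S} (hv : v ∈ degLT S X 0) : v = 0 := by
    simpa [degLT] using hv
  constructor
  · rw [injective_iff_map_eq_zero]
    intro v hv
    -- If `T v = 0`, then `v = -(T v - v)` lies one degree lower; descend to degree zero.
    have (n : ℕ) : v ∈ degLT S X n → v = 0 := by
      induction n with
      | zero => exact zero
      | succ n ih =>
        intro hn
        refine ih ?_
        simpa [hv] using h n hn
    obtain ⟨n, hn⟩ := exists_mem_degLT v
    exact this n hn
  -- The error `T v - v` has lower degree, so it is some `T w`, and `v - w` is a preimage of `v`.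
  · have (n : ℕ) : ∀ v ∈ degLT S X n, ∃ w, T w = v := by
      induction n with
      | zero => exact fun v hv => ⟨0, by rw [zero hv, map_zero]⟩
      | succ n ih =>
        intro v hv
        obtain ⟨w, hw⟩ := ih _ (h n hv)
        exact ⟨v - w, by rw [map_sub, hw, sub_sub_cancel]⟩
    intro v
    obtain ⟨n, hn⟩ := exists_mem_degLT v
    exact this n v hn

theorem pbwLeft_bijective : Function.Bijective (pbwLeft k b) :=
  ⟨Function.LeftInverse.injective pbwSymbol_left, Function.RightInverse.surjective pbwLeft_symbol⟩

/-- In the left basis `pbwRight` is unitriangular for the degree. -/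
theorem pbwRight_bijective : Function.Bijective (pbwRight k b) := by
  have h := bijective_of_sub_mem_degLT ((pbwSymbol b).comp (pbwRight k b))
    pbwSymbol_right_sub_mem
  have h' := (pbwLeft_bijective (k := k) (b := b)).comp h
  convert h' using 1
  funext v
  exact (pbwLeft_symbol _).symm

end PBWBasis

/-! ### Algebras as modules under right multiplication, and their tensor products. -/

section RightMultiplication

variable {k R A : Type u} [Field k] [CommRing R] [Algebra k R] [Ring A] [Algebra k A]

/-- The algebra `A`, regarded as a module over `R` by means of right multiplications. -/
def RMul (_ : R →ₐ[k] A) : Type u := A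

variable (f : R →ₐ[k] A)

instance : AddCommGroup (RMul f) := inferInstanceAs (AddCommGroup A)

instance : Module A (RMul f) := inferInstanceAs (Module A A)

instance : Module k (RMul f) := inferInstanceAs (Module k A)

instance : IsScalarTower k A (RMul f) := inferInstanceAs (IsScalarTower k A A)

instance : Module R (RMul f) where
  smul r a := (show A from a) * f r
  one_smul a := by
    change (show A from a) * f 1 = a
    rw [map_one, mul_one]
  mul_smul r s a := by
    change (show A from a) * f (r * s) = (show A from a) * f s * f r
    rw [mul_comm, map_mul, mul_assoc]
  smul_zero r := zero_mul (M₀ := A) (f r)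
  smul_add r a b := add_mul (R := A) a b (f r)
  add_smul r s a := by
    change (show A from a) * f (r + s) = (show A from a) * f r + (show A from a) * f s
    rw [map_add, mul_add]
  zero_smul a := by
    change (show A from a) * f 0 = 0
    rw [map_zero, mul_zero]

/-- An element of `A` as an element of `RMul f`. -/
def toRMul : A ≃+ RMul f := AddEquiv.refl A

theorem smul_toRMul (r : R) (a : A) : r • toRMul f a = toRMul f (a * f r) := rfl

instance : IsScalarTower k R (RMul f) where
  smul_assoc c r a := by
    change (show A from a) * f (c • r) = c • ((show A from a) * f r)
    rw [map_smul, mul_smul_comm]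

instance : SMulCommClass R A (RMul f) where
  smul_comm r a b := by
    change a * (show A from b) * f r = a * ((show A from b) * f r)
    rw [mul_assoc]

variable {R' A' : Type u} [CommRing R'] [Algebra k R'] [Ring A'] [Algebra k A'] (g : R' →ₐ[k] A')

/-- Splittings `i` and `j` of the canonical surjections from free modules tensor to a splitting of a
surjection from the free module on pairs. -/
theorem RMul.projective_tensor [Module.Projective R (RMul f)] [Module.Projective R' (RMul g)] :
    Module.Projective (R ⊗[k] R') (RMul (Algebra.TensorProduct.map f g)) := by
  obtain ⟨i, hi⟩ := (Module.projective_def' (R := R) (P := RMul f)).mp inferInstance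
  obtain ⟨j, hj⟩ := (Module.projective_def' (R := R') (P := RMul g)).mp inferInstance
  let F := Algebra.TensorProduct.map f g
  let π : (RMul f × RMul g →₀ R ⊗[k] R') →ₗ[R ⊗[k] R'] RMul F :=
    Finsupp.linearCombination (R ⊗[k] R') fun x =>
      toRMul F (((toRMul f).symm x.1) ⊗ₜ[k] ((toRMul g).symm x.2))
  let σ : A ⊗[k] A' →ₗ[k] (RMul f × RMul g →₀ R ⊗[k] R') :=
    (finsuppTensorFinsupp k k R R' (RMul f) (RMul g)).toLinearMap ∘ₗ
      TensorProduct.map (i.restrictScalars k) (j.restrictScalars k)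
  have hσ (a : A) (a' : A') (x) :
      σ (a ⊗ₜ a') x = i (toRMul f a) x.1 ⊗ₜ j (toRMul g a') x.2 := by
    obtain ⟨x, y⟩ := x
    exact finsuppTensorFinsupp_apply ..
  let τ : RMul F →ₗ[R ⊗[k] R'] (RMul f × RMul g →₀ R ⊗[k] R') :=
    { toFun := fun a => σ ((toRMul F).symm a)
      map_add' := fun a b => by rw [map_add, map_add]
      map_smul' := fun r a => by
        obtain ⟨a, rfl⟩ := (toRMul F).surjective a
        rw [smul_toRMul, AddEquiv.symm_apply_apply, AddEquiv.symm_apply_apply, RingHom.id_apply]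
        induction r using TensorProduct.induction_on with
        | zero => simp
        | add r s hr hs => rw [map_add, mul_add, map_add, hr, hs, add_smul]
        | tmul r r' =>
          induction a using TensorProduct.induction_on with
          | zero => simp
          | add a b ha hb => rw [add_mul, map_add, ha, hb, map_add, smul_add]
          | tmul a a' =>
            ext x
            simp only [F, Algebra.TensorProduct.map_tmul, Algebra.TensorProduct.tmul_mul_tmul]
            rw [hσ, Finsupp.smul_apply, hσ, ← smul_toRMul, ← smul_toRMul, map_smul, map_smul,
              Finsupp.smul_apply, Finsupp.smul_apply, smul_eq_mul, smul_eq_mul, smul_eq_mul,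
              Algebra.TensorProduct.tmul_mul_tmul] }
  refine Module.Projective.of_split τ π (LinearMap.ext fun a => ?_)
  obtain ⟨a, rfl⟩ := (toRMul F).surjective a
  change π (σ a) = toRMul F a
  have key (x : RMul f →₀ R) (y : RMul g →₀ R') :
      π (finsuppTensorFinsupp k k R R' (RMul f) (RMul g) (x ⊗ₜ y)) =
        toRMul F ((toRMul f).symm (Finsupp.linearCombination R id x) ⊗ₜ
          (toRMul g).symm (Finsupp.linearCombination R' id y)) := by
    induction x using Finsupp.induction_linear with
    | zero => simp
    | add x x' hx hx' =>
      rw [TensorProduct.add_tmul, map_add, map_add, hx, hx', map_add, map_add,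
        TensorProduct.add_tmul, map_add]
    | single a r =>
      induction y using Finsupp.induction_linear with
      | zero => simp
      | add y y' hy hy' =>
        rw [TensorProduct.tmul_add, map_add, map_add, hy, hy', map_add, map_add,
          TensorProduct.tmul_add, map_add]
      | single b s =>
        rw [finsuppTensorFinsupp_single, Finsupp.linearCombination_single,
          Finsupp.linearCombination_single, Finsupp.linearCombination_single, smul_toRMul]
        simp only [F, Algebra.TensorProduct.map_tmul, Algebra.TensorProduct.tmul_mul_tmul]
        rfl
  induction a using TensorProduct.induction_on with
  | zero => simp
  | add a b ha hb => rw [map_add, map_add, ha, hb, map_add]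
  | tmul a a' =>
    have h₁ : Finsupp.linearCombination R id (i (toRMul f a)) = toRMul f a :=
      LinearMap.congr_fun hi _
    have h₂ : Finsupp.linearCombination R' id (j (toRMul g a')) = toRMul g a' :=
      LinearMap.congr_fun hj _
    have := key (i (toRMul f a)) (j (toRMul g a'))
    rw [h₁, h₂] at this
    exact this

end RightMultiplication

/-! ### Making a projective module free by adding a free module. -/

section Swindle

variable {R M F : Type u} [CommRing R] [AddCommGroup M] [Module R M] [AddCommGroup F] [Module R F]

/-- The Eilenberg swindle. -/
theorem nonempty_prod_finsupp_equiv (s : M →ₗ[R] F) (p : F →ₗ[R] M) (hps : ∀ m, p (s m) = m) :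
    Nonempty ((M × (ℕ →₀ F)) ≃ₗ[R] (ℕ →₀ F)) := by
  let e : F →ₗ[R] F := s ∘ₗ p
  let e' : F →ₗ[R] F := LinearMap.id - e
  have he (m : F) : e m = s (p m) := rfl
  have he' (m : F) : e' m = m - s (p m) := rfl
  -- `e` projects `F` onto its copy of `M`, and `e'` onto the complement. `D` moves the
  -- `M`-components one index up and fixes the complementary ones, which frees the `M`-slot at index
  -- `0` for the extra summand. `D'` moves them back down.
  let D : (ℕ →₀ F) →ₗ[R] (ℕ →₀ F) :=
    Finsupp.mapRange.linearMap e' + Finsupp.lmapDomain F R Nat.succ ∘ₗ Finsupp.mapRange.linearMap e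
  let Φ : (M × (ℕ →₀ F)) →ₗ[R] (ℕ →₀ F) := (Finsupp.lsingle 0 ∘ₗ s).coprod D
  let D' : (ℕ →₀ F) →ₗ[R] (ℕ →₀ F) := Finsupp.mapRange.linearMap e' +
    Finsupp.lcomapDomain Nat.succ Nat.succ_injective ∘ₗ Finsupp.mapRange.linearMap e
  let Ψ : (ℕ →₀ F) →ₗ[R] (M × (ℕ →₀ F)) := (p ∘ₗ Finsupp.lapply 0).prod D'
  have hΦ0 (m f) : Φ (m, f) 0 = s m + e' (f 0) := by
    have : Finsupp.mapDomain Nat.succ (Finsupp.mapRange.linearMap (α := ℕ) e f) 0 = 0 :=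
      Finsupp.mapDomain_of_notMem_range _ _ (by simp)
    change Finsupp.single 0 (s m) 0 + (e' (f 0) +
      Finsupp.mapDomain Nat.succ (Finsupp.mapRange.linearMap (α := ℕ) e f) 0) = _
    rw [this, add_zero, Finsupp.single_eq_same]
  have hΦs (m f) (n : ℕ) : Φ (m, f) (n + 1) = e' (f (n + 1)) + e (f n) := by
    have : Finsupp.mapDomain Nat.succ (Finsupp.mapRange.linearMap (α := ℕ) e f) (n + 1) = e (f n) :=
      Finsupp.mapDomain_apply Nat.succ_injective _ _
    change Finsupp.single 0 (s m) (n + 1) +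
      (e' (f (n + 1)) +
      Finsupp.mapDomain Nat.succ (Finsupp.mapRange.linearMap (α := ℕ) e f) (n + 1)) = _
    rw [this, Finsupp.single_eq_of_ne (by simp), zero_add]
  have hΨ1 (g) : (Ψ g).1 = p (g 0) := rfl
  have hΨ2 (g) (n : ℕ) : (Ψ g).2 n = e' (g n) + e (g (n + 1)) := rfl
  refine ⟨LinearEquiv.ofLinearMap Φ Ψ ?_ ?_⟩
  · refine LinearMap.ext fun g => Finsupp.ext fun n => ?_
    change Φ ((Ψ g).1, (Ψ g).2) n = g n
    cases n with
    | zero => rw [hΦ0, hΨ1, hΨ2]; simp [he, he', hps]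
    | succ n => rw [hΦs, hΨ2, hΨ2]; simp [he, he', hps]
  · refine LinearMap.ext fun x => Prod.ext ?_ (Finsupp.ext fun n => ?_)
    · change (Ψ (Φ (x.1, x.2))).1 = x.1
      rw [hΨ1, hΦ0]
      simp [he', hps]
    · change (Ψ (Φ (x.1, x.2))).2 n = x.2 n
      rw [hΨ2]
      cases n with
      | zero => rw [hΦ0, hΦs]; simp [he, he', hps]
      | succ n => rw [hΦs, hΦs]; simp [he, he', hps]

variable (R M) in
/-- The direct sum of a projective module and of a suitable free module is free. -/
theorem exists_basis_prod_finsupp [Module.Projective R M] :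
    ∃ B X : Type u, Nonempty (Module.Basis X R (M × (B →₀ R))) := by
  obtain ⟨s, hs⟩ := (Module.projective_def' (R := R) (P := M)).mp inferInstance
  obtain ⟨e⟩ := nonempty_prod_finsupp_equiv s (Finsupp.linearCombination R id)
    (LinearMap.congr_fun hs)
  let c : (ℕ × M →₀ R) ≃ₗ[R] (ℕ →₀ (M →₀ R)) := Finsupp.curryLinearEquiv R
  exact ⟨ℕ × M, ℕ × M, ⟨⟨((LinearEquiv.refl R M).prodCongr c).trans (e.trans c.symm)⟩⟩⟩

end Swindle

/-! ### The semidirect product of `L` with a free module, and its enveloping algebra. -/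

section SplitExtension

set_option linter.unusedSectionVars false

attribute [local instance 100] LieRing.ofAssociativeRing

variable (k S L B : Type u) [Field k] [CommRing S] [Algebra k S] [LieRing L] [LieAlgebra k L]
  [Module S L] [LieRingModule L S]

/-- The direct sum of a Lie–Rinehart algebra `L` and of a free `S`-module, on which `L` acts
coordinatewise. -/
def SplitExt (S L B : Type u) [CommRing S] : Type u := L × (B →₀ S)

namespace SplitExt

instance : AddCommGroup (SplitExt S L B) := inferInstanceAs (AddCommGroup (L × (B →₀ S)))

instance : Module S (SplitExt S L B) := inferInstanceAs (Module S (L × (B →₀ S)))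

instance : Module k (SplitExt S L B) := inferInstanceAs (Module k (L × (B →₀ S)))

variable {S L B}

/-- The coordinatewise action of `L` on a free `S`-module. -/
def coordAct (α : L) : (B →₀ S) →+ (B →₀ S) :=
  Finsupp.mapRange.addMonoidHom (AddMonoidHom.mk' (fun s : S => ⁅α, s⁆) (lie_add α))

@[simp]
theorem coordAct_apply (α : L) (f : B →₀ S) (x : B) : coordAct α f x = ⁅α, f x⁆ := rfl

@[ext]
theorem ext {x y : SplitExt S L B} (h₁ : x.1 = y.1) (h₂ : ∀ i, x.2 i = y.2 i) : x = y :=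
  Prod.ext h₁ (Finsupp.ext h₂)

@[simp]
theorem fst_add (x y : SplitExt S L B) : (x + y).1 = x.1 + y.1 := rfl

@[simp]
theorem snd_add (x y : SplitExt S L B) (i : B) : (x + y).2 i = x.2 i + y.2 i := rfl

@[simp]
theorem fst_smul (s : S) (x : SplitExt S L B) : (s • x).1 = s • x.1 := rfl

@[simp]
theorem snd_smul (s : S) (x : SplitExt S L B) (i : B) : (s • x).2 i = s * x.2 i := rfl

@[simp]
theorem fst_zero : (0 : SplitExt S L B).1 = 0 := rfl

@[simp]
theorem snd_zero (i : B) : (0 : SplitExt S L B).2 i = 0 := rfl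

instance : Bracket (SplitExt S L B) (SplitExt S L B) where
  bracket x y := (⁅x.1, y.1⁆, coordAct x.1 y.2 - coordAct y.1 x.2)

@[simp]
theorem fst_lie (x y : SplitExt S L B) : ⁅x, y⁆.1 = ⁅x.1, y.1⁆ := rfl

@[simp]
theorem snd_lie (x y : SplitExt S L B) (i : B) : ⁅x, y⁆.2 i = ⁅x.1, y.2 i⁆ - ⁅y.1, x.2 i⁆ := rfl

instance : LieRing (SplitExt S L B) where
  add_lie x y z := by
    ext
    · simp
    · simp only [snd_lie, fst_add, add_lie, snd_add, lie_add]; abel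
  lie_add x y z := by
    ext
    · simp
    · simp only [snd_lie, fst_add, add_lie, snd_add, lie_add]; abel
  lie_self x := by
    ext
    · simp
    · simp
  leibniz_lie x y z := by
    ext
    · simp
    · simp only [snd_lie, fst_lie, snd_add, lie_sub, lie_lie]; abel

/-- The free summand is an abelian ideal and acts by zero on `S`, so both the inclusion of `L` and
the projection to `L` respect the anchors. -/
instance : LieRingModule (SplitExt S L B) S where
  bracket x s := ⁅x.1, s⁆
  add_lie x y s := add_lie x.1 y.1 s
  lie_add x s t := lie_add x.1 s t
  leibniz_lie x y s := leibniz_lie x.1 y.1 s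

theorem lie_apply (x : SplitExt S L B) (s : S) : ⁅x, s⁆ = ⁅x.1, s⁆ := rfl

variable {k} in
@[simp]
theorem fst_smul' (s : k) (x : SplitExt S L B) : (s • x).1 = s • x.1 := rfl

variable {k} in
@[simp]
theorem snd_smul' (s : k) (x : SplitExt S L B) (i : B) : (s • x).2 i = s • x.2 i := rfl

variable [LieRinehartRing S L]

instance : LieRinehartRing S (SplitExt S L B) where
  lie_smul_eq_mul' a b x := LieRinehartRing.lie_smul_eq_mul a b x.1
  leibniz_mul_right' x a b := LieRinehartRing.leibniz_mul_right x.1 a b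
  leibniz_smul_right' x y a := by
    ext
    · simp [lie_apply]
    · simp [lie_apply]
      ring

variable [LieRinehartAlgebra k S L]

instance : LieAlgebra k (SplitExt S L B) where
  lie_smul c x y := by
    ext
    · simp
    · simp only [snd_lie, fst_smul', snd_smul', smul_sub]
      rw [show ⁅x.1, c • y.2 _⁆ = _ from lie_smul c x.1 (y.2 _),
        show ⁅c • y.1, x.2 _⁆ = _ from smul_lie c y.1 (x.2 _)]

instance : LieRinehartAlgebra k S (SplitExt S L B) where
  smul_assoc c s x := by
    ext
    · simp
    · simp
  smul_lie c x s := smul_lie c x.1 s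
  lie_smul c x s := lie_smul c x.1 s

variable (S L B) in
/-- The inclusion of `L` in the split extension. -/
def incl : L →ₗ⁅k⁆ SplitExt S L B where
  toFun α := ((α, 0) : L × (B →₀ S))
  map_add' _ _ := Prod.ext rfl (add_zero 0).symm
  map_smul' _ _ := Prod.ext rfl (smul_zero _).symm
  map_lie' {α β} := Prod.ext rfl (by
    change 0 = coordAct α 0 - coordAct β 0
    rw [map_zero, map_zero, sub_zero])

variable (S L B) in
/-- The projection of the split extension onto `L`. -/
def proj : SplitExt S L B →ₗ⁅k⁆ L where
  toFun x := x.1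
  map_add' _ _ := rfl
  map_smul' _ _ := rfl
  map_lie' := rfl

end SplitExt

variable [LieRinehartRing S L] [LieRinehartAlgebra k S L]

/-- The morphism from `U(S, L)` to the enveloping algebra of the split extension. -/
def envIncl : Env k S L →ₐ[k] Env k S (SplitExt S L B) :=
  lift (inS k S _) ((inL k S (SplitExt S L B)).comp (SplitExt.incl k S L B))
    (fun s _ => (inS_mul_inL k S (SplitExt S L B) _ _).trans
      (congrArg _ (Prod.ext rfl (smul_zero s))))
    (fun _ s => sub_eq_iff_eq_add'.mpr (inL_mul_inS k S (SplitExt S L B) _ s))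

/-- The morphism from the enveloping algebra of the split extension to `U(S, L)`. -/
def envProj : Env k S (SplitExt S L B) →ₐ[k] Env k S L :=
  lift (inS k S _) ((inL k S L).comp (SplitExt.proj k S L B))
    (fun _ _ => inS_mul_inL k S L _ _)
    (fun _ s => sub_eq_iff_eq_add'.mpr (inL_mul_inS k S L _ s))

theorem envIncl_inS (s : S) : envIncl k S L B (inS k S L s) = inS k S _ s :=
  lift_inS _ _ _ _ s

theorem envProj_inS (s : S) : envProj k S L B (inS k S _ s) = inS k S L s :=
  lift_inS _ _ _ _ s

theorem envIncl_inL (α : L) :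
    envIncl k S L B (inL k S L α) = inL k S _ (SplitExt.incl k S L B α) :=
  lift_inL _ _ _ _ α

theorem envProj_inL (x : SplitExt S L B) : envProj k S L B (inL k S _ x) = inL k S L x.1 :=
  lift_inL _ _ _ _ x

/-- As both maps fix `S`, this retraction is one of left and of right `S`-modules, and projectivity
passes to `U(S, L)`. -/
theorem envProj_incl (a : Env k S L) : envProj k S L B (envIncl k S L B a) = a := by
  have : (envProj k S L B).comp (envIncl k S L B) = AlgHom.id k _ :=
    algHom_ext (fun s => by rw [AlgHom.comp_apply, envIncl_inS, envProj_inS]; rfl)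
      (fun α => by rw [AlgHom.comp_apply, envIncl_inL, envProj_inL]; rfl)
  exact DFunLike.congr_fun this a

end SplitExtension

/-! ### Projectivity of `U` over `S` on both sides, and of `U^e` over `S^e`. -/

section Projective

variable (k S L : Type u) [Field k] [CommRing S] [Algebra k S] [LieRing L] [LieAlgebra k L]
  [Module S L] [LieRingModule L S] [LieRinehartRing S L] [LieRinehartAlgebra k S L]

theorem projective_right_of_basis {X : Type u} (b : Module.Basis X S L) :
    Module.Projective S (RMul (inS k S L)) := by
  classical
  -- Any linear order serves; it only fixes the order of factors in monomials.
  let : LinearOrder X := linearOrderOfSTO WellOrderingRel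
  let e : (Multiset X →₀ S) →ₗ[S] RMul (inS k S L) :=
    { toFun := fun v => toRMul _ (pbwRight k b v)
      map_add' := fun v w => by simp
      map_smul' := fun s v => by rw [pbwRight_smul]; rfl }
  exact Module.Projective.of_equiv (LinearEquiv.ofBijective e
    ((toRMul (inS k S L)).bijective.comp (pbwRight_bijective (k := k) (b := b))))

/-- Left multiplication by `S` on `U` is right multiplication by `Sᵐᵒᵖ` on the opposite algebra.
This is the form needed to treat `U^e` as a tensor product of right modules. -/
theorem projective_left_of_basis {X : Type u} (b : Module.Basis X S L) :
    Module.Projective Sᵐᵒᵖ (RMul (AlgHom.op (inS k S L))) := by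
  classical
  let : LinearOrder X := linearOrderOfSTO WellOrderingRel
  let e : (Multiset X →₀ Sᵐᵒᵖ) ≃+ (Multiset X →₀ S) :=
    Finsupp.mapRange.addEquiv opAddEquiv.symm
  have he (s : Sᵐᵒᵖ) (v : Multiset X →₀ Sᵐᵒᵖ) : e (s • v) = s.unop • e v :=
    Finsupp.ext fun M => (mul_comm _ _).trans rfl
  let e' : (Multiset X →₀ Sᵐᵒᵖ) →ₗ[Sᵐᵒᵖ] RMul (AlgHom.op (inS k S L)) :=
    { toFun := fun v => toRMul _ (op (pbwLeft k b (e v)))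
      map_add' := fun v w => by simp
      map_smul' := fun s v => by rw [he, pbwLeft_smul]; rfl }
  exact Module.Projective.of_equiv (LinearEquiv.ofBijective e'
    ((toRMul (AlgHom.op (inS k S L))).bijective.comp (opEquiv.bijective.comp
      ((pbwLeft_bijective (k := k) (b := b)).comp e.bijective))))

variable [Module.Projective S L]

/-- Adding a free summand makes the underlying module of the Lie–Rinehart algebra free, so the PBW
theorem applies to the larger enveloping algebra, of which `U` is a direct summand over `S`. -/
instance projective_right : Module.Projective S (RMul (inS k S L)) := by
  obtain ⟨B, X, ⟨b⟩⟩ := exists_basis_prod_finsupp S L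
  have := projective_right_of_basis k S (SplitExt S L B) b
  let i : RMul (inS k S L) →ₗ[S] RMul (inS k S (SplitExt S L B)) :=
    { toFun := envIncl k S L B
      map_add' := map_add _
      map_smul' := fun s a => (map_mul (envIncl k S L B) (show Env k S L from a) (inS k S L s)).trans
        (congrArg _ (envIncl_inS k S L B s)) }
  let p : RMul (inS k S (SplitExt S L B)) →ₗ[S] RMul (inS k S L) :=
    { toFun := envProj k S L B
      map_add' := map_add _
      map_smul' := fun s a => (map_mul (envProj k S L B) (show Env k S (SplitExt S L B) from a) (inS k S _ s)).trans
        (congrArg _ (envProj_inS k S L B s)) }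
  exact Module.Projective.of_split i p (LinearMap.ext (envProj_incl k S L B))

instance projective_left : Module.Projective Sᵐᵒᵖ (RMul (AlgHom.op (inS k S L))) := by
  obtain ⟨B, X, ⟨b⟩⟩ := exists_basis_prod_finsupp S L
  have := projective_left_of_basis k S (SplitExt S L B) b
  let i : RMul (AlgHom.op (inS k S L)) →ₗ[Sᵐᵒᵖ] RMul (AlgHom.op (inS k S (SplitExt S L B))) :=
    { toFun := AlgHom.op (envIncl k S L B)
      map_add' := map_add _
      map_smul' := fun s a =>
        (map_mul (AlgHom.op (envIncl k S L B)) (show (Env k S L)ᵐᵒᵖ from a) (op (inS k S L s.unop))).trans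
        (congrArg _ (congrArg op (envIncl_inS k S L B s.unop))) }
  let p : RMul (AlgHom.op (inS k S (SplitExt S L B))) →ₗ[Sᵐᵒᵖ] RMul (AlgHom.op (inS k S L)) :=
    { toFun := AlgHom.op (envProj k S L B)
      map_add' := map_add _
      map_smul' := fun s a =>
        (map_mul (AlgHom.op (envProj k S L B)) (show (Env k S (SplitExt S L B))ᵐᵒᵖ from a) (op (inS k S _ s.unop))).trans
        (congrArg _ (congrArg op (envProj_inS k S L B s.unop))) }
  exact Module.Projective.of_split i p
    (LinearMap.ext fun a => congrArg op (envProj_incl k S L B (unop a)))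

instance projective_inSe : Module.Projective (Ae k S) (RMul (inSe k S L)) :=
  RMul.projective_tensor _ _

end Projective

/-! ### Spectral objects -/

section SpectralObject

open ComposableArrows

/-- The spectral object in an abelian category that is the image of a spectral object in a
triangulated category by a homological functor. -/
def mapHomological {C ι A : Type*} [Category* C] [Category* ι] [HasZeroObject C]
    [HasShift C ℤ] [Preadditive C] [∀ n : ℤ, (shiftFunctor C n).Additive] [Pretriangulated C]
    [Category* A] [Abelian A] (X : Triangulated.SpectralObject C ι) (F : C ⥤ A)
    [F.IsHomological] [F.ShiftSequence ℤ] : SpectralObject A ι where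
  H n := X.ω₁ ⋙ F.shift n
  δ' n₀ n₁ h :=
    { app := fun D => F.homologySequenceδ (X.ω₂.obj D) n₀ n₁ h
      naturality := fun _ _ φ =>
        F.homologySequenceδ_naturality _ _ (X.ω₂.map φ) n₀ n₁ h }
  exact₁' n₀ n₁ h D :=
    (F.homologySequence_exact₁ _ (X.ω₂_obj_distinguished D) n₀ n₁ h).exact_toComposableArrows
  exact₂' n D :=
    (F.homologySequence_exact₂ _ (X.ω₂_obj_distinguished D) n).exact_toComposableArrows
  exact₃' n₀ n₁ h D :=
    (F.homologySequence_exact₃ _ (X.ω₂_obj_distinguished D) n₀ n₁ h).exact_toComposableArrows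

/-- The map `g` induces a surjection from `B` to `im g / im (g f)` with kernel `im f + ker g`, which
is also the kernel of `π`. -/
theorem nonempty_equiv_range_quotient {k A B D E : Type*} [Ring k] [AddCommGroup A] [Module k A]
    [AddCommGroup B] [Module k B] [AddCommGroup D] [Module k D] [AddCommGroup E] [Module k E]
    (f : A →ₗ[k] B) (g : B →ₗ[k] D) (π : B →ₗ[k] E) (hπ : Function.Surjective π)
    (h : LinearMap.ker π = LinearMap.range f ⊔ LinearMap.ker g) :
    Nonempty (E ≃ₗ[k] (LinearMap.range g ⧸
      (LinearMap.range (g ∘ₗ f)).submoduleOf (LinearMap.range g))) := by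
  let π' := Submodule.mkQ ((LinearMap.range (g ∘ₗ f)).submoduleOf (LinearMap.range g)) ∘ₗ
    g.rangeRestrict
  have hπ' : Function.Surjective π' :=
    (Submodule.mkQ_surjective _).comp g.surjective_rangeRestrict
  have hker : LinearMap.ker π' = LinearMap.ker π := by
    rw [h]
    ext b
    rw [LinearMap.mem_ker]
    change Submodule.mkQ _ (g.rangeRestrict b) = 0 ↔ _
    rw [Submodule.mkQ_apply, Submodule.Quotient.mk_eq_zero, Submodule.mem_sup]
    constructor
    · rintro ⟨a, ha⟩
      refine ⟨f a, ⟨a, rfl⟩, b - f a, ?_, by simp⟩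
      have ha' : g (f a) = g b := ha
      simp [ha']
    · rintro ⟨_, ⟨a, rfl⟩, c, hc, rfl⟩
      refine ⟨a, ?_⟩
      have hc' : g c = 0 := hc
      change g (f a) = g (f a + c)
      simp [hc']
  exact ⟨(π.quotKerEquivOfSurjective hπ).symm.trans
    ((Submodule.quotEquivOfEq _ _ hker.symm).trans (π'.quotKerEquivOfSurjective hπ'))⟩

variable {k : Type u} [Field k]

theorem ker_eq_range_sup_range {A B D E : ModuleCat.{u} k} (f : A ⟶ B) (d : D ⟶ B) (π : B ⟶ E)
    (w : biprod.desc f d ≫ π = 0) (h : (ShortComplex.mk _ _ w).Exact) :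
    LinearMap.ker π.hom = LinearMap.range f.hom ⊔ LinearMap.range d.hom := by
  have hf : f ≫ π = 0 := by rw [← biprod.inl_desc f d, Category.assoc, w, comp_zero]
  have hd : d ≫ π = 0 := by rw [← biprod.inr_desc f d, Category.assoc, w, comp_zero]
  rw [ShortComplex.moduleCat_exact_iff] at h
  apply le_antisymm
  · intro b hb
    obtain ⟨x, rfl⟩ := h b hb
    refine Submodule.mem_sup.mpr ⟨_, ⟨(biprod.fst : A ⊞ D ⟶ A) x, rfl⟩, _,
      ⟨(biprod.snd : A ⊞ D ⟶ D) x, rfl⟩, ?_⟩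
    exact (congrArg (fun t : A ⊞ D ⟶ B => t.hom x) (biprod.desc_eq (f := f) (g := d))).symm
  · refine sup_le ?_ ?_
    · rintro _ ⟨a, rfl⟩
      exact congrArg (fun t => t.hom a) hf
    · rintro _ ⟨a, rfl⟩
      exact congrArg (fun t => t.hom a) hd

variable (Y : SpectralObject (ModuleCat.{u} k) EInt)

/-- With outer indices `⊥` and `⊤`, the object `E` is the cokernel of `f` together with the
connecting map into `H(⊥, j)`. The image of that connecting map is `ker g`, so `E` is a graded piece
of the filtration of `H(⊥, ⊤)` by images. -/
theorem nonempty_E_equiv_range_quotient {i j : EInt} (hij : i ≤ j) (n₀ n₁ n₂ : ℤ)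
    (hn₁ : n₀ + 1 = n₁) (hn₂ : n₁ + 1 = n₂) :
    Nonempty (Y.E (homOfLE (bot_le (a := i))) (homOfLE hij) (homOfLE (le_top (a := j))) n₀ n₁ n₂
        hn₁ hn₂ ≃ₗ[k]
      (LinearMap.range ((Y.H n₁).map (twoδ₂Toδ₁' ⊥ j ⊤ bot_le le_top)).hom ⧸
      (LinearMap.range ((Y.H n₁).map (twoδ₂Toδ₁' ⊥ i ⊤ bot_le le_top)).hom).submoduleOf
        (LinearMap.range ((Y.H n₁).map (twoδ₂Toδ₁' ⊥ j ⊤ bot_le le_top)).hom))) := by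
  let f := (Y.H n₁).map (twoδ₂Toδ₁' ⊥ i j bot_le hij)
  let g := (Y.H n₁).map (twoδ₂Toδ₁' ⊥ j ⊤ bot_le le_top)
  have hfg : f ≫ g = (Y.H n₁).map (twoδ₂Toδ₁' ⊥ i ⊤ bot_le le_top) := by
    rw [← Functor.map_comp]
    rfl
  have h₁ := Y.cokernelSequenceE_exact (homOfLE (bot_le (a := i))) (homOfLE hij)
    (homOfLE (le_top (a := j))) _ rfl n₀ n₁ n₂ hn₁ hn₂
  have h₂ := Y.exact₁ (homOfLE (bot_le (a := j))) (homOfLE (le_top (a := j))) _ rfl n₀ n₁ hn₁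
  let π : (Y.H n₁).obj (mk₁ (homOfLE (bot_le (a := j)))) ⟶
      Y.E (homOfLE (bot_le (a := i))) (homOfLE hij) (homOfLE (le_top (a := j))) n₀ n₁ n₂ hn₁ hn₂ :=
    (Y.cokernelSequenceE (homOfLE (bot_le (a := i))) (homOfLE hij)
      (homOfLE (le_top (a := j))) _ rfl n₀ n₁ n₂ hn₁ hn₂).g
  have hπ : Epi π := inferInstanceAs (Epi (Y.cokernelSequenceE (homOfLE (bot_le (a := i)))
    (homOfLE hij) (homOfLE (le_top (a := j))) _ rfl n₀ n₁ n₂ hn₁ hn₂).g)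
  rw [ModuleCat.epi_iff_surjective] at hπ
  have h₃ := h₂.moduleCat_range_eq_ker
  rw [← hfg, ModuleCat.hom_comp]
  refine nonempty_equiv_range_quotient f.hom g.hom π.hom hπ ?_
  refine (ker_eq_range_sup_range f
    (Y.δ (homOfLE (bot_le (a := j))) (homOfLE (le_top (a := j))) n₀ n₁ hn₁) π _ h₁).trans ?_
  exact congrArg (LinearMap.range f.hom ⊔ ·) h₃

/-- The spectral sequence of a first quadrant spectral object converges. -/
theorem convergesTo_of_isFirstQuadrant [Y.IsFirstQuadrant] :
    ConvergesTo Y.E₂SpectralSequenceNat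
      (fun n => (Y.H n).obj (mk₁ (homOfLE (bot_le (a := (⊤ : EInt)))))) := by
  intro n
  let g (i : EInt) := (Y.H n).map (twoδ₂Toδ₁' ⊥ i ⊤ bot_le le_top)
  -- `F^p` is the image of the truncation to degrees `< n - p + 1`, that is, to degrees at most `q`
  -- when `p + q = n`. At `p = 0` the complementary part `≥ n + 1` has no cohomology in degree `n`;
  -- at `p = n + 1` the truncation is `< 0` and vanishes.
  refine ⟨fun p => LinearMap.range (g ((n - p + 1 : ℤ) : EInt)).hom, ?_, ?_, ?_, ?_⟩
  · intro p p' hp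
    have hle : ((n - p' + 1 : ℤ) : EInt) ≤ ((n - p + 1 : ℤ) : EInt) := by
      simp only [WithBotTop.coe_le_coe]
      lia
    have : (Y.H n).map (twoδ₂Toδ₁' ⊥ _ _ bot_le hle) ≫ g ((n - p + 1 : ℤ) : EInt) =
        g ((n - p' + 1 : ℤ) : EInt) := by
      rw [← Functor.map_comp]
      rfl
    rintro _ ⟨a, rfl⟩
    exact ⟨(Y.H n).map (twoδ₂Toδ₁' ⊥ _ _ bot_le hle) a, congrArg (fun t => t.hom a) this⟩
  · have h : Epi (g ((n - (0 : ℕ) + 1 : ℤ) : EInt)) :=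
      (Y.exact₂ _ _ _ rfl n).epi_f ((Y.isZero₂_of_isFirstQuadrant _ _ _ n (by
        simp only [WithBotTop.coe_lt_coe]
        lia)).eq_of_tgt _ _)
    rw [ModuleCat.epi_iff_surjective] at h
    exact LinearMap.range_eq_top.mpr h
  · have h : g ((n - (n + 1 : ℕ) + 1 : ℤ) : EInt) = 0 :=
      (Y.isZero₁_of_isFirstQuadrant _ _ _ (by
        simp only [WithBotTop.coe_le_coe]
        lia) n).eq_of_src _ _
    change LinearMap.range (g _).hom = ⊥
    rw [h]
    exact LinearMap.range_zero
  · intro p q hpq r hr hp hq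
    -- The entry at `(p, q)` of page `r` has indices `q - r + 2 ≤ q ≤ q + 1 ≤ q + r - 1`. The bound
    -- `q + 2 ≤ r` makes the first at most `0`, so it can be lowered to `⊥`. The bound `p + 1 ≤ r`
    -- makes the last at least `n`, so it can be raised to `⊤`.
    have h₀₁ : ((q - r + 2 : ℤ) : EInt) ≤ (q : ℤ) := by
      simp only [WithBotTop.coe_le_coe]
      lia
    have h₁₂ : ((q : ℤ) : EInt) ≤ (q + 1 : ℤ) := by
      simp only [WithBotTop.coe_le_coe]
      lia
    have h₂₃ : ((q + 1 : ℤ) : EInt) ≤ (q + r - 1 : ℤ) := by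
      simp only [WithBotTop.coe_le_coe]
      lia
    let e₁ := Y.spectralSequencePageXIso SpectralObject.coreE₂CohomologicalNat r hr (p, q)
      (q - r + 2 : ℤ) (q : ℤ) (q + 1 : ℤ) (q + r - 1 : ℤ) rfl rfl rfl rfl
      (n - 1) n (n + 1) (by simp; lia)
    let e₂ := Y.isoMapFourδ₁Toδ₀' ⊥ _ _ _ _ bot_le h₀₁ h₁₂ h₂₃ (n - 1) n (n + 1)
      (Y.isZero₁_of_isFirstQuadrant _ _ _ (by
        simp only [WithBotTop.coe_le_coe]
        lia) _)
    let e₃ := Y.isoMapFourδ₄Toδ₃' ⊥ _ _ _ ⊤ bot_le h₁₂ h₂₃ le_top (n - 1) n (n + 1)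
      (Y.isZero₂_of_isFirstQuadrant _ _ _ _ (by
        simp only [WithBotTop.coe_lt_coe]
        lia))
    obtain ⟨e₄⟩ := nonempty_E_equiv_range_quotient Y h₁₂ (n - 1) n (n + 1) (by lia) rfl
    have hp₁ : (n - p + 1 : ℤ) = q + 1 := by lia
    have hp₂ : (n - (p + 1 : ℕ) + 1 : ℤ) = q := by lia
    beta_reduce
    rw [hp₁, hp₂]
    exact ⟨(e₁ ≪≫ e₂.symm ≪≫ e₃).toLinearEquiv.trans e₄⟩

theorem ConvergesTo.of_equiv {E : E₂CohomologicalSpectralSequenceNat (ModuleCat.{u} k)}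
    {H H' : ℕ → ModuleCat.{u} k} (h : ConvergesTo E H) (e : ∀ n, H n ≃ₗ[k] H' n) :
    ConvergesTo E H' := by
  intro n
  obtain ⟨F, hF, hF₀, hFn, hE⟩ := h n
  refine ⟨fun p => (F p).map (e n).toLinearMap, fun p q hpq => Submodule.map_mono (hF hpq), ?_, ?_,
    fun p q hpq r hr hp hq => ?_⟩
  · beta_reduce
    rw [hF₀, Submodule.map_top, LinearEquiv.range]
  · beta_reduce
    rw [hFn, Submodule.map_bot]
  · obtain ⟨e'⟩ := hE p q hpq r hr hp hq
    refine ⟨e'.trans (Submodule.Quotient.equiv _ _ ((e n).submoduleMap (F p)) ?_)⟩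
    ext ⟨_, x, hx, rfl⟩
    constructor
    · rintro ⟨⟨y, hy⟩, hy', hyx⟩
      have : y = x := (e n).injective (congrArg Subtype.val hyx)
      subst this
      exact ⟨y, hy', rfl⟩
    · rintro ⟨y, hy, hyx⟩
      have : y = x := (e n).injective hyx
      subst this
      exact ⟨⟨y, hx⟩, hy, rfl⟩

end SpectralObject

/-! ### The hypercohomology spectral sequence -/

section SmallHom

universe w v

variable (k : Type u) [Field k] {T : Type v} [Category.{w} T] [Preadditive T] [Linear k T]
  (X : T) [∀ Z : T, Small.{u} (X ⟶ Z)]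

/-- The functor `Hom(X, -)` with values in the category of `k`-modules in a universe in which
the spaces of morphisms from `X` are small. -/
def shrinkHom : T ⥤ ModuleCat.{u} k where
  obj Z := ModuleCat.of k (Shrink.{u} (X ⟶ Z))
  map {Z Z'} g := ModuleCat.ofHom ((Shrink.linearEquiv k (X ⟶ Z')).symm.toLinearMap ∘ₗ
    Linear.rightComp k X g ∘ₗ (Shrink.linearEquiv k (X ⟶ Z)).toLinearMap)
  map_id Z := by
    ext x
    simp
  map_comp f g := by
    ext x
    simp

/-- The values of `shrinkHom`. -/
def shrinkHomEquiv (Z : T) : (shrinkHom k X).obj Z ≃ₗ[k] (X ⟶ Z) := Shrink.linearEquiv k (X ⟶ Z)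

theorem shrinkHomEquiv_map {Z Z' : T} (g : Z ⟶ Z') (x : (shrinkHom k X).obj Z) :
    shrinkHomEquiv k X Z' ((shrinkHom k X).map g x) = shrinkHomEquiv k X Z x ≫ g :=
  (Shrink.linearEquiv k (X ⟶ Z')).apply_symm_apply _

instance : (shrinkHom k X).Additive where
  map_add {Z Z' f g} := by
    ext x
    apply (shrinkHomEquiv k X Z').injective
    rw [shrinkHomEquiv_map, Preadditive.comp_add, ModuleCat.hom_add, LinearMap.add_apply, map_add]
    exact congrArg₂ (· + ·) (shrinkHomEquiv_map k X f x).symm (shrinkHomEquiv_map k X g x).symm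

theorem isZero_shrinkHom_obj {Z : T} (h : ∀ f : X ⟶ Z, f = 0) :
    IsZero ((shrinkHom k X).obj Z) := by
  have : Subsingleton ((shrinkHom k X).obj Z) :=
    ⟨fun x y => (shrinkHomEquiv k X Z).injective ((h _).trans (h _).symm)⟩
  exact ModuleCat.isZero_of_subsingleton _

variable [HasZeroObject T] [HasShift T ℤ] [∀ n : ℤ, (shiftFunctor T n).Additive]
  [Pretriangulated T]

instance : (shrinkHom k X).IsHomological where
  exact D hD := by
    rw [ShortComplex.moduleCat_exact_iff]
    intro x hx
    have hx' : shrinkHomEquiv k X D.obj₂ x ≫ D.mor₂ = 0 :=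
      (shrinkHomEquiv_map k X D.mor₂ x).symm.trans
        ((congrArg (shrinkHomEquiv k X D.obj₃) hx).trans (map_zero _))
    obtain ⟨y, hy⟩ := D.coyoneda_exact₂ hD _ hx'
    refine ⟨(shrinkHomEquiv k X D.obj₁).symm y, (shrinkHomEquiv k X D.obj₂).injective ?_⟩
    exact (shrinkHomEquiv_map k X D.mor₁ _).trans
      ((congrArg (· ≫ D.mor₁) ((shrinkHomEquiv k X D.obj₁).apply_symm_apply y)).trans hy.symm)

instance : (shrinkHom k X).ShiftSequence ℤ := Functor.ShiftSequence.tautological _ _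

end SmallHom

/-- An isomorphism `Y ≅ Y'` induces isomorphisms `Ext^n(X, Y) ≅ Ext^n(X, Y')`. -/
def extCongr (k : Type u) [Field k] {C : Type*} [Category* C] [Abelian C] [Linear k C]
    [HasExt C] (X : C) {Y Y' : C} (e : Y ≅ Y') (n : ℕ) : Ext X Y n ≃ₗ[k] Ext X Y' n where
  toFun x := x.comp (Ext.mk₀ e.hom) (add_zero n)
  map_add' x y := Ext.add_comp ..
  map_smul' c x := Ext.smul_comp ..
  invFun x := x.comp (Ext.mk₀ e.inv) (add_zero n)
  left_inv x := by simp
  right_inv x := by simp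

section Hypercohomology

universe w v

variable {C : Type v} [Category.{u} C] [Abelian C] [HasDerivedCategory.{w} C]

open DerivedCategory

/-- A projective resolution of `X` is K-projective, so every morphism comes from the homotopy
category, where morphisms lie in the universe of `C`. This holds for unbounded `Z` as well. -/
instance [EnoughProjectives C] (X : C) (Z : DerivedCategory C) :
    Small.{u} ((singleFunctor C 0).obj X ⟶ Z) := by
  let P := ProjectiveResolution.of X
  let e₁ : Qh.obj ((HomotopyCategory.quotient C _).obj P.cochainComplex) ≅
      (singleFunctor C 0).obj X :=
    (quotientCompQhIso C).app _ ≪≫ asIso (Q.map P.π') ≪≫ (singleFunctorIsoCompQ C 0).symm.app X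
  let e₂ : Qh.obj ((HomotopyCategory.quotient C _).obj (Q.objPreimage Z)) ≅ Z :=
    (quotientCompQhIso C).app _ ≪≫ Q.objObjPreimageIso Z
  have h := CochainComplex.IsKProjective.Qh_map_bijective
    (K := P.cochainComplex) ((HomotopyCategory.quotient C _).obj (Q.objPreimage Z))
  exact small_of_surjective ((e₁.homCongr e₂).surjective.comp h.surjective)

/-- The truncation `τ_{< q + 1} Z` has the same cohomology as `Z` in degree `q`. -/
theorem isIso_homologyFunctor_map_eTruncLTι (Z : DerivedCategory C) (q : ℤ) :
    IsIso ((homologyFunctor C q).map ((TStructure.t.eTruncLTι (q + 1 : ℤ)).app Z)) := by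
  let T := (TStructure.t.eTriangleLTGE.obj ((q + 1 : ℤ) : EInt)).obj Z
  have hT := TStructure.t.eTriangleLTGE_distinguished (q + 1 : ℤ) Z
  have : T.obj₃.IsGE (q + 1) := TStructure.t.isGE_eTruncGE_obj_obj (q + 1) (q + 1 : ℤ) le_rfl Z
  have h₁ : Mono ((homologyFunctor C q).map T.mor₁) :=
    (HomologySequence.mono_homologyMap_mor₁_iff T hT (q - 1) q).mpr
      ((isZero_of_isGE T.obj₃ (q + 1) (q - 1) (by lia)).eq_of_src _ _)
  have h₂ : Epi ((homologyFunctor C q).map T.mor₁) :=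
    (HomologySequence.epi_homologyMap_mor₁_iff T hT q).mpr
      ((isZero_of_isGE T.obj₃ (q + 1) q (by lia)).eq_of_tgt _ _)
  exact isIso_of_mono_of_epi ((homologyFunctor C q).map T.mor₁)

/-- The truncation `τ_{≥ q} Z` has the same cohomology as `Z` in degree `q`. -/
theorem isIso_homologyFunctor_map_eTruncGEπ (Z : DerivedCategory C) (q : ℤ) :
    IsIso ((homologyFunctor C q).map ((TStructure.t.eTruncGEπ (q : ℤ)).app Z)) := by
  let T := (TStructure.t.eTriangleLTGE.obj ((q : ℤ) : EInt)).obj Z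
  have hT := TStructure.t.eTriangleLTGE_distinguished (q : ℤ) Z
  have : T.obj₁.IsLE (q - 1) := TStructure.t.isLE_eTruncLT_obj_obj (q - 1) (q : ℤ) (by simp) Z
  have h₁ : Mono ((homologyFunctor C q).map T.mor₂) :=
    (HomologySequence.mono_homologyMap_mor₂_iff T hT q).mpr
      ((isZero_of_isLE T.obj₁ (q - 1) q (by lia)).eq_of_src _ _)
  have h₂ : Epi ((homologyFunctor C q).map T.mor₂) :=
    (HomologySequence.epi_homologyMap_mor₂_iff T hT q (q + 1)).mpr
      ((isZero_of_isLE T.obj₁ (q - 1) (q + 1) (by lia)).eq_of_tgt _ _)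
  exact isIso_of_mono_of_epi ((homologyFunctor C q).map T.mor₂)

/-- The truncation of `Z` in a single degree `q` is the object `H^q(Z)` in degree `q`. -/
theorem nonempty_eTrunc_iso_single (Z : DerivedCategory C) (q : ℤ) :
    Nonempty ((TStructure.t.eTruncGE.obj (q : ℤ)).obj
      ((TStructure.t.eTruncLT.obj (q + 1 : ℤ)).obj Z) ≅
        (singleFunctor C q).obj ((homologyFunctor C q).obj Z)) := by
  have := TStructure.t.isGE_eTruncGE_obj_obj q (q : ℤ) le_rfl
    ((TStructure.t.eTruncLT.obj (q + 1 : ℤ)).obj Z)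
  have := TStructure.t.isLE_eTruncLT_obj_obj q (q + 1 : ℤ) le_rfl Z
  obtain ⟨Y, ⟨e⟩⟩ := exists_iso_singleFunctor_obj_of_isGE_of_isLE
    ((TStructure.t.eTruncGE.obj (q : ℤ)).obj ((TStructure.t.eTruncLT.obj (q + 1 : ℤ)).obj Z)) q
  have := isIso_homologyFunctor_map_eTruncLTι Z q
  have := isIso_homologyFunctor_map_eTruncGEπ ((TStructure.t.eTruncLT.obj (q + 1 : ℤ)).obj Z) q
  let e₁ : Y ≅ (homologyFunctor C q).obj ((singleFunctor C q).obj Y) :=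
    (singleFunctorCompHomologyFunctorIso C q).symm.app Y
  refine ⟨e ≪≫ (singleFunctor C q).mapIso (e₁ ≪≫ (homologyFunctor C q).mapIso e.symm ≪≫
    (asIso ((homologyFunctor C q).map ((TStructure.t.eTruncGEπ (q : ℤ)).app
      ((TStructure.t.eTruncLT.obj (q + 1 : ℤ)).obj Z)))).symm ≪≫
    asIso ((homologyFunctor C q).map ((TStructure.t.eTruncLTι (q + 1 : ℤ)).app Z)))⟩

/-- Morphisms to a bounded below complex of injective objects in the derived category are
cohomology classes of the complex of morphisms. -/
theorem exists_linearMap_cocycles (k : Type u) [Field k] [Linear k C] (X : C)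
    (K : CochainComplex C ℤ) [K.IsKInjective] (n : ℤ) :
    ∃ τ : LinearMap.ker (Linear.rightComp k X (K.d n (n + 1))) →ₗ[k]
        ((singleFunctor C 0).obj X ⟶ (Q.obj K)⟦n⟧),
      Function.Surjective τ ∧
        ∀ f, τ f = 0 ↔ ∃ g : X ⟶ K.X (n - 1), g ≫ K.d (n - 1) n = f.1 := by
  -- A cocycle `f` gives a degree `n` cocycle `z` from `X` in degree `0` to `K`, hence a chain map
  -- `c` from `X` to `K⟦n⟧`.
  let z (f : X ⟶ K.X n) (hf : f ≫ K.d n (n + 1) = 0) :=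
    CochainComplex.HomComplex.Cocycle.fromSingleMk f (zero_add n) (n + 1) rfl hf
  let c (f : X ⟶ K.X n) (hf : f ≫ K.d n (n + 1) = 0) :=
    CochainComplex.HomComplex.Cocycle.equivHomShift.symm (z f hf)
  let e₁ := (singleFunctorIsoCompQ C 0).app X
  let e₂ := (Q.commShiftIso n).app K
  let A : CochainComplex C ℤ := (CochainComplex.singleFunctor C 0).obj X
  -- As `K⟦n⟧` is K-injective, morphisms into it are the same in the homotopy and derived
  -- categories: `hQ` uses injectivity, `hQ'` surjectivity.
  have hQ (g : A ⟶ K⟦n⟧) : Q.map g = 0 ↔ (HomotopyCategory.quotient C _).map g = 0 := by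
    have hi := (CochainComplex.IsKInjective.Qh_map_bijective
      ((HomotopyCategory.quotient C _).obj A) (K⟦n⟧)).injective
    have hn := (quotientCompQhIso C).hom.naturality g
    constructor
    · intro h
      refine hi ?_
      rw [Functor.map_zero, ← cancel_mono ((quotientCompQhIso C).hom.app _)]
      refine hn.trans ?_
      rw [h, comp_zero, zero_comp]
    · intro h
      rw [← cancel_epi ((quotientCompQhIso C).hom.app _), ← hn, Functor.comp_map, h,
        Functor.map_zero, zero_comp, comp_zero]
  have hQ' (g : Q.obj A ⟶ Q.obj (K⟦n⟧)) : ∃ g₀, Q.map g₀ = g := by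
    obtain ⟨g₁, hg₁⟩ := (CochainComplex.IsKInjective.Qh_map_bijective
      ((HomotopyCategory.quotient C _).obj A) (K⟦n⟧)).surjective
        ((quotientCompQhIso C).hom.app _ ≫ g ≫ (quotientCompQhIso C).inv.app _)
    obtain ⟨g₀, rfl⟩ := (HomotopyCategory.quotient C _).map_surjective g₁
    refine ⟨g₀, ?_⟩
    rw [← cancel_epi ((quotientCompQhIso C).hom.app _),
      ← (quotientCompQhIso C).hom.naturality g₀, Functor.comp_map, hg₁]
    simp
  have hz (f) (hf : f ≫ K.d n (n + 1) = 0) : Q.map (c f hf) = 0 ↔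
      ∃ g : X ⟶ K.X (n - 1), g ≫ K.d (n - 1) n = f := by
    rw [← CochainComplex.HomComplex.Cocycle.fromSingleMk_mem_coboundaries_iff f (zero_add n)
      (n + 1) rfl hf (n - 1) (by lia),
      ← CochainComplex.HomComplex.CohomologyClass.toHom_mk_eq_zero_iff]
    exact hQ _
  refine ⟨{ toFun := fun f => e₁.hom ≫ Q.map (c f.1 f.2) ≫ e₂.hom
            map_add' := ?_
            map_smul' := ?_ }, ?_, ?_⟩
  · rintro ⟨f, hf⟩ ⟨g, hg⟩
    have hfg : (f + g) ≫ K.d n (n + 1) = 0 := by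
      rw [Preadditive.add_comp]
      exact (congrArg₂ (· + ·) hf hg).trans (add_zero 0)
    have h : c (f + g) hfg = c f hf + c g hg :=
      (congrArg _ (CochainComplex.HomComplex.Cocycle.fromSingleMk_add f g (zero_add n) _ rfl
        hf hg)).trans (map_add CochainComplex.HomComplex.Cocycle.equivHomShift.symm _ _)
    change e₁.hom ≫ Q.map (c (f + g) _) ≫ e₂.hom = _
    rw [h, Functor.map_add, Preadditive.add_comp, Preadditive.comp_add]
  -- Compatibility with scalars is naturality in `X`, applied to the endomorphism `r • 𝟙 X`.
  · rintro r ⟨f, hf⟩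
    have hrf : (r • f) ≫ K.d n (n + 1) = 0 := by
      rw [Linear.smul_comp]
      exact (congrArg (r • ·) hf).trans (smul_zero r)
    have hr : r • f = (r • 𝟙 X) ≫ f := by rw [Linear.smul_comp, Category.id_comp]
    have hc (f') (hf') (h : f' = (r • 𝟙 X) ≫ f) : c f' hf' =
        (CochainComplex.singleFunctor C 0).map (r • 𝟙 X) ≫ c f hf := by
      subst h
      exact (congrArg _ (CochainComplex.HomComplex.Cocycle.fromSingleMk_precomp (r • 𝟙 X) f
        (zero_add n) _ rfl hf)).trans
          (CochainComplex.HomComplex.Cocycle.equivHomShift_symm_precomp (z f hf) _)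
    have h := hc _ hrf hr
    have h' : e₁.hom ≫ Q.map ((CochainComplex.singleFunctor C 0).map (r • 𝟙 X)) = r • e₁.hom := by
      have := (singleFunctorIsoCompQ C 0).hom.naturality (r • 𝟙 X)
      rw [CategoryTheory.Functor.map_smul, CategoryTheory.Functor.map_id, Linear.smul_comp, Category.id_comp] at this
      exact this.symm
    change e₁.hom ≫ Q.map (c (r • f) _) ≫ e₂.hom = r • (e₁.hom ≫ Q.map (c f hf) ≫ e₂.hom)
    rw [h, Functor.map_comp, Category.assoc, ← Category.assoc, h', Linear.smul_comp]
  · intro g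
    obtain ⟨g₀, hg₀⟩ := hQ' (e₁.inv ≫ g ≫ e₂.inv)
    obtain ⟨f, hf, hf'⟩ := CochainComplex.HomComplex.Cocycle.fromSingleMk_surjective
      (CochainComplex.HomComplex.Cocycle.equivHomShift g₀) n (zero_add n) (n + 1) rfl
    refine ⟨⟨f, hf⟩, ?_⟩
    have h : c f hf = g₀ := by
      apply CochainComplex.HomComplex.Cocycle.equivHomShift.injective
      rw [← hf']
      exact CochainComplex.HomComplex.Cocycle.equivHomShift.apply_symm_apply _
    change e₁.hom ≫ Q.map (c f hf) ≫ e₂.hom = g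
    rw [h, hg₀]
    simp
  · rintro ⟨f, hf⟩
    rw [← hz f hf]
    simp

variable (k : Type u) [Field k] [Linear k C] [EnoughProjectives C] (X : C) (Z : DerivedCategory C)

open ComposableArrows

/-- The spectral object obtained by applying `Hom(X, -)` to the truncations of an object of the
derived category. -/
def homSpectralObject : SpectralObject (ModuleCat.{u} k) EInt :=
  mapHomological (TStructure.t.spectralObject Z) (shrinkHom k ((singleFunctor C 0).obj X))

/-- The objects of the spectral object `homSpectralObject`. -/
def homSpectralObjectEquiv {i j : EInt} (hij : i ≤ j) (n : ℤ) :
    ((homSpectralObject k X Z).H n).obj (mk₁ (homOfLE hij)) ≃ₗ[k]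
      ((singleFunctor C 0).obj X ⟶
        ((TStructure.t.eTruncGE.obj i).obj ((TStructure.t.eTruncLT.obj j).obj Z))⟦n⟧) :=
  shrinkHomEquiv k _ _

theorem isZero_homSpectralObject {i j : EInt} (hij : i ≤ j) (n : ℤ)
    (h : ∀ f : (singleFunctor C 0).obj X ⟶
      ((TStructure.t.eTruncGE.obj i).obj ((TStructure.t.eTruncLT.obj j).obj Z))⟦n⟧, f = 0) :
    IsZero (((homSpectralObject k X Z).H n).obj (mk₁ (homOfLE hij))) :=
  isZero_shrinkHom_obj k _ h

/-- Truncations of `Z` below a non-positive degree vanish. For `n < i`, an object in degrees `≥ i`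
shifted by `n` lies in degrees `≥ 1` and receives only zero from `X`, which lies in degree `0`. -/
instance [Z.IsGE 0] : (homSpectralObject k X Z).IsFirstQuadrant where
  isZero₁ i j hij hj n := by
    refine isZero_homSpectralObject k X Z hij n fun f => IsZero.eq_of_tgt ?_ _ _
    exact Functor.map_isZero _ (Functor.map_isZero _
      (TStructure.t.isZero_eTruncLT_obj_obj Z 0 j hj))
  isZero₂ i j hij n hi := by
    refine isZero_homSpectralObject k X Z hij n fun f => ?_
    have := TStructure.t.isGE_eTruncGE_obj_obj (n + 1) i (by
      induction i using WithBotTop.rec with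
      | bot => simp at hi
      | coe i =>
        simp only [WithBotTop.coe_le_coe]
        simp only [WithBotTop.coe_lt_coe] at hi
        lia
      | top => simp) ((TStructure.t.eTruncLT.obj j).obj Z)
    have := TStructure.t.isGE_shift
      ((TStructure.t.eTruncGE.obj i).obj ((TStructure.t.eTruncLT.obj j).obj Z)) (n + 1) n 1
    exact TStructure.t.zero f 0 1

/-- The entry consists of the morphisms of degree `p + q` from `X` to the truncation to degree `q`,
which is `H^q(Z)[-q]`; the shifts combine to `[p]`. -/
theorem nonempty_page_two_iso [HasExt.{u} C] [Z.IsGE 0] (p q : ℕ) :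
    Nonempty (((homSpectralObject k X Z).E₂SpectralSequenceNat.page 2 le_rfl).X (p, q) ≅
      ModuleCat.of k (Ext X ((homologyFunctor C q).obj Z) p)) := by
  obtain ⟨e⟩ := nonempty_eTrunc_iso_single Z q
  have hq : ((q : ℤ) : EInt) ≤ (q + 1 : ℤ) := by simp
  let Y := (homologyFunctor C q).obj Z
  let e₁ := (homSpectralObject k X Z).spectralSequenceFirstPageXIso
    SpectralObject.coreE₂CohomologicalNat (p, q) (q : ℤ) (q + 1 : ℤ) rfl rfl (p + q) rfl
  -- Both sides are `H^q(Z)` placed in degree `-p`.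
  let e₂ : ((TStructure.t.eTruncGE.obj (q : ℤ)).obj
      ((TStructure.t.eTruncLT.obj (q + 1 : ℤ)).obj Z))⟦(p + q : ℤ)⟧ ≅
        ((singleFunctor C 0).obj Y)⟦(p : ℤ)⟧ :=
    (shiftFunctor (DerivedCategory C) (p + q : ℤ)).mapIso e ≪≫
      ((singleFunctors C).shiftIso (p + q) (-p) q (by lia)).app Y ≪≫
      ((singleFunctors C).shiftIso p (-p) 0 (by lia)).symm.app Y
  exact ⟨e₁ ≪≫ ((homSpectralObjectEquiv k X Z hq (p + q)).trans
    ((Linear.homCongr k (Iso.refl _) e₂).trans (Ext.homLinearEquiv (n := p)).symm)).toModuleIso⟩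

theorem nonempty_equiv_of_surjective {A B B' : Type*} [AddCommGroup A] [Module k A]
    [AddCommGroup B] [Module k B] [AddCommGroup B'] [Module k B'] (f : A →ₗ[k] B) (g : A →ₗ[k] B')
    (hf : Function.Surjective f) (hg : Function.Surjective g) (h : ∀ a, f a = 0 ↔ g a = 0) :
    Nonempty (B ≃ₗ[k] B') :=
  ⟨(f.quotKerEquivOfSurjective hf).symm.trans
    ((Submodule.quotEquivOfEq _ _ (Submodule.ext h)).trans (g.quotKerEquivOfSurjective hg))⟩

end Hypercohomology

/-- Let `K` be a complex of injective objects in non-negative degrees. There is a spectral sequence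
with second page `Ext^p(X, H^q(K))` that converges to the cohomology of `Hom(X, K)`. -/
theorem exists_spectralSequence {k : Type u} [Field k] {C : Type*} [Category.{u} C] [Abelian C]
    [Linear k C] [EnoughProjectives C] [HasExt.{u} C] (X : C) (K : CochainComplex C ℤ)
    [K.IsStrictlyGE 0] [∀ n, Injective (K.X n)] (H : ℕ → ModuleCat.{u} k)
    (σ : ∀ n : ℕ, LinearMap.ker (Linear.rightComp k X (K.d n (n + 1))) →ₗ[k] H n)
    (hσ : ∀ n, Function.Surjective (σ n))
    (hσ' : ∀ n f, σ n f = 0 ↔ ∃ g : X ⟶ K.X (n - 1), g ≫ K.d (n - 1) n = f.1) :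
    ∃ E : E₂CohomologicalSpectralSequenceNat (ModuleCat.{u} k),
      (∀ p q : ℕ, Nonempty ((E.page 2 le_rfl).X (p, q) ≅ ModuleCat.of k (Ext X (K.homology q) p))) ∧
      ConvergesTo E H := by
  let := HasDerivedCategory.standard C
  have : K.IsKInjective := CochainComplex.isKInjective_of_injective K 0
  let Z := DerivedCategory.Q.obj K
  refine ⟨(homSpectralObject k X Z).E₂SpectralSequenceNat, fun p q => ?_, ?_⟩
  · obtain ⟨e⟩ := nonempty_page_two_iso k X Z p q
    let e' := (DerivedCategory.homologyFunctorFactors C q).app K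
    exact ⟨e ≪≫ (extCongr k X e' p).toModuleIso⟩
  -- The morphisms from `X` to `K⟦n⟧` and the space `H n` are quotients of the same space of
  -- cocycles by the same coboundaries.
  · have h (n : ℕ) : Nonempty (((homSpectralObject k X Z).H n).obj
        (ComposableArrows.mk₁ (homOfLE (bot_le (a := (⊤ : EInt))))) ≃ₗ[k] H n) := by
      obtain ⟨τ, hτ, hτ'⟩ := exists_linearMap_cocycles k X K n
      obtain ⟨e⟩ := nonempty_equiv_of_surjective k τ (σ n) hτ (hσ n)
        fun f => (hτ' f).trans (hσ' n f).symm
      exact ⟨(homSpectralObjectEquiv k X Z bot_le n).trans e⟩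
    exact (convergesTo_of_isFirstQuadrant _).of_equiv fun n => (h n).some

/-! ### Restriction of injective modules along a flat extension. -/

section RestrictInjective

variable {k R A : Type u} [Field k] [CommRing R] [Algebra k R] [Ring A] [Algebra k A]
  (f : R →ₐ[k] A)

theorem RMul.tmul_mul {X : Type u} [AddCommGroup X] [Module R X] (a : A) (r : R) (x : X) :
    toRMul f (a * f r) ⊗ₜ[R] x = toRMul f a ⊗ₜ[R] (r • x) := by
  rw [← smul_toRMul, TensorProduct.smul_tmul]

theorem RMul.smul_tmul {X : Type u} [AddCommGroup X] [Module R X] (a b : A) (x : X) :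
    a • (toRMul f b ⊗ₜ[R] x : RMul f ⊗[R] X) = toRMul f (a * b) ⊗ₜ[R] x := rfl

theorem RMul.tensor_induction {X : Type u} [AddCommGroup X] [Module R X]
    {P : RMul f ⊗[R] X → Prop} (tmul : ∀ a x, P (toRMul f a ⊗ₜ[R] x))
    (add : ∀ y z, P y → P z → P (y + z)) (y : RMul f ⊗[R] X) : P y := by
  induction y using TensorProduct.induction_on with
  | zero => simpa using tmul 0 0
  | tmul a x => exact tmul a x
  | add y z hy hz => exact add y z hy hz

/-- The map `A ⊗ X → M`, `a ⊗ x ↦ a g(x)`, for an `R`-linear map `g` from `X` to an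
`A`-module `M`. -/
def RMul.liftTensor {X : Type u} [AddCommGroup X] [Module R X] {M : Type u} [AddCommGroup M]
    [Module A M] (g : X →+ M) (hg : ∀ (r : R) x, g (r • x) = f r • g x) :
    RMul f ⊗[R] X →ₗ[A] M :=
  let l : RMul f ⊗[R] X →+ M := TensorProduct.liftAddHom
    (AddMonoidHom.mk' (fun a : RMul f => AddMonoidHom.mk' (fun x => (toRMul f).symm a • g x)
        (fun x y => by rw [map_add, smul_add]))
      (fun a b => by
        ext x
        change (toRMul f).symm (a + b) • g x = (toRMul f).symm a • g x + (toRMul f).symm b • g x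
        rw [map_add, add_smul]))
    (fun r a x => by
      change ((toRMul f).symm a * f r) • g x = (toRMul f).symm a • g (r • x)
      rw [hg, mul_smul])
  { l with
    map_smul' := fun a y => by
      change l (a • y) = a • l y
      induction y using RMul.tensor_induction f with
      | tmul b x => exact mul_smul a b (g x)
      | add y z hy hz => rw [smul_add, map_add, map_add, smul_add, hy, hz] }

/-- The map `A ⊗ X → A ⊗ Y` induced by an `R`-linear map `X → Y`. -/
def RMul.mapTensor {X Y : Type u} [AddCommGroup X] [Module R X] [AddCommGroup Y] [Module R Y]
    (g : X →ₗ[R] Y) : RMul f ⊗[R] X →ₗ[A] RMul f ⊗[R] Y :=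
  { LinearMap.lTensor (RMul f) g with
    map_smul' := fun a y => by
      change LinearMap.lTensor (RMul f) g (a • y) = a • LinearMap.lTensor (RMul f) g y
      induction y using RMul.tensor_induction f with
      | tmul b x => rfl
      | add y z hy hz => rw [smul_add, map_add, map_add, smul_add, hy, hz] }

theorem RMul.mapTensor_injective {X Y : Type u} [AddCommGroup X] [Module R X] [AddCommGroup Y]
    [Module R Y] [Module.Flat R (RMul f)] (g : X →ₗ[R] Y) (hg : Function.Injective g) :
    Function.Injective (mapTensor f g) :=
  Module.Flat.lTensor_preserves_injective_linearMap g hg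

/-- If `A` is flat as a right module over `R`, the restriction of an injective `A`-module to `R`
is injective. -/
theorem injective_restrictScalars [Module.Flat R (RMul f)] (I : ModuleCat.{u} A) [Injective I] :
    Injective ((ModuleCat.restrictScalars f.toRingHom).obj I) := by
  have hI : Module.Injective A I := Module.injective_module_of_injective_object A I
  let Q := (ModuleCat.restrictScalars f.toRingHom).obj I
  have : Module.Injective R Q := by
    refine ⟨fun X Y _ _ _ _ j hj g => ?_⟩
    -- Extension of scalars is left adjoint to restriction and preserves injections by flatness.
    -- Extend the adjoint map over `A ⊗ Y`, then restrict it to `1 ⊗ Y`.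
    obtain ⟨h, hh⟩ := hI.out (RMul.mapTensor f j) (RMul.mapTensor_injective f j hj)
      (RMul.liftTensor f (M := I) g.toAddMonoidHom fun r x => g.map_smul r x)
    refine ⟨{ toFun := fun y => h (toRMul f 1 ⊗ₜ[R] y)
              map_add' := fun y z => by rw [TensorProduct.tmul_add, map_add]; rfl
              map_smul' := fun r y => ?_ }, fun x => ?_⟩
    · rw [← RMul.tmul_mul, one_mul]
      refine Eq.trans ?_ (h.map_smul (f r) _)
      rw [RMul.smul_tmul, mul_one]
    · exact (hh (toRMul f 1 ⊗ₜ[R] x)).trans (one_smul A (show I from g x))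
  exact Module.injective_object_of_injective_module R Q

end RestrictInjective

/-! ### Restriction to `S^e` preserves injectives; linearity checked on generators. -/

section Linearity

attribute [local instance 100] LieRing.ofAssociativeRing

variable {k S L : Type u} [Field k] [CommRing S] [Algebra k S] [LieRing L] [LieAlgebra k L]
  [Module S L] [LieRingModule L S]

/-- Projectivity of `L` enters through `projective_inSe`: `U^e` is projective, hence flat, as a
right `S^e`-module. -/
instance (I : ModuleCat.{u} (Ae k (Env k S L))) [LieRinehartRing S L] [LieRinehartAlgebra k S L]
    [Module.Projective S L] [Injective I] : Injective ((res k S L).obj I) :=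
  injective_restrictScalars (inSe k S L) I

theorem Env.map_smul_of_generators {N N' : Type u} [AddCommGroup N] [Module (Env k S L) N]
    [AddCommGroup N'] [Module (Env k S L) N'] (g : N →+ N')
    (h₁ : ∀ s n, g (inS k S L s • n) = inS k S L s • g n)
    (h₂ : ∀ α n, g (inL k S L α • n) = inL k S L α • g n) (a : Env k S L) (n : N) :
    g (a • n) = a • g n := by
  induction a using Env.induction generalizing n with
  | inS s => exact h₁ s n
  | inL α => exact h₂ α n
  | algebraMap c => rw [← (inS k S L).commutes]; exact h₁ _ n
  | mul a b ha hb => rw [mul_smul, ha, hb, mul_smul]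
  | add a b ha hb => rw [add_smul, map_add, ha, hb, add_smul]

theorem map_smul_of_lft_rgt {M M' : Type u} [AddCommGroup M] [Module (Ae k (Env k S L)) M]
    [AddCommGroup M'] [Module (Ae k (Env k S L)) M'] (g : M →+ M')
    (h₁ : ∀ a m, g (lft k S L a • m) = lft k S L a • g m)
    (h₂ : ∀ a m, g (rgt k S L a • m) = rgt k S L a • g m) (x : Ae k (Env k S L)) (m : M) :
    g (x • m) = x • g m := by
  induction x using TensorProduct.induction_on with
  | zero =>
    exact (congrArg g (zero_smul (Ae k (Env k S L)) m)).trans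
      (g.map_zero.trans (zero_smul (Ae k (Env k S L)) (g m)).symm)
  | tmul a b => rw [← op_unop b, ← lft_mul_rgt, mul_smul, h₁, h₂, mul_smul]
  | add x y hx hy => rw [add_smul, map_add, hx, hy, add_smul]

theorem map_rgt_smul_of_generators {M M' : Type u} [AddCommGroup M] [Module (Ae k (Env k S L)) M]
    [AddCommGroup M'] [Module (Ae k (Env k S L)) M'] (g : M →+ M')
    (h₁ : ∀ s m, g (rgt k S L (inS k S L s) • m) = rgt k S L (inS k S L s) • g m)
    (h₂ : ∀ α m, g (rgt k S L (inL k S L α) • m) = rgt k S L (inL k S L α) • g m)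
    (a : Env k S L) (m : M) : g (rgt k S L a • m) = rgt k S L a • g m := by
  induction a using Env.induction generalizing m with
  | inS s => exact h₁ s m
  | inL α => exact h₂ α m
  | algebraMap c => rw [← (inS k S L).commutes]; exact h₁ _ m
  | mul a b ha hb => rw [← rgt_mul_rgt, mul_smul, hb, ha, mul_smul]
  | add a b ha hb =>
    have h : rgt k S L (a + b) = rgt k S L a + rgt k S L b := by
      simp only [rgt, MulOpposite.op_add, TensorProduct.tmul_add]
    rw [h, add_smul, map_add, ha, hb, add_smul]

end Linearity

/-! ### The bimodule `U ⊗_S N` attached to a left `U`-module `N`. -/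

section Induced

attribute [local instance 100] LieRing.ofAssociativeRing

variable {k S L : Type u} [Field k] [CommRing S] [Algebra k S] [LieRing L] [LieAlgebra k L]
  [Module S L] [LieRingModule L S]

variable (N : ModuleCat.{u} (Env k S L))

/-- The tensor product `U ⊗ N` over `S` of the right `S`-module `U` and a left `U`-module `N`. -/
abbrev Induced : Type u :=
  RMul (inS k S L) ⊗[S] ((ModuleCat.restrictScalars (inS k S L).toRingHom).obj N)

variable {N} in
/-- The element `a ⊗ n` of `U ⊗ N`. -/
def Induced.mk (a : Env k S L) (n : N) : Induced N :=
  toRMul (inS k S L) a ⊗ₜ[S]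
    (show (ModuleCat.restrictScalars (inS k S L).toRingHom).obj N from n)

namespace Induced

variable {N}

theorem mk_mul_inS (a : Env k S L) (s : S) (n : N) :
    mk (a * inS k S L s) n = mk a (inS k S L s • n) := RMul.tmul_mul _ _ _ _

theorem smul_mk (a b : Env k S L) (n : N) : a • mk b n = mk (a * b) n := rfl

theorem smul_mk' (c : k) (b : Env k S L) (n : N) : c • mk b n = mk (c • b) n := rfl

theorem smul_mk'' (s : S) (b : Env k S L) (n : N) : s • mk b n = mk (b * inS k S L s) n := rfl

theorem mk_add (a : Env k S L) (n n' : N) : mk a (n + n') = mk a n + mk a n' :=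
  TensorProduct.tmul_add _ _ _

theorem add_mk (a b : Env k S L) (n : N) : mk (a + b) n = mk a n + mk b n :=
  TensorProduct.add_tmul _ _ _

theorem mk_sub (a : Env k S L) (n n' : N) : mk a (n - n') = mk a n - mk a n' :=
  TensorProduct.tmul_sub _ _ _

theorem sub_mk (a b : Env k S L) (n : N) : mk (a - b) n = mk a n - mk b n :=
  TensorProduct.sub_tmul _ _ _

@[elab_as_elim]
theorem induction {P : Induced N → Prop} (mk : ∀ a n, P (mk a n))
    (add : ∀ y z, P y → P z → P (y + z)) (y : Induced N) : P y :=
  RMul.tensor_induction (inS k S L)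
    (X := (ModuleCat.restrictScalars (inS k S L).toRingHom).obj N) mk add y

variable (N)

variable {N} in
/-- The additive map on `U ⊗ N` defined by a balanced biadditive map. -/
def liftAdd {P : Type u} [AddCommGroup P] (F : Env k S L →+ N →+ P)
    (hF : ∀ a s n, F (a * inS k S L s) n = F a (inS k S L s • n)) : Induced N →+ P :=
  TensorProduct.liftAddHom (R := S) (M := RMul (inS k S L))
    (N := (ModuleCat.restrictScalars (inS k S L).toRingHom).obj N) F fun s a n => hF a s n

/-- The right action of `α ∈ L` on `U ⊗ N`: `(a ⊗ n) α = a α ⊗ n - a ⊗ α n`. -/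
def rightL (α : L) : Module.End k (Induced N) :=
  let l : Induced N →+ Induced N := liftAdd
    (AddMonoidHom.mk' (fun a => AddMonoidHom.mk'
        (fun n => mk (a * inL k S L α) n - mk a (inL k S L α • n))
        (fun x y => by
          rw [mk_add, smul_add, mk_add]
          abel))
      (fun a b => by
        ext n
        change mk ((a + b) * inL k S L α) n - mk (a + b) (inL k S L α • n) = (_ - _) + (_ - _)
        rw [add_mul, add_mk, add_mk]
        abel))
    -- Neither term is balanced over `S` by itself. Moving `s` past `α` produces `a α_S(s) ⊗ n` in
    -- both, and the two contributions cancel.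
    (fun a s n => by
      change mk (a * inS k S L s * inL k S L α) n - mk (a * inS k S L s) (inL k S L α • n) =
        mk (a * inL k S L α) (inS k S L s • n) - mk a (inL k S L α • inS k S L s • n)
      rw [← mk_mul_inS, ← mul_smul, inL_mul_inS, add_smul, mk_add, ← mk_mul_inS, mul_smul,
        ← mk_mul_inS, mul_assoc _ (inL k S L α), inL_mul_inS, mul_add, add_mk, mul_assoc]
      abel)
  { l with
    map_smul' := fun c y => by
      change l (c • y) = c • l y
      induction y using Induced.induction with
      | mk a n =>
        change mk (c • a * inL k S L α) n - mk (c • a) (inL k S L α • n) =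
          c • (mk (a * inL k S L α) n - mk a (inL k S L α • n))
        rw [smul_sub, smul_mk', smul_mk', smul_mul_assoc]
      | add y z hy hz => rw [smul_add, map_add, map_add, smul_add, hy, hz] }

theorem rightL_mk (α : L) (a : Env k S L) (n : N) :
    rightL N α (mk a n) = mk (a * inL k S L α) n - mk a (inL k S L α • n) := rfl

theorem end_ext {f g : Module.End k (Induced N)} (h : ∀ a n, f (mk a n) = g (mk a n)) : f = g := by
  ext y
  induction y using Induced.induction with
  | mk a n => exact h a n
  | add y z hy hz => rw [map_add, map_add, hy, hz]

/-- The right action of `S` on `U ⊗ N`. -/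
def rightS : S →ₐ[k] (Module.End k (Induced N))ᵐᵒᵖ :=
  (Algebra.lsmul k k (Induced N)).toOpposite fun s t => by
    rw [Commute, SemiconjBy, ← map_mul, mul_comm, map_mul]

theorem rightS_mk (s : S) (a : Env k S L) (n : N) :
    (rightS N s).unop (mk a n) = mk (a * inS k S L s) n := rfl

/-- The right action of `L` on `U ⊗ N`, as a morphism of Lie algebras. -/
def rightLLie : L →ₗ⁅k⁆ (Module.End k (Induced N))ᵐᵒᵖ where
  toFun α := op (rightL N α)
  map_add' α β := unop_injective <| end_ext N fun a n => by
    change rightL N (α + β) (mk a n) = rightL N α (mk a n) + rightL N β (mk a n)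
    simp only [rightL_mk, map_add, mul_add, add_mk, add_smul, mk_add]
    abel
  map_smul' c α := unop_injective <| end_ext N fun a n => by
    change rightL N (c • α) (mk a n) = c • rightL N α (mk a n)
    have h : mk a ((c • inL k S L α) • n) = c • mk a (inL k S L α • n) := by
      rw [Algebra.smul_def, ← (inS k S L).commutes, mul_smul, ← mk_mul_inS, smul_mk',
        (inS k S L).commutes, ← Algebra.commutes, ← Algebra.smul_def]
    simp only [rightL_mk, map_smul, mul_smul_comm, smul_sub, smul_mk', h]
  map_lie' {α β} := unop_injective <| end_ext N fun a n => by
    change rightL N ⁅α, β⁆ (mk a n) = rightL N β (rightL N α (mk a n))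
      - rightL N α (rightL N β (mk a n))
    simp only [rightL_mk, LieHom.map_lie, Ring.lie_def, map_sub, mul_sub, sub_mk, sub_smul, mk_sub,
      mul_smul, mul_assoc]
    abel

/-- The right action of `U` on `U ⊗ N`. -/
def right : Env k S L →ₐ[k] (Module.End k (Induced N))ᵐᵒᵖ :=
  lift (rightS N) (rightLLie N)
    (fun s α => unop_injective <| end_ext N fun a n => by
      change rightL N α (mk (a * inS k S L s) n) = rightL N (s • α) (mk a n)
      rw [rightL_mk, rightL_mk, ← inS_mul_inL, mul_assoc, mul_smul, mk_mul_inS])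
    (fun α s => unop_injective <| end_ext N fun a n => by
      change (rightS N s).unop (rightL N α (mk a n)) - rightL N α (mk (a * inS k S L s) n) =
        mk (a * inS k S L ⁅α, s⁆) n
      rw [rightL_mk, rightL_mk, map_sub, rightS_mk, rightS_mk, mul_assoc, inL_mul_inS, mul_add,
        add_mk, mul_assoc]
      abel)

theorem right_inS (s : S) (y : Induced N) : (right N (inS k S L s)).unop y = s • y :=
  congrArg (fun f : (Module.End k (Induced N))ᵐᵒᵖ => f.unop y) (lift_inS (rightS N) (rightLLie N) _ _ s)

theorem right_inL (α : L) (y : Induced N) : (right N (inL k S L α)).unop y = rightL N α y :=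
  congrArg (fun f : (Module.End k (Induced N))ᵐᵒᵖ => f.unop y) (lift_inL (rightS N) (rightLLie N) _ _ α)

/-- The right action multiplies the first factor on the right or acts on `N`, so it commutes with
left multiplication. The two actions therefore combine to one of `U^e`. -/
theorem right_smul (a b : Env k S L) (y : Induced N) :
    (right N b).unop (a • y) = a • (right N b).unop y := by
  induction b using Env.induction generalizing y with
  | inS s =>
    rw [right_inS, right_inS, smul_comm]
  | inL α =>
    rw [right_inL, right_inL]
    induction y using Induced.induction with
    | mk b n => simp only [smul_mk, rightL_mk, smul_sub, mul_assoc]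
    | add y z hy hz => rw [smul_add, map_add, map_add, smul_add, hy, hz]
  | algebraMap c =>
    rw [AlgHom.commutes]
    exact smul_comm c a y
  | mul b c hb hc =>
    rw [map_mul]
    exact (congrArg _ (hb y)).trans (hc _)
  | add b c hb hc =>
    rw [map_add]
    exact (congrArg₂ (· + ·) (hb y) (hc y)).trans (smul_add _ _ _).symm

theorem commute_right (a : Env k S L) (b : (Env k S L)ᵐᵒᵖ) :
    Commute (Algebra.lsmul k k (Induced N) a) (AlgHom.opComm (right N) b) :=
  LinearMap.ext fun y => (right_smul N a b.unop y).symm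

/-- The bimodule structure of `U ⊗ N`. -/
def action : Ae k (Env k S L) →ₐ[k] Module.End k (Induced N) :=
  Algebra.TensorProduct.lift (Algebra.lsmul k k (Induced N)) (AlgHom.opComm (right N))
    (commute_right N)

instance : Module (Ae k (Env k S L)) (Induced N) :=
  Module.compHom _ (action N).toRingHom

theorem lft_smul (a : Env k S L) (y : Induced N) : lft k S L a • y = a • y := by
  refine (LinearMap.congr_fun (Algebra.TensorProduct.lift_tmul _ _ (commute_right N) a 1) y).trans ?_
  rw [map_one, mul_one]
  rfl

theorem rgt_smul (a : Env k S L) (y : Induced N) : rgt k S L a • y = (right N a).unop y := by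
  refine (LinearMap.congr_fun
    (Algebra.TensorProduct.lift_tmul _ _ (commute_right N) 1 (op a)) y).trans ?_
  rw [map_one, one_mul]
  rfl

end Induced

end Induced

/-! ### The functor `Hom_{S^e}(S, -)`, its left adjoint, and injective objects. -/

section HomFunctor

attribute [local instance 100] LieRing.ofAssociativeRing

variable (k S L : Type u) [Field k] [CommRing S] [Algebra k S] [LieRing L] [LieAlgebra k L]
  [Module S L] [LieRingModule L S]

variable {k S L} in
/-- The map `U ⊗ N → U ⊗ N'` induced by a morphism `N → N'`. -/
def Induced.map {N N' : ModuleCat.{u} (Env k S L)} (j : N ⟶ N') :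
    Induced N →ₗ[Ae k (Env k S L)] Induced N' :=
  let l := RMul.mapTensor (inS k S L)
    ((ModuleCat.restrictScalars (inS k S L).toRingHom).map j).hom
  { l with
    map_smul' := map_smul_of_lft_rgt l.toAddMonoidHom
      (fun a y => by
        rw [lft_smul, lft_smul]
        exact l.map_smul a y)
      (map_rgt_smul_of_generators l.toAddMonoidHom
        (fun s y => by
          rw [rgt_smul, rgt_smul, right_inS, right_inS]
          exact (LinearMap.lTensor _ _).map_smul s y)
        (fun α y => by
          rw [rgt_smul, rgt_smul, right_inL, right_inL]
          induction y using Induced.induction with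
          | mk a n =>
            rw [rightL_mk, map_sub]
            change mk _ _ - mk a (j.hom (inL k S L α • n)) = rightL N' α (mk a (j.hom n))
            rw [map_smul]
            rfl
          | add y z hy hz => rw [map_add, map_add, map_add, map_add, hy, hz])) }

variable {k S L} in
theorem Induced.map_mk {N N' : ModuleCat.{u} (Env k S L)} (j : N ⟶ N') (a : Env k S L) (n : N) :
    Induced.map j (mk a n) = mk a (j.hom n) := rfl

variable {k S L} in
theorem val_one {M : ModuleCat.{u} (Ae k (Env k S L))} (φ : regular k S ⟶ (res k S L).obj M)
    (s : S) : val φ s = lft k S L (inS k S L s) • val φ 1 := by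
  rw [← val_left, mul_one]

variable {k S L} in
theorem lft_rgt_comm {M : ModuleCat.{u} (Ae k (Env k S L))} (a b : Env k S L) (m : M) :
    lft k S L a • rgt k S L b • m = rgt k S L b • lft k S L a • m := by
  rw [← mul_smul, ← mul_smul, lft_mul_rgt, rgt_mul_lft]

variable {k S L} in
theorem lft_add (a b : Env k S L) : lft k S L (a + b) = lft k S L a + lft k S L b :=
  TensorProduct.add_tmul _ _ _

variable {k S L} in
theorem rgt_add (a b : Env k S L) : rgt k S L (a + b) = rgt k S L a + rgt k S L b :=
  TensorProduct.tmul_add _ _ _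

variable [LieRinehartRing S L] [LieRinehartAlgebra k S L]

variable {k S L} in
theorem homAction_inS (M : ModuleCat.{u} (Ae k (Env k S L))) (s : S)
    (φ : regular k S ⟶ (res k S L).obj M) : homAction M (inS k S L s) φ = homActS M s φ :=
  LinearMap.congr_fun (lift_inS (homActSAlg M) (homActLLie M) _ _ s) φ

variable {k S L} in
theorem homAction_inL (M : ModuleCat.{u} (Ae k (Env k S L))) (α : L)
    (φ : regular k S ⟶ (res k S L).obj M) : homAction M (inL k S L α) φ = homActL M α φ :=
  LinearMap.congr_fun (lift_inL (homActSAlg M) (homActLLie M) _ _ α) φ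

variable {k S L} in
/-- The `U`-module `Hom_{S^e}(S, M)`. -/
def homModule (M : ModuleCat.{u} (Ae k (Env k S L))) : ModuleCat.{u} (Env k S L) :=
  letI : Module (Env k S L) (regular k S ⟶ (res k S L).obj M) :=
    Module.compHom _ (homAction M).toRingHom
  ModuleCat.of (Env k S L) (regular k S ⟶ (res k S L).obj M)

/-- The functor that sends a `U`-bimodule `M` to the `U`-module `Hom_{S^e}(S, M)`. -/
def homFunctor : ModuleCat.{u} (Ae k (Env k S L)) ⥤ ModuleCat.{u} (Env k S L) where
  obj M := homModule M
  map {M N} g := ModuleCat.ofHom (X := homModule M) (Y := homModule N)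
    { toFun := fun φ => (show regular k S ⟶ (res k S L).obj M from φ) ≫ (res k S L).map g
      map_add' := fun φ ψ => Preadditive.add_comp _ _ _ φ ψ _
      map_smul' := fun a φ => homAction_comp g a φ }
  map_id M := ModuleCat.hom_ext (LinearMap.ext fun φ =>
    Category.comp_id (show regular k S ⟶ (res k S L).obj M from φ))
  map_comp {M _ _} g h := ModuleCat.hom_ext (LinearMap.ext fun φ =>
    (Category.assoc (show regular k S ⟶ (res k S L).obj M from φ) ((res k S L).map g)
      ((res k S L).map h)).symm)

variable {k S L}

/-- An element of `Hom_{S^e}(S, M)` as a morphism. -/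
def toHom {M : ModuleCat.{u} (Ae k (Env k S L))} :
    (homFunctor k S L).obj M ≃+ (regular k S ⟶ (res k S L).obj M) := AddEquiv.refl _

theorem toHom_smul {M : ModuleCat.{u} (Ae k (Env k S L))} (a : Env k S L)
    (x : (homFunctor k S L).obj M) : toHom (a • x) = homAction M a (toHom x) := rfl

theorem toHom_map {M N : ModuleCat.{u} (Ae k (Env k S L))} (g : M ⟶ N)
    (x : (homFunctor k S L).obj M) :
    toHom (((homFunctor k S L).map g).hom x) = toHom x ≫ (res k S L).map g := rfl

instance : (homFunctor k S L).Additive where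
  map_add {M N g h} := by
    ext φ
    apply toHom.injective
    refine (Preadditive.comp_add _ _ _ (toHom φ) ((res k S L).map g) ((res k S L).map h))

theorem lie_one (α : L) : ⁅α, (1 : S)⁆ = 0 := by
  have h := LieRinehartRing.leibniz_mul_right α (1 : S) 1
  simpa using h

/-- The morphism of bimodules `U ⊗ N → M` that corresponds to a morphism of `U`-modules
`N → Hom_{S^e}(S, M)`. -/
def Induced.desc {N : ModuleCat.{u} (Env k S L)} {M : ModuleCat.{u} (Ae k (Env k S L))}
    (g : N ⟶ (homFunctor k S L).obj M) : Induced N →ₗ[Ae k (Env k S L)] M :=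
  let v : N →+ M := AddMonoidHom.mk' (fun n => val (toHom (g.hom n)) 1) fun n n' => by
    rw [map_add, map_add, val_add]
  let l : Induced N →+ M := liftAdd
    (AddMonoidHom.mk' (fun a => (DistribSMul.toAddMonoidHom M (lft k S L a)).comp v) fun a b => by
      ext n
      change lft k S L (a + b) • v n = lft k S L a • v n + lft k S L b • v n
      rw [lft_add, add_smul])
    (fun a s n => by
      change lft k S L (a * inS k S L s) • val (toHom (g.hom n)) 1
        = lft k S L a • val (toHom (g.hom (inS k S L s • n))) 1
      rw [map_smul, toHom_smul, homAction_inS, val_homActS, ← mul_smul, lft_mul_lft])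
  have hl (a n) : l (mk a n) = lft k S L a • val (toHom (g.hom n)) 1 := rfl
  { l with
    map_smul' := map_smul_of_lft_rgt l
      (fun a y => by
        rw [lft_smul]
        induction y using Induced.induction with
        | mk b n => rw [smul_mk, hl, hl, ← mul_smul, lft_mul_lft]
        | add y z hy hz => rw [smul_add, map_add, map_add, smul_add, hy, hz])
      (map_rgt_smul_of_generators l
        (fun s y => by
          rw [rgt_smul, right_inS]
          induction y using Induced.induction with
          | mk b n =>
            rw [smul_mk'', hl, hl, ← lft_mul_lft, mul_smul, ← val_left, val_right, lft_rgt_comm]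
          | add y z hy hz => rw [smul_add, map_add, map_add, smul_add, hy, hz])
        -- Since `α_S(1) = 0`, the action satisfies `(α φ)(1) = α φ(1) - φ(1) α`. Solved for `φ(1)
        -- α`, this is the formula defining the right action on `U ⊗ N`.
        (fun α y => by
          rw [rgt_smul, right_inL]
          induction y using Induced.induction with
          | mk b n =>
            rw [rightL_mk, map_sub, hl, hl, hl, map_smul, toHom_smul, homAction_inL, val_homActL,
              lie_one, map_zero, sub_zero, ← lft_mul_lft, mul_smul, ← smul_sub, sub_sub_cancel,
              lft_rgt_comm]
          | add y z hy hz => rw [map_add, map_add, map_add, smul_add, hy, hz])) }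

theorem Induced.desc_mk {N : ModuleCat.{u} (Env k S L)} {M : ModuleCat.{u} (Ae k (Env k S L))}
    (g : N ⟶ (homFunctor k S L).obj M) (a : Env k S L) (n : N) :
    Induced.desc g (mk a n) = lft k S L a • val (toHom (g.hom n)) 1 := rfl

/-- The morphism of `U`-modules `N → Hom_{S^e}(S, M)` that corresponds to a morphism of bimodules
`U ⊗ N → M`. -/
def Induced.curry {N : ModuleCat.{u} (Env k S L)} {M : ModuleCat.{u} (Ae k (Env k S L))}
    (h : Induced N →ₗ[Ae k (Env k S L)] M) : N ⟶ (homFunctor k S L).obj M :=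
  let c (n : N) : regular k S ⟶ (res k S L).obj M :=
    mkHom (AddMonoidHom.mk' (fun s => h (mk (inS k S L s) n)) fun s t => by
        rw [map_add, add_mk, map_add])
      (fun a b s => by
        change h (mk (inS k S L (a * s * b)) n) = _ • h (mk (inS k S L s) n)
        rw [← map_smul, ← lft_mul_rgt, mul_smul, rgt_smul, right_inS, lft_smul, smul_mk'', smul_mk,
          map_mul, map_mul, mul_assoc])
  have hc (n s) : val (c n) s = h (mk (inS k S L s) n) := rfl
  let l : N →+ (homFunctor k S L).obj M :=
    AddMonoidHom.mk' (fun n => toHom.symm (c n)) fun n n' => by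
      apply toHom.injective
      refine val_ext fun s => ?_
      rw [map_add, val_add]
      change h (mk _ (n + n')) = h (mk _ n) + h (mk _ n')
      rw [mk_add, map_add]
  have hl (n) : toHom (l n) = c n := rfl
  ModuleCat.ofHom (X := N) (Y := (homFunctor k S L).obj M)
    { l with
      map_smul' := Env.map_smul_of_generators l
        (fun t n => by
          apply toHom.injective
          refine val_ext fun s => ?_
          rw [toHom_smul, homAction_inS, val_homActS, hl, hl, hc, hc, ← mk_mul_inS, ← map_smul,
            lft_smul, smul_mk, ← map_mul, ← map_mul, mul_comm])
        (fun α n => by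
          apply toHom.injective
          refine val_ext fun s => ?_
          rw [toHom_smul, homAction_inL, val_homActL, hl, hl, hc, hc, hc, ← map_smul, ← map_smul,
            lft_smul, rgt_smul, right_inL, rightL_mk, smul_mk, inL_mul_inS, ← map_sub, ← map_sub,
            add_mk]
          congr 1
          abel) }

theorem Induced.val_curry {N : ModuleCat.{u} (Env k S L)} {M : ModuleCat.{u} (Ae k (Env k S L))}
    (h : Induced N →ₗ[Ae k (Env k S L)] M) (n : N) (s : S) :
    val (toHom ((curry h).hom n)) s = h (mk (inS k S L s) n) := rfl

/-- A right adjoint of an exact functor preserves injectives: pass to `U ⊗ X → I`, extend along the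
injection into `U ⊗ Y`, and pass back. Flatness of `U` as a right `S`-module is what keeps the
induced map injective. -/
instance injective_homFunctor_obj [Module.Projective S L] (I : ModuleCat.{u} (Ae k (Env k S L)))
    [Injective I] : Injective ((homFunctor k S L).obj I) where
  factors {X Y} g j _ := by
    have hI : Module.Injective (Ae k (Env k S L)) I :=
      Module.injective_module_of_injective_object _ I
    obtain ⟨h, hh⟩ := hI.out (Induced.map j)
      (RMul.mapTensor_injective (inS k S L)
        ((ModuleCat.restrictScalars (inS k S L).toRingHom).map j).hom
        ((ModuleCat.mono_iff_injective j).mp inferInstance)) (Induced.desc g)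
    refine ⟨Induced.curry h, ?_⟩
    ext x
    apply toHom.injective
    refine val_ext fun s => ?_
    refine ((Induced.val_curry h _ s).trans
      (congrArg h (Induced.map_mk j (inS k S L s) x).symm)).trans ?_
    rw [hh, Induced.desc_mk, ← val_one]

end HomFunctor

/-! ### The identification of `Hom_U(S, Hom_{S^e}(S, M))` with `Hom_{U^e}(U, M)`. -/

section Invariants

attribute [local instance 100] LieRing.ofAssociativeRing

variable {k S L : Type u} [Field k] [CommRing S] [Algebra k S] [LieRing L] [LieAlgebra k L]
  [Module S L] [LieRingModule L S]

/-- An element of `U` as an element of the bimodule `U`. -/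
def toRegular : Env k S L ≃+ regular k (Env k S L) := AddEquiv.refl _

theorem lft_smul_toRegular (a b : Env k S L) :
    lft k S L a • toRegular b = toRegular (a * b) := by
  let : Module (Ae k (Env k S L)) (Env k S L) := TensorProduct.Algebra.module
  change (a ⊗ₜ[k] 1 : Ae k (Env k S L)) • b = a * b
  rw [TensorProduct.Algebra.smul_def]
  simp

theorem rgt_smul_toRegular (a b : Env k S L) :
    rgt k S L a • toRegular b = toRegular (b * a) := by
  let : Module (Ae k (Env k S L)) (Env k S L) := TensorProduct.Algebra.module
  change (1 ⊗ₜ[k] op a : Ae k (Env k S L)) • b = b * a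
  rw [TensorProduct.Algebra.smul_def]
  simp

theorem regular_hom_ext {M : ModuleCat.{u} (Ae k (Env k S L))} {φ ψ : regular k (Env k S L) ⟶ M}
    (h : φ.hom (toRegular 1) = ψ.hom (toRegular 1)) : φ = ψ := by
  refine ModuleCat.hom_ext (LinearMap.ext fun a => ?_)
  have ha : a = lft k S L (toRegular.symm a) • toRegular 1 := by
    rw [lft_smul_toRegular, mul_one, AddEquiv.apply_symm_apply]
  rw [ha, map_smul, map_smul, h]

/-- The morphism of bimodules `U → M` with `1 ↦ m`. -/
def regularHom {M : ModuleCat.{u} (Ae k (Env k S L))} (m : M)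
    (hm : ∀ a, lft k S L a • m = rgt k S L a • m) : regular k (Env k S L) ⟶ M :=
  let l : regular k (Env k S L) →+ M :=
    AddMonoidHom.mk' (fun a => lft k S L (toRegular.symm a) • m) fun a b => by
      rw [map_add, lft_add, add_smul]
  ModuleCat.ofHom (X := regular k (Env k S L)) (Y := M)
    { l with
      map_smul' := map_smul_of_lft_rgt l
        (fun a b => by
          obtain ⟨b, rfl⟩ := toRegular.surjective b
          rw [lft_smul_toRegular]
          change lft k S L (a * b) • m = lft k S L a • lft k S L b • m
          rw [← mul_smul, lft_mul_lft])
        (fun a b => by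
          obtain ⟨b, rfl⟩ := toRegular.surjective b
          rw [rgt_smul_toRegular]
          change lft k S L (b * a) • m = rgt k S L a • lft k S L b • m
          rw [← lft_rgt_comm, ← hm, ← mul_smul, lft_mul_lft]) }

theorem regularHom_one {M : ModuleCat.{u} (Ae k (Env k S L))} (m : M)
    (hm : ∀ a, lft k S L a • m = rgt k S L a • m) :
    (regularHom m hm).hom (toRegular 1) = m :=
  one_smul (Ae k (Env k S L)) m

theorem lft_smul_apply_eq_rgt_smul_apply {M : ModuleCat.{u} (Ae k (Env k S L))}
    (φ : regular k (Env k S L) ⟶ M) (a : Env k S L) :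
    lft k S L a • φ.hom (toRegular 1) = rgt k S L a • φ.hom (toRegular 1) := by
  rw [← φ.hom.map_smul, ← φ.hom.map_smul, lft_smul_toRegular, rgt_smul_toRegular, mul_one, one_mul]

variable [LieRinehartRing S L] [LieRinehartAlgebra k S L]

variable (k L) in
/-- An element of `S` as an element of the `U`-module `S`. -/
def toBase : S ≃+ base k S L := AddEquiv.refl _

theorem inS_smul_toBase (s t : S) : inS k S L s • toBase k L t = toBase k L (s * t) :=
  LinearMap.congr_fun (lift_inS (Algebra.lmul k S) (LieModule.toEnd k L S) _ _ s) t

theorem inL_smul_toBase (α : L) (t : S) : inL k S L α • toBase k L t = toBase k L ⁅α, t⁆ :=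
  LinearMap.congr_fun (lift_inL (Algebra.lmul k S) (LieModule.toEnd k L S) _ _ α) t

theorem base_hom_ext {M : ModuleCat.{u} (Ae k (Env k S L))}
    {φ ψ : base k S L ⟶ (homFunctor k S L).obj M}
    (h : val (toHom (φ.hom (toBase k L 1))) 1 = val (toHom (ψ.hom (toBase k L 1))) 1) : φ = ψ := by
  refine ModuleCat.hom_ext (LinearMap.ext fun a => ?_)
  obtain ⟨s, rfl⟩ := (toBase k L).surjective a
  have ha : toBase k L s = inS k S L s • toBase k L 1 := by
    rw [inS_smul_toBase, mul_one]
  rw [ha, map_smul, map_smul]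
  congr 1
  apply toHom.injective
  refine val_ext fun t => ?_
  rw [val_one, h, ← val_one]

/-- The morphism of `U`-modules `S → Hom_{S^e}(S, M)` with `s ↦ (t ↦ s t m)`. -/
def baseHom {M : ModuleCat.{u} (Ae k (Env k S L))} (m : M)
    (hm : ∀ a, lft k S L a • m = rgt k S L a • m) : base k S L ⟶ (homFunctor k S L).obj M :=
  let c (s : S) : regular k S ⟶ (res k S L).obj M :=
    mkHom (AddMonoidHom.mk' (fun t => lft k S L (inS k S L (s * t)) • m) fun t t' => by
        rw [mul_add, map_add, lft_add, add_smul])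
      (fun a b t => by
        change lft k S L (inS k S L (s * (a * t * b))) • m = _ • lft k S L (inS k S L (s * t)) • m
        rw [← lft_mul_rgt, mul_smul, ← lft_rgt_comm, ← hm, ← mul_smul, ← mul_smul, lft_mul_lft,
          lft_mul_lft, ← map_mul, ← map_mul]
        congr 3
        ring)
  have hc (s t) : val (c s) t = lft k S L (inS k S L (s * t)) • m := rfl
  let l : base k S L →+ (homFunctor k S L).obj M :=
    AddMonoidHom.mk' (fun s => toHom.symm (c ((toBase k L).symm s))) fun s s' => by
      apply toHom.injective
      refine val_ext fun t => ?_
      rw [map_add, map_add, val_add, AddEquiv.apply_symm_apply, AddEquiv.apply_symm_apply,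
        AddEquiv.apply_symm_apply, hc, hc, hc, add_mul, map_add, lft_add, add_smul]
  have hl (s) : toHom (l (toBase k L s)) = c s := rfl
  ModuleCat.ofHom (X := base k S L) (Y := (homFunctor k S L).obj M)
    { l with
      map_smul' := Env.map_smul_of_generators l
        (fun r s => by
          obtain ⟨s, rfl⟩ := (toBase k L).surjective s
          apply toHom.injective
          refine val_ext fun t => ?_
          rw [inS_smul_toBase, toHom_smul, homAction_inS, val_homActS, hl, hl, hc, hc, ← mul_smul,
            lft_mul_lft, ← map_mul, mul_assoc])
        (fun α s => by
          obtain ⟨s, rfl⟩ := (toBase k L).surjective s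
          apply toHom.injective
          refine val_ext fun t => ?_
          rw [inL_smul_toBase, toHom_smul, homAction_inL, val_homActL, hl, hl, hc, hc, hc,
            ← lft_rgt_comm, ← hm, ← mul_smul, ← mul_smul, lft_mul_lft, lft_mul_lft, inL_mul_inS,
            lft_add, add_smul, add_sub_cancel_left, LieRinehartRing.leibniz_mul_right, smul_eq_mul,
            map_add, lft_add, add_smul, add_sub_cancel_left]) }

theorem val_baseHom_one {M : ModuleCat.{u} (Ae k (Env k S L))} (m : M)
    (hm : ∀ a, lft k S L a • m = rgt k S L a • m) :
    val (toHom ((baseHom m hm).hom (toBase k L 1))) 1 = m := by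
  refine (congrArg (fun s => lft k S L (inS k S L s) • m) (one_mul 1)).trans ?_
  rw [map_one]
  exact one_smul (Ae k (Env k S L)) m

/-- Let `m` be the value at `1` of the image of `1`. Elements of `S` commute with `m` because `S` is
commutative and the image of `1` is a bimodule morphism. Elements of `L` do so because they kill `1`
in `S`. The elements that commute with `m` are closed under sums and products. -/
theorem lft_smul_val_eq_rgt_smul_val {M : ModuleCat.{u} (Ae k (Env k S L))}
    (ψ : base k S L ⟶ (homFunctor k S L).obj M) (a : Env k S L) :
    lft k S L a • val (toHom (ψ.hom (toBase k L 1))) 1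
      = rgt k S L a • val (toHom (ψ.hom (toBase k L 1))) 1 := by
  induction a using Env.induction with
  | inS s => rw [← val_left, ← val_right]
  | inL α =>
    have h : homActL M α (toHom (ψ.hom (toBase k L 1))) = 0 := by
      rw [← homAction_inL, ← toHom_smul, ← map_smul, inL_smul_toBase, lie_one, map_zero, map_zero,
        map_zero]
    have h' := val_homActL M α (toHom (ψ.hom (toBase k L 1))) 1
    rw [h, lie_one, map_zero, sub_zero] at h'
    exact (sub_eq_zero.mp h'.symm)
  | algebraMap c => rw [← (inS k S L).commutes, ← val_left, ← val_right]
  | mul a b ha hb => rw [← lft_mul_lft, mul_smul, hb, lft_rgt_comm, ha, ← mul_smul, rgt_mul_rgt]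
  | add a b ha hb => rw [lft_add, rgt_add, add_smul, add_smul, ha, hb]

/-- The morphism of bimodules `U → M` that corresponds to a morphism of `U`-modules
`S → Hom_{S^e}(S, M)`. -/
def toRegularHom {M : ModuleCat.{u} (Ae k (Env k S L))}
    (ψ : base k S L ⟶ (homFunctor k S L).obj M) : regular k (Env k S L) ⟶ M :=
  regularHom (val (toHom (ψ.hom (toBase k L 1))) 1) (lft_smul_val_eq_rgt_smul_val ψ)

theorem toRegularHom_one {M : ModuleCat.{u} (Ae k (Env k S L))}
    (ψ : base k S L ⟶ (homFunctor k S L).obj M) :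
    (toRegularHom ψ).hom (toRegular 1) = val (toHom (ψ.hom (toBase k L 1))) 1 :=
  regularHom_one _ (lft_smul_val_eq_rgt_smul_val ψ)

/-- Morphisms of `U`-modules `S → Hom_{S^e}(S, M)` correspond to morphisms of
bimodules `U → M`. -/
def baseHomEquiv (M : ModuleCat.{u} (Ae k (Env k S L))) :
    (base k S L ⟶ (homFunctor k S L).obj M) ≃ₗ[k] (regular k (Env k S L) ⟶ M) :=
  LinearEquiv.ofBijective
    { toFun := toRegularHom
      map_add' := fun ψ ψ' => regular_hom_ext <| by
        rw [toRegularHom_one]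
        change _ = (toRegularHom ψ).hom (toRegular 1) + (toRegularHom ψ').hom (toRegular 1)
        rw [toRegularHom_one, toRegularHom_one]
        exact val_add _ _ _
      map_smul' := fun c ψ => regular_hom_ext <| by
        rw [toRegularHom_one]
        change _ = algebraMap k (Ae k (Env k S L)) c • (toRegularHom ψ).hom (toRegular 1)
        have h : toHom ((c • ψ).hom (toBase k L 1)) = c • toHom (ψ.hom (toBase k L 1)) := by
          refine (toHom_smul (algebraMap k (Env k S L) c) _).trans ?_
          rw [AlgHom.commutes]
          rfl
        rw [h, val_smul, toRegularHom_one] }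
    ⟨fun ψ ψ' h => base_hom_ext <|
      ((toRegularHom_one ψ).symm.trans
        (congrArg (fun φ : regular k (Env k S L) ⟶ M => φ.hom (toRegular 1)) h)).trans
          (toRegularHom_one ψ'),
     fun φ => ⟨baseHom _ (lft_smul_apply_eq_rgt_smul_apply φ), regular_hom_ext
        ((toRegularHom_one _).trans (val_baseHom_one _ (lft_smul_apply_eq_rgt_smul_apply φ)))⟩⟩

theorem baseHomEquiv_comp {M N : ModuleCat.{u} (Ae k (Env k S L))} (g : M ⟶ N)
    (ψ : base k S L ⟶ (homFunctor k S L).obj M) :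
    baseHomEquiv N (ψ ≫ (homFunctor k S L).map g) = baseHomEquiv M ψ ≫ g :=
  regular_hom_ext ((toRegularHom_one _).trans (congrArg g.hom (toRegularHom_one ψ)).symm)

end Invariants

/-! ### Classes from which all of `Ext^q(-, M)` is pulled back, and exact functors. -/

section UniversalClasses

universe w w' v v' u₁ u₂

set_option linter.unusedSectionVars false

variable {C : Type u₁} [Category.{v} C] [Abelian C] [HasExt.{w} C]
  {D : Type u₂} [Category.{v'} D] [Abelian D] [HasExt.{w'} D]

/-- Every class in `Ext^q(X, M)` is the pullback of `c` under a morphism `X → Z`, and the pullback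
vanishes if and only if this morphism factors through `π`. -/
structure IsUniversalClass {P Z M : C} {q : ℕ} (π : P ⟶ Z) (c : Ext.{w} Z M q) : Prop where
  surjective {X : C} (x : Ext.{w} X M q) : ∃ h : X ⟶ Z, (Ext.mk₀ h).comp c (zero_add q) = x
  eq_zero_iff {X : C} (h : X ⟶ Z) : (Ext.mk₀ h).comp c (zero_add q) = 0 ↔ ∃ t : X ⟶ P, t ≫ π = h

/-- If an exact functor maps one universal class to a universal class, then it does so for
every universal class. -/
theorem IsUniversalClass.map (F : C ⥤ D) [F.Additive] [PreservesFiniteLimits F]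
    [PreservesFiniteColimits F] {P Z M : C} {q : ℕ} {π : P ⟶ Z} {c c₀ : Ext.{w} Z M q}
    (hc : IsUniversalClass π c) (hc₀ : IsUniversalClass π c₀)
    (hF : IsUniversalClass (F.map π) (c₀.mapExactFunctor F)) :
    IsUniversalClass (F.map π) (c.mapExactFunctor F) := by
  -- The classes `c` and `c₀` need not be equal. Universality makes each a pullback of the other,
  -- with `g' ≫ g` the identity up to a morphism factoring through `π`, and these relations survive
  -- under `F`.
  obtain ⟨g, hg⟩ := hc.surjective c₀
  obtain ⟨g', hg'⟩ := hc₀.surjective c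
  have comp {X Y : C} (a : X ⟶ Y) (b : Y ⟶ Z) (e : Ext.{w} Z M q) :
      (Ext.mk₀ (a ≫ b)).comp e (zero_add q) =
        (Ext.mk₀ a).comp ((Ext.mk₀ b).comp e (zero_add q)) (zero_add q) := by
    rw [← Ext.mk₀_comp_mk₀, Ext.comp_assoc_of_second_deg_zero]
  have comp' {X Y : D} (a : X ⟶ Y) (b : Y ⟶ F.obj Z) (e : Ext.{w'} (F.obj Z) (F.obj M) q) :
      (Ext.mk₀ (a ≫ b)).comp e (zero_add q) =
        (Ext.mk₀ a).comp ((Ext.mk₀ b).comp e (zero_add q)) (zero_add q) := by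
    rw [← Ext.mk₀_comp_mk₀, Ext.comp_assoc_of_second_deg_zero]
  have hFg : (Ext.mk₀ (F.map g)).comp (c.mapExactFunctor F) (zero_add q)
      = c₀.mapExactFunctor F := by
    rw [← hg, Ext.mapExactFunctor_comp, Ext.mapExactFunctor_mk₀]
  have hFg' : (Ext.mk₀ (F.map g')).comp (c₀.mapExactFunctor F) (zero_add q)
      = c.mapExactFunctor F := by
    rw [← hg', Ext.mapExactFunctor_comp, Ext.mapExactFunctor_mk₀]
  obtain ⟨r, hr⟩ := (hc.eq_zero_iff (g' ≫ g - 𝟙 Z)).mp (by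
    rw [sub_eq_add_neg, Ext.mk₀_add, Ext.mk₀_neg, Ext.add_comp, Ext.neg_comp, comp, hg, hg',
      Ext.mk₀_id_comp, add_neg_cancel])
  obtain ⟨s, hs⟩ := (hc.eq_zero_iff (π ≫ g)).mp (by
    rw [comp, hg, hc₀.eq_zero_iff]
    exact ⟨𝟙 _, Category.id_comp _⟩)
  have hπ : (Ext.mk₀ (F.map π)).comp (c.mapExactFunctor F) (zero_add q) = 0 := by
    rw [← Ext.mapExactFunctor_mk₀, ← Ext.mapExactFunctor_comp,
      (hc.eq_zero_iff π).mpr ⟨𝟙 _, Category.id_comp _⟩, Ext.mapExactFunctor_zero]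
  constructor
  · intro X x
    obtain ⟨h, rfl⟩ := hF.surjective x
    exact ⟨h ≫ F.map g, by rw [comp', hFg]⟩
  · intro X h
    constructor
    · intro hh
      obtain ⟨t, ht⟩ := (hF.eq_zero_iff (h ≫ F.map g')).mp (by rw [comp', hFg', hh])
      -- From `h F(g') = t F(π)`, `π g = s π` and `g' g - 1 = r π` it follows that `h = t F(π g) - h
      -- F(r π) = (t F(s) - h F(r)) F(π)`.
      refine ⟨t ≫ F.map s - h ≫ F.map r, ?_⟩
      have e : h ≫ F.map (g' ≫ g - 𝟙 Z) = h ≫ F.map g' ≫ F.map g - h := by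
        rw [F.map_sub, F.map_comp, F.map_id, Preadditive.comp_sub, Category.comp_id]
      rw [Preadditive.sub_comp, Category.assoc, Category.assoc, ← F.map_comp, ← F.map_comp, hr, hs,
        e, F.map_comp, ← Category.assoc, ht, Category.assoc, sub_sub_cancel]
    · rintro ⟨t, rfl⟩
      rw [comp', hπ, Ext.comp_zero]

/-- Dimension shifting: the connecting maps of short exact sequences with injective middle
terms. -/
theorem bijective_postcomp_extClass {S : ShortComplex C} (hS : S.ShortExact) [Injective S.X₂]
    (X : C) (m : ℕ) :
    Function.Bijective fun x : Ext.{w} X S.X₃ (m + 1) =>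
      x.comp hS.extClass (rfl : m + 1 + 1 = m + 2) := by
  constructor
  · refine (injective_iff_map_eq_zero (hS.extClass.postcomp X rfl)).mpr fun x hx => ?_
    obtain ⟨y, rfl⟩ := Ext.covariant_sequence_exact₃ X hS x rfl hx
    rw [Ext.eq_zero_of_injective y, Ext.zero_comp]
  · intro x
    exact Ext.covariant_sequence_exact₁ X hS x (Ext.eq_zero_of_injective _) rfl

/-- A sequence of short exact sequences `Z^q → J^q → Z^{q+1}` with `J^q` injective and
`Z^0 ≅ M`. -/
structure CosyzygySequence (M : C) where
  /-- the cosyzygies -/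
  Z : ℕ → C
  /-- the injective objects -/
  J : ℕ → C
  /-- the inclusions -/
  i (q : ℕ) : Z q ⟶ J q
  /-- the projections -/
  p (q : ℕ) : J q ⟶ Z (q + 1)
  w (q : ℕ) : i q ≫ p q = 0
  shortExact (q : ℕ) : (ShortComplex.mk (i q) (p q) (w q)).ShortExact
  injective (q : ℕ) : Injective (J q)
  /-- the identification of the first object -/
  e : Z 0 ≅ M

namespace CosyzygySequence

variable {M : C} (T : CosyzygySequence M)

/-- The class of the exact sequence `M → J^0 → ⋯ → J^{q-1} → Z^q`. -/
def cls : ∀ q, Ext.{w} (T.Z q) M q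
  | 0 => Ext.mk₀ T.e.hom
  | q + 1 => (T.shortExact q).extClass.comp (cls q) (add_comm 1 q)

/-- Iterated dimension shifting. The source degree must be positive so that the `Ext` groups of the
injective middle terms vanish on both sides. -/
theorem bijective_postcomp_cls (X : C) (q m n : ℕ) (h : m + 1 + q = n) :
    Function.Bijective fun x : Ext.{w} X (T.Z q) (m + 1) => x.comp (T.cls q) h := by
  induction q generalizing m n with
  | zero =>
    obtain rfl : m + 1 = n := h
    refine Function.bijective_iff_has_inverse.mpr
      ⟨fun x => x.comp (Ext.mk₀ T.e.inv) (add_zero _), fun x => ?_, fun x => ?_⟩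
    · change (x.comp (Ext.mk₀ T.e.hom) _).comp (Ext.mk₀ T.e.inv) _ = x
      rw [Ext.comp_assoc_of_third_deg_zero, Ext.mk₀_comp_mk₀, Iso.hom_inv_id, Ext.comp_mk₀_id]
    · change (x.comp (Ext.mk₀ T.e.inv) _).comp (Ext.mk₀ T.e.hom) _ = x
      rw [Ext.comp_assoc_of_third_deg_zero, Ext.mk₀_comp_mk₀, Iso.inv_hom_id, Ext.comp_mk₀_id]
  | succ q ih =>
    have := T.injective q
    have h₁ := bijective_postcomp_extClass (T.shortExact q) X m
    have h₂ := ih (m + 1) n (by lia)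
    convert h₂.comp h₁ using 2 with x
    exact (Ext.comp_assoc _ _ _ _ _ (by lia)).symm

theorem isUniversalClass_cls_zero (P : C) : IsUniversalClass (0 : P ⟶ T.Z 0) (T.cls 0) where
  surjective x := ⟨Ext.homEquiv₀ x ≫ T.e.inv, by
    rw [cls, Ext.mk₀_comp_mk₀, Category.assoc, Iso.inv_hom_id, Category.comp_id,
      Ext.mk₀_homEquiv₀_apply]⟩
  eq_zero_iff h := by
    rw [cls, Ext.mk₀_comp_mk₀, Ext.mk₀_eq_zero_iff]
    constructor
    · intro hh
      exact ⟨0, by rw [zero_comp, ← cancel_mono T.e.hom, hh, zero_comp]⟩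
    · rintro ⟨t, rfl⟩
      rw [comp_zero, zero_comp]

/-- By dimension shifting `Ext^{q+1}(X, M)` is `Ext^1(X, Z^q)`, which is the cokernel of `Hom(X,
J^q) → Hom(X, Z^{q+1})`. -/
theorem isUniversalClass_cls_succ (q : ℕ) : IsUniversalClass (T.p q) (T.cls (q + 1)) := by
  have := T.injective q
  have h (X : C) := T.bijective_postcomp_cls X q 0 (q + 1) (by lia)
  have hc {X : C} (f : X ⟶ T.Z (q + 1)) : (Ext.mk₀ f).comp (T.cls (q + 1)) (zero_add _) =
      ((Ext.mk₀ f).comp (T.shortExact q).extClass (zero_add 1)).comp (T.cls q) (add_comm 1 q) :=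
    (Ext.comp_assoc _ _ _ _ _ (by lia)).symm
  constructor
  · intro X x
    obtain ⟨y, rfl⟩ := (h X).surjective x
    obtain ⟨z, rfl⟩ := Ext.covariant_sequence_exact₁ X (T.shortExact q) y
      (Ext.eq_zero_of_injective _) rfl
    exact ⟨Ext.homEquiv₀ z, by rw [hc, Ext.mk₀_homEquiv₀_apply]⟩
  · intro X f
    rw [hc]
    constructor
    · intro hf
      have hf' := (h X).injective (hf.trans (Ext.zero_comp _ _ _ _ (by lia)).symm)
      obtain ⟨y, hy⟩ := Ext.covariant_sequence_exact₃ X (T.shortExact q) _ rfl hf'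
      refine ⟨Ext.homEquiv₀ y, (Ext.mk₀_bijective _ _).injective ?_⟩
      rw [← Ext.mk₀_comp_mk₀, Ext.mk₀_homEquiv₀_apply]
      exact hy
    · rintro ⟨t, rfl⟩
      rw [← Ext.mk₀_comp_mk₀, Ext.comp_assoc_of_second_deg_zero]
      have h₀ := (T.shortExact q).comp_extClass
      dsimp only at h₀
      rw [h₀, Ext.comp_zero, Ext.zero_comp]

variable (F : C ⥤ D) [F.Additive] [PreservesFiniteLimits F] [PreservesFiniteColimits F]
  (hF : ∀ I : C, Injective I → Injective (F.obj I))

/-- The image of a sequence under an exact functor that preserves injective objects. -/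
def map : CosyzygySequence (F.obj M) where
  Z q := F.obj (T.Z q)
  J q := F.obj (T.J q)
  i q := F.map (T.i q)
  p q := F.map (T.p q)
  w q := by rw [← F.map_comp, T.w, F.map_zero]
  shortExact q := (T.shortExact q).map_of_exact F
  injective q := hF _ (T.injective q)
  e := F.mapIso T.e

theorem cls_map (q : ℕ) : (T.map F hF).cls q = (T.cls q).mapExactFunctor F := by
  induction q with
  | zero => exact (Ext.mapExactFunctor_mk₀ F _).symm
  | succ q ih =>
    have h := Ext.mapExactFunctor_extClass F (T.shortExact q)
    rw [cls, cls, Ext.mapExactFunctor_comp, h, ← ih]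
    rfl

end CosyzygySequence

section Resolution

variable {M : C} (I : InjectiveResolution M)

/-- The morphism from `I^q` to the kernel of `I^{q+1} → I^{q+2}`. -/
def toCocycles (q : ℕ) : I.cocomplex.X q ⟶ kernel (I.cocomplex.d (q + 1) (q + 1 + 1)) :=
  kernel.lift _ (I.cocomplex.d q (q + 1)) (I.cocomplex.d_comp_d _ _ _)

theorem toCocycles_comp (q : ℕ) : toCocycles I q ≫ kernel.ι _ = I.cocomplex.d q (q + 1) :=
  kernel.lift_ι _ _ _

theorem kernel_ι_comp_toCocycles (q : ℕ) :
    kernel.ι (I.cocomplex.d q (q + 1)) ≫ toCocycles I q = 0 := by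
  rw [← cancel_mono (kernel.ι _), Category.assoc, toCocycles_comp, kernel.condition, zero_comp]

/-- The cosyzygies of an injective resolution. -/
def cosyzygySequence : CosyzygySequence M where
  Z q := kernel (I.cocomplex.d q (q + 1))
  J q := I.cocomplex.X q
  i q := kernel.ι _
  p q := toCocycles I q
  w q := kernel_ι_comp_toCocycles I q
  shortExact q :=
    { exact := by
        -- Enlarging the target `Z^{q+1}` to `I^{q+1}` does not change exactness in the middle, and
        -- there the sequence is a kernel sequence.
        let φ : ShortComplex.mk (kernel.ι (I.cocomplex.d q (q + 1))) (toCocycles I q)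
            (kernel_ι_comp_toCocycles I q) ⟶
            ShortComplex.mk (kernel.ι (I.cocomplex.d q (q + 1))) _ (kernel.condition _) :=
          { τ₁ := 𝟙 _, τ₂ := 𝟙 _, τ₃ := kernel.ι _
            comm₂₃ := (Category.id_comp _).trans (toCocycles_comp I q).symm }
        have : IsIso φ.τ₂ := by dsimp [φ]; infer_instance
        have : Epi φ.τ₁ := by dsimp [φ]; infer_instance
        have : Mono φ.τ₃ := by dsimp [φ]; infer_instance
        exact (ShortComplex.exact_iff_of_epi_of_isIso_of_mono φ).mpr
          (ShortComplex.exact_kernel _)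
      mono_f := by dsimp only; infer_instance
      epi_g := (ShortComplex.exact_iff_epi_kernel_lift _).mp (I.exact_succ q) }
  injective q := I.injective q
  e := IsLimit.conePointUniqueUpToIso (kernelIsKernel _) I.isLimitKernelFork

/-- The extended complex is zero in degree `-1`, so there are no non-zero coboundaries in degree
`0`. -/
theorem extMk_eq_zero_iff_of_zero {X : C} (f : X ⟶ I.cocomplex.X 0)
    (hf : f ≫ I.cocomplex.d 0 1 = 0) : I.extMk f 1 rfl hf = 0 ↔ f = 0 := by
  constructor
  · intro h
    rw [← I.extEquivCohomologyClass.apply_eq_iff_eq,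
      InjectiveResolution.extEquivCohomologyClass_extMk,
      InjectiveResolution.extEquivCohomologyClass_zero,
      CochainComplex.HomComplex.CohomologyClass.mk_eq_zero_iff,
      CochainComplex.HomComplex.Cocycle.fromSingleMk_mem_coboundaries_iff _ _ _ _ _ (-1)
        (by lia)] at h
    obtain ⟨g, hg⟩ := h
    have h₀ : g = 0 := (CochainComplex.isZero_of_isStrictlyGE _ 0 _ (by lia)).eq_of_tgt _ _
    rw [h₀, zero_comp] at hg
    rw [← cancel_mono (I.cochainComplexXIso 0 0 rfl).inv, zero_comp]
    exact hg.symm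
  · rintro rfl
    exact I.extMk_zero 1 rfl

/-- The class in `Ext^q(Z^q, M)` of the inclusion of the kernel `Z^q` of `I^q → I^{q+1}`. -/
def cocyclesClass (q : ℕ) : Ext.{w} (kernel (I.cocomplex.d q (q + 1))) M q :=
  I.extMk (kernel.ι (I.cocomplex.d q (q + 1))) (q + 1) rfl (kernel.condition _)

theorem exists_comp_cocyclesClass (q : ℕ) {X : C} (x : Ext.{w} X M q) :
    ∃ h, (Ext.mk₀ h).comp (cocyclesClass I q) (zero_add q) = x := by
  obtain ⟨f, hf, rfl⟩ := I.extMk_surjective x (q + 1) rfl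
  refine ⟨kernel.lift _ f hf, ?_⟩
  rw [cocyclesClass, InjectiveResolution.mk₀_comp_extMk]
  congr 1
  exact kernel.lift_ι _ _ _

theorem isUniversalClass_cocyclesClass_zero (P : C) :
    IsUniversalClass (0 : P ⟶ _) (cocyclesClass.{w} I 0) where
  surjective x := exists_comp_cocyclesClass I 0 x
  eq_zero_iff h := by
    rw [cocyclesClass, InjectiveResolution.mk₀_comp_extMk, extMk_eq_zero_iff_of_zero]
    constructor
    · intro hh
      exact ⟨0, by rw [zero_comp, ← cancel_mono (kernel.ι _), hh, zero_comp]⟩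
    · rintro ⟨t, rfl⟩
      rw [comp_zero, zero_comp]

theorem isUniversalClass_cocyclesClass_succ (q : ℕ) :
    IsUniversalClass (toCocycles I q) (cocyclesClass.{w} I (q + 1)) where
  surjective x := exists_comp_cocyclesClass I _ x
  eq_zero_iff h := by
    rw [cocyclesClass, InjectiveResolution.mk₀_comp_extMk, I.extMk_eq_zero_iff _ _ rfl _ q rfl]
    refine exists_congr fun t => ?_
    rw [← cancel_mono (kernel.ι _), Category.assoc, toCocycles_comp]

variable (F : C ⥤ D) [F.Additive] [PreservesFiniteLimits F] [PreservesFiniteColimits F]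

theorem isUniversalClass_map_cocyclesClass_zero (hF : ∀ I : C, Injective I → Injective (F.obj I))
    (P : C) : IsUniversalClass (0 : F.obj P ⟶ _) ((cocyclesClass.{w} I 0).mapExactFunctor F) := by
  have h := ((cosyzygySequence I).map F hF).isUniversalClass_cls_zero (F.obj P)
  rw [CosyzygySequence.cls_map] at h
  have h' := (isUniversalClass_cocyclesClass_zero I P).map F
    ((cosyzygySequence I).isUniversalClass_cls_zero P) (by rw [F.map_zero]; exact h)
  rwa [F.map_zero] at h'

/-- The iterated connecting class is compatible with `F` by construction, and its image is universal
because `F` preserves injectives. Universality passes to the class of the resolution without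
identifying the two classes. -/
theorem isUniversalClass_map_cocyclesClass_succ (hF : ∀ I : C, Injective I → Injective (F.obj I))
    (q : ℕ) : IsUniversalClass (F.map (toCocycles I q))
      ((cocyclesClass.{w} I (q + 1)).mapExactFunctor F) := by
  have h := ((cosyzygySequence I).map F hF).isUniversalClass_cls_succ q
  rw [CosyzygySequence.cls_map] at h
  exact (isUniversalClass_cocyclesClass_succ I q).map F
    ((cosyzygySequence I).isUniversalClass_cls_succ q) h

end Resolution

end UniversalClasses

/-! ### Cocycle classes in `H^q(S, M)` and the action of `U` on them. -/

section CocycleClasses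

variable {k S L : Type u} [Field k] [CommRing S] [Algebra k S] [LieRing L] [LieAlgebra k L]
  [Module S L] [LieRingModule L S]

section Basic

variable {M : ModuleCat.{u} (Ae k (Env k S L))} (I : InjectiveResolution M)

/-- The morphism to `Z^q` defined by a cocycle of `Hom_{S^e}(S, I)`. -/
def cocycleLift (q : ℕ) (f : regular k S ⟶ (res k S L).obj (I.cocomplex.X q))
    (hf : f ≫ (res k S L).map (I.cocomplex.d q (q + 1)) = 0) :
    regular k S ⟶ (res k S L).obj (kernel (I.cocomplex.d q (q + 1))) :=
  kernel.lift ((res k S L).map (I.cocomplex.d q (q + 1))) f hf ≫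
    (PreservesKernel.iso (res k S L) (I.cocomplex.d q (q + 1))).inv

theorem cocycleLift_comp (q : ℕ) (f : regular k S ⟶ (res k S L).obj (I.cocomplex.X q))
    (hf : f ≫ (res k S L).map (I.cocomplex.d q (q + 1)) = 0) :
    cocycleLift I q f hf ≫ (res k S L).map (kernel.ι (I.cocomplex.d q (q + 1))) = f := by
  rw [cocycleLift, Category.assoc, PreservesKernel.iso_inv_ι, kernel.lift_ι]

theorem cocycleClass_eq (q : ℕ) (f : regular k S ⟶ (res k S L).obj (I.cocomplex.X q))
    (hf : f ≫ (res k S L).map (I.cocomplex.d q (q + 1)) = 0) :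
    cocycleClass I q f hf = (Ext.mk₀ (cocycleLift I q f hf)).comp
      ((cocyclesClass I q).mapExactFunctor (res k S L)) (zero_add q) := rfl

theorem cocycleClass_comp_map_ι (q : ℕ)
    (h : regular k S ⟶ (res k S L).obj (kernel (I.cocomplex.d q (q + 1))))
    (hf : (h ≫ (res k S L).map (kernel.ι (I.cocomplex.d q (q + 1)))) ≫
      (res k S L).map (I.cocomplex.d q (q + 1)) = 0) :
    cocycleClass I q (h ≫ (res k S L).map (kernel.ι (I.cocomplex.d q (q + 1)))) hf =
      (Ext.mk₀ h).comp ((cocyclesClass I q).mapExactFunctor (res k S L)) (zero_add q) := by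
  rw [cocycleClass_eq]
  congr 2
  rw [← cancel_mono ((res k S L).map (kernel.ι (I.cocomplex.d q (q + 1)))), cocycleLift_comp]

theorem cocycleClass_congr (q : ℕ) {f f' : regular k S ⟶ (res k S L).obj (I.cocomplex.X q)}
    (hf : f ≫ (res k S L).map (I.cocomplex.d q (q + 1)) = 0)
    (hf' : f' ≫ (res k S L).map (I.cocomplex.d q (q + 1)) = 0) (h : f = f') :
    cocycleClass I q f hf = cocycleClass I q f' hf' := by
  subst h
  rfl

theorem cocycleClass_add (q : ℕ) (f f' : regular k S ⟶ (res k S L).obj (I.cocomplex.X q))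
    (hf : f ≫ (res k S L).map (I.cocomplex.d q (q + 1)) = 0)
    (hf' : f' ≫ (res k S L).map (I.cocomplex.d q (q + 1)) = 0)
    (hff' : (f + f') ≫ (res k S L).map (I.cocomplex.d q (q + 1)) = 0) :
    cocycleClass I q (f + f') hff' = cocycleClass I q f hf + cocycleClass I q f' hf' := by
  have h : cocycleLift I q (f + f') hff' = cocycleLift I q f hf + cocycleLift I q f' hf' := by
    rw [← cancel_mono ((res k S L).map (kernel.ι (I.cocomplex.d q (q + 1)))),
      Preadditive.add_comp, cocycleLift_comp, cocycleLift_comp, cocycleLift_comp]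
  rw [cocycleClass_eq, h, Ext.mk₀_add, Ext.add_comp]
  rfl

variable {I} in
theorem comp_map_cocycle {N : ModuleCat.{u} (Ae k (Env k S L))} {J : InjectiveResolution N}
    {g : M ⟶ N} (φ : InjectiveResolution.Hom I J g) (q : ℕ)
    (f : regular k S ⟶ (res k S L).obj (I.cocomplex.X q))
    (hf : f ≫ (res k S L).map (I.cocomplex.d q (q + 1)) = 0) :
    (f ≫ (res k S L).map (φ.hom.f q)) ≫ (res k S L).map (J.cocomplex.d q (q + 1)) = 0 := by
  rw [Category.assoc, ← (res k S L).map_comp, φ.hom.comm, (res k S L).map_comp, ← Category.assoc,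
    hf, zero_comp]

/-- A morphism of resolutions induces a morphism `z` between the kernels `Z^q`, and the universal
classes over `U^e` are compatible with `z` and `g`. The exact restriction functor transports this to
`S^e`. -/
theorem cocycleClass_comp_mk₀ {N : ModuleCat.{u} (Ae k (Env k S L))} (J : InjectiveResolution N)
    {g : M ⟶ N} (φ : InjectiveResolution.Hom I J g) (q : ℕ)
    (f : regular k S ⟶ (res k S L).obj (I.cocomplex.X q))
    (hf : f ≫ (res k S L).map (I.cocomplex.d q (q + 1)) = 0)
    (hf' : (f ≫ (res k S L).map (φ.hom.f q)) ≫ (res k S L).map (J.cocomplex.d q (q + 1)) = 0) :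
    (cocycleClass I q f hf).comp (Ext.mk₀ ((res k S L).map g)) (add_zero q) =
      cocycleClass J q (f ≫ (res k S L).map (φ.hom.f q)) hf' := by
  let z : kernel (I.cocomplex.d q (q + 1)) ⟶ kernel (J.cocomplex.d q (q + 1)) :=
    kernel.map _ _ (φ.hom.f q) (φ.hom.f (q + 1)) (φ.hom.comm _ _).symm
  have hz : z ≫ kernel.ι _ = kernel.ι _ ≫ φ.hom.f q := kernel.lift_ι _ _ _
  have h : (cocyclesClass I q).comp (Ext.mk₀ g) (add_zero q) =
      (Ext.mk₀ z).comp (cocyclesClass J q) (zero_add q) := by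
    rw [cocyclesClass, cocyclesClass, InjectiveResolution.extMk_comp_mk₀ _ _ _ _ φ,
      InjectiveResolution.mk₀_comp_extMk]
    congr 1
    exact hz.symm
  have e : f ≫ (res k S L).map (φ.hom.f q) =
      (cocycleLift I q f hf ≫ (res k S L).map z) ≫ (res k S L).map (kernel.ι _) := by
    rw [Category.assoc, ← (res k S L).map_comp, hz, (res k S L).map_comp, ← Category.assoc,
      cocycleLift_comp]
  rw [cocycleClass_congr J q hf' (e ▸ hf') e, cocycleClass_comp_map_ι, cocycleClass_eq,
    Ext.comp_assoc_of_third_deg_zero, ← Ext.mapExactFunctor_mk₀, ← Ext.mapExactFunctor_comp, h,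
    Ext.mapExactFunctor_comp, Ext.mapExactFunctor_mk₀, ← Ext.mk₀_comp_mk₀,
    Ext.comp_assoc_of_second_deg_zero]

end Basic

variable [LieRinehartRing S L] [LieRinehartAlgebra k S L] [Module.Projective S L]

section Cohomology

variable {M : ModuleCat.{u} (Ae k (Env k S L))} (I : InjectiveResolution M)

theorem cocycleClass_surjective (q : ℕ) (x : HH k S ((res k S L).obj M) q) :
    ∃ f hf, cocycleClass I q f hf = x := by
  have hc : ∃ h, (Ext.mk₀ h).comp ((cocyclesClass I q).mapExactFunctor (res k S L))
      (zero_add q) = x := by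
    cases q with
    | zero =>
      exact (isUniversalClass_map_cocyclesClass_zero I (res k S L)
        (fun I _ => inferInstance) M).surjective x
    | succ q =>
      exact (isUniversalClass_map_cocyclesClass_succ I (res k S L)
        (fun I _ => inferInstance) q).surjective x
  obtain ⟨h, rfl⟩ := hc
  refine ⟨h ≫ (res k S L).map (kernel.ι _), ?_, cocycleClass_comp_map_ι I q h _⟩
  rw [Category.assoc, ← (res k S L).map_comp, kernel.condition, (res k S L).map_zero, comp_zero]

theorem cocycleClass_eq_zero_iff (q : ℕ) (f : regular k S ⟶ (res k S L).obj (I.cocomplex.X q))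
    (hf : f ≫ (res k S L).map (I.cocomplex.d q (q + 1)) = 0) : cocycleClass I q f hf = 0 ↔
        ∃ (p : ℕ) (g : regular k S ⟶ (res k S L).obj (I.cocomplex.X p)),
          g ≫ (res k S L).map (I.cocomplex.d p q) = f := by
  rw [cocycleClass_eq]
  cases q with
  | zero =>
    refine ((isUniversalClass_map_cocyclesClass_zero I (res k S L)
        (fun I _ => inferInstance) M).eq_zero_iff _).trans ?_
    have h := cocycleLift_comp I 0 f hf
    constructor
    · rintro ⟨t, ht⟩
      refine ⟨0, 0, ?_⟩
      rw [← h, ← ht, comp_zero, zero_comp, zero_comp]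
    -- No differential ends in degree `0`, so `f = 0`, in accordance with the choice `π = 0` there.
    · rintro ⟨p, g, hg⟩
      refine ⟨0, ?_⟩
      rw [← cancel_mono ((res k S L).map (kernel.ι (I.cocomplex.d 0 (0 + 1)))), h, ← hg,
        I.cocomplex.shape p 0 (by simp), (res k S L).map_zero, comp_zero, comp_zero, zero_comp]
  | succ q =>
    refine ((isUniversalClass_map_cocyclesClass_succ I (res k S L)
        (fun I _ => inferInstance) q).eq_zero_iff _).trans ?_
    have h := cocycleLift_comp I (q + 1) f hf
    have hd : (res k S L).map (toCocycles I q) ≫ (res k S L).map (kernel.ι _) =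
        (res k S L).map (I.cocomplex.d q (q + 1)) := by
      rw [← (res k S L).map_comp, toCocycles_comp]
    constructor
    · rintro ⟨t, ht⟩
      refine ⟨q, t, ?_⟩
      rw [← h, ← ht, Category.assoc, hd]
    · rintro ⟨p, g, hg⟩
      by_cases hp : p = q
      · subst hp
        refine ⟨g, ?_⟩
        rw [← cancel_mono ((res k S L).map (kernel.ι _)), h, ← hg, Category.assoc, hd]
      -- For `p + 1` different from the degree of `f` the differential is zero, so quantifying over
      -- all `p` adds no coboundaries.
      · refine ⟨0, ?_⟩
        rw [← cancel_mono ((res k S L).map (kernel.ι _)), h, ← hg,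
          I.cocomplex.shape p (q + 1) (by simpa using hp), (res k S L).map_zero, comp_zero, zero_comp,
          zero_comp]

theorem cocycleClass_zero (q : ℕ)
    (h : (0 : regular k S ⟶ (res k S L).obj (I.cocomplex.X q)) ≫
      (res k S L).map (I.cocomplex.d q (q + 1)) = 0) : cocycleClass I q 0 h = 0 :=
  (cocycleClass_eq_zero_iff I q 0 h).mpr ⟨q, 0, zero_comp⟩

/-- The action commutes with the maps induced by the differentials, so it sends coboundaries to
coboundaries and descends to classes. -/
theorem cocycleClass_homAction_eq (q : ℕ) (a : Env k S L)
    {f f' : regular k S ⟶ (res k S L).obj (I.cocomplex.X q)}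
    (hf : f ≫ (res k S L).map (I.cocomplex.d q (q + 1)) = 0)
    (hf' : f' ≫ (res k S L).map (I.cocomplex.d q (q + 1)) = 0)
    (h : cocycleClass I q f hf = cocycleClass I q f' hf') :
    cocycleClass I q (homAction _ a f) (homAction_cocycle _ a f hf) =
      cocycleClass I q (homAction _ a f') (homAction_cocycle _ a f' hf') := by
  have hd : (f - f') ≫ (res k S L).map (I.cocomplex.d q (q + 1)) = 0 := by
    rw [Preadditive.sub_comp, hf, hf', sub_zero]
  have hs : cocycleClass I q (f - f') hd = 0 := by
    have h₁ := cocycleClass_add I q (f - f') f' hd hf' (by rw [sub_add_cancel, hf])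
    rw [cocycleClass_congr I q _ hf (sub_add_cancel f f'), h] at h₁
    exact add_eq_right.mp h₁.symm
  obtain ⟨p, g, hg⟩ := (cocycleClass_eq_zero_iff I q _ hd).mp hs
  have hs' : cocycleClass I q (homAction _ a (f - f')) (homAction_cocycle _ a _ hd) = 0 :=
    (cocycleClass_eq_zero_iff I q _ _).mpr ⟨p, homAction _ a g, by rw [homAction_comp, hg]⟩
  have h₂ := cocycleClass_add I q (homAction _ a (f - f')) (homAction _ a f')
    (homAction_cocycle _ a _ hd) (homAction_cocycle _ a f' hf') (by
      rw [← map_add, sub_add_cancel]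
      exact homAction_cocycle _ a f hf)
  rw [hs', zero_add] at h₂
  rw [← h₂]
  exact cocycleClass_congr I q _ _ (by rw [← map_add, sub_add_cancel])

end Cohomology

section Action

variable (M : ModuleCat.{u} (Ae k (Env k S L))) (q : ℕ)

/-- The action of `U` on `H^q(S, M)`, defined by means of a fixed injective resolution. -/
def cohomologySMul (a : Env k S L) (x : HH k S ((res k S L).obj M) q) :
    HH k S ((res k S L).obj M) q :=
  let I := InjectiveResolution.of M
  cocycleClass I q (homAction _ a (cocycleClass_surjective I q x).choose)
    (homAction_cocycle _ a _ (cocycleClass_surjective I q x).choose_spec.choose)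

theorem cohomologySMul_of (a : Env k S L)
    (f : regular k S ⟶ (res k S L).obj ((InjectiveResolution.of M).cocomplex.X q))
    (hf : f ≫ (res k S L).map ((InjectiveResolution.of M).cocomplex.d q (q + 1)) = 0) :
    cohomologySMul M q a (cocycleClass _ q f hf) =
      cocycleClass _ q (homAction _ a f) (homAction_cocycle _ a f hf) :=
  cocycleClass_homAction_eq _ q a _ hf
    (cocycleClass_surjective (InjectiveResolution.of M) q _).choose_spec.choose_spec

/-- Every morphism extends to a morphism of injective resolutions. -/
def resolutionHom {M N : ModuleCat.{u} (Ae k (Env k S L))} (I : InjectiveResolution M)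
    (J : InjectiveResolution N) (g : M ⟶ N) : InjectiveResolution.Hom I J g where
  hom := InjectiveResolution.desc g J I
  ι_f_zero_comp_hom_f_zero :=
    HomologicalComplex.congr_hom (InjectiveResolution.desc_commutes g J I) 0

variable {M} in
-- A comparison morphism over the identity of `M` preserves classes and commutes with `homAction`;
-- hence the action does not depend on the resolution that defines it.
theorem cohomologySMul_cocycleClass (I : InjectiveResolution M) (a : Env k S L)
    (f : regular k S ⟶ (res k S L).obj (I.cocomplex.X q))
    (hf : f ≫ (res k S L).map (I.cocomplex.d q (q + 1)) = 0) :
    cohomologySMul M q a (cocycleClass I q f hf) =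
      cocycleClass I q (homAction _ a f) (homAction_cocycle _ a f hf) := by
  let φ := resolutionHom I (InjectiveResolution.of M) (𝟙 M)
  have h {f : regular k S ⟶ (res k S L).obj (I.cocomplex.X q)} (hf : f ≫ (res k S L).map (I.cocomplex.d q (q + 1)) = 0) :
      cocycleClass I q f hf = cocycleClass _ q (f ≫ (res k S L).map (φ.hom.f q)) (comp_map_cocycle φ q f hf) := by
    rw [← cocycleClass_comp_mk₀ I _ φ q f hf (comp_map_cocycle φ q f hf), (res k S L).map_id, Ext.comp_mk₀_id]
  rw [h hf, cohomologySMul_of, h (homAction_cocycle _ a f hf)]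
  exact cocycleClass_congr _ q _ _ (homAction_comp _ a f).symm

/-- The `U`-module structure on `H^q(S, M)`. -/
abbrev cohomologyModule : Module (Env k S L) (HH k S ((res k S L).obj M) q) where
  smul := cohomologySMul M q
  one_smul x := by
    obtain ⟨f, hf, rfl⟩ := cocycleClass_surjective (InjectiveResolution.of M) q x
    refine (cohomologySMul_of M q 1 f hf).trans (cocycleClass_congr _ q _ _ ?_)
    rw [map_one]
    rfl
  mul_smul a b x := by
    obtain ⟨f, hf, rfl⟩ := cocycleClass_surjective (InjectiveResolution.of M) q x
    change cohomologySMul M q _ _ = cohomologySMul M q a (cohomologySMul M q b _)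
    rw [cohomologySMul_of, cohomologySMul_of, cohomologySMul_of]
    exact cocycleClass_congr _ q _ _ (by rw [map_mul]; rfl)
  smul_zero a := by
    have h := cocycleClass_zero (InjectiveResolution.of M) q zero_comp
    refine (congrArg (cohomologySMul M q a) h.symm).trans
      ((cohomologySMul_of M q a 0 zero_comp).trans (Eq.trans ?_ h))
    exact cocycleClass_congr _ q _ _ (map_zero _)
  smul_add a x y := by
    obtain ⟨f, hf, rfl⟩ := cocycleClass_surjective (InjectiveResolution.of M) q x
    obtain ⟨g, hg, rfl⟩ := cocycleClass_surjective (InjectiveResolution.of M) q y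
    have hfg : (f + g) ≫ (res k S L).map ((InjectiveResolution.of M).cocomplex.d q (q + 1)) = 0 := by
      rw [Preadditive.add_comp, hf, hg, add_zero]
    change cohomologySMul M q a (_ + _) = cohomologySMul M q a _ + cohomologySMul M q a _
    rw [← cocycleClass_add _ q f g hf hg hfg, cohomologySMul_of, cohomologySMul_of,
      cohomologySMul_of, ← cocycleClass_add]
    · exact cocycleClass_congr _ q _ _ (map_add _ _ _)
    · rw [← map_add]
      exact homAction_cocycle _ a _ hfg
  add_smul a b x := by
    obtain ⟨f, hf, rfl⟩ := cocycleClass_surjective (InjectiveResolution.of M) q x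
    change cohomologySMul M q _ _ = cohomologySMul M q a _ + cohomologySMul M q b _
    rw [cohomologySMul_of, cohomologySMul_of, cohomologySMul_of, ← cocycleClass_add]
    · exact cocycleClass_congr _ q _ _ (by rw [map_add]; rfl)
    · rw [Preadditive.add_comp, homAction_cocycle _ a f hf, homAction_cocycle _ b f hf, add_zero]
  zero_smul x := by
    obtain ⟨f, hf, rfl⟩ := cocycleClass_surjective (InjectiveResolution.of M) q x
    refine (cohomologySMul_of M q 0 f hf).trans
      (Eq.trans ?_ (cocycleClass_zero (InjectiveResolution.of M) q zero_comp))
    exact cocycleClass_congr _ q _ _ (by rw [map_zero]; rfl)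

theorem cohomologySMul_comp {M N : ModuleCat.{u} (Ae k (Env k S L))} (g : M ⟶ N) (a : Env k S L)
    (x : HH k S ((res k S L).obj M) q) :
    (cohomologySMul M q a x).comp (Ext.mk₀ ((res k S L).map g)) (add_zero q) =
      cohomologySMul N q a (x.comp (Ext.mk₀ ((res k S L).map g)) (add_zero q)) := by
  obtain ⟨f, hf, rfl⟩ := cocycleClass_surjective (InjectiveResolution.of M) q x
  let φ := resolutionHom (InjectiveResolution.of M) (InjectiveResolution.of N) g
  rw [cohomologySMul_of, cocycleClass_comp_mk₀ _ _ φ q _ _ (comp_map_cocycle φ q _ (homAction_cocycle _ a f hf)),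
    cocycleClass_comp_mk₀ _ _ φ q _ _ (comp_map_cocycle φ q f hf), cohomologySMul_of]
  exact cocycleClass_congr _ q _ _ (homAction_comp _ a f)

end Action

end CocycleClasses

/-! ### The `k`-linear description of `Ext` by cocycles in an injective resolution. -/

section ExtOfCochains

universe v u₁

variable (k : Type u) [Field k] {C : Type u₁} [Category.{v} C] [Abelian C] [Linear k C]
  {M : C} (I : InjectiveResolution M) (X : C)

theorem comp_cochainComplexXIso_cocycle (n : ℕ) (f : X ⟶ I.cochainComplex.X n)
    (hf : f ≫ I.cochainComplex.d n (n + 1) = 0) :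
    (f ≫ (I.cochainComplexXIso n n rfl).hom) ≫ I.cocomplex.d n (n + 1) = 0 := by
  rw [I.cochainComplex_d n (n + 1) n (n + 1) rfl (by push_cast; rfl)] at hf
  rw [← cancel_mono (I.cochainComplexXIso (n + 1) (n + 1) (by push_cast; rfl)).inv,
    Category.assoc, Category.assoc, hf, zero_comp]

variable [HasExt.{u} C]

variable {X} in
theorem smul_extMk {n : ℕ} (r : k) (f : X ⟶ I.cocomplex.X n) (m : ℕ) (hm : n + 1 = m)
    (hf : f ≫ I.cocomplex.d n m = 0) (hf' : (r • f) ≫ I.cocomplex.d n m = 0) :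
    r • I.extMk f m hm hf = I.extMk (r • f) m hm hf' := by
  have h : (Ext.mk₀ (r • 𝟙 X)).comp (I.extMk f m hm hf) (zero_add _) = r • I.extMk f m hm hf := by
    rw [Ext.mk₀_smul, Ext.smul_comp, Ext.mk₀_id_comp]
  rw [← h, InjectiveResolution.mk₀_comp_extMk]
  congr 1
  rw [Linear.smul_comp, Category.id_comp]

/-- The class in `Ext^n(X, M)` of a cocycle of `Hom(X, I)`, where `I` is an injective resolution
of `M`. -/
def extOfCocycle (n : ℕ) :
    LinearMap.ker (Linear.rightComp k X (I.cochainComplex.d n (n + 1))) →ₗ[k] Ext.{u} X M n where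
  toFun f := I.extMk (f.1 ≫ (I.cochainComplexXIso n n rfl).hom) (n + 1) rfl
    (comp_cochainComplexXIso_cocycle I X n f.1 f.2)
  map_add' f g := by
    rw [InjectiveResolution.add_extMk]
    congr 1
    exact Preadditive.add_comp _ _ _ _ _ _
  map_smul' r f := by
    have h := Linear.smul_comp _ _ _ r f.1 (I.cochainComplexXIso n n rfl).hom
    refine Eq.trans ?_ (smul_extMk k I r _ (n + 1) rfl
      (comp_cochainComplexXIso_cocycle I X n f.1 f.2)
      (h ▸ comp_cochainComplexXIso_cocycle I X n _ (r • f).2)).symm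
    congr 1

theorem extOfCocycle_apply (n : ℕ) (f : X ⟶ I.cochainComplex.X n)
    (hf : f ≫ I.cochainComplex.d n (n + 1) = 0) :
    extOfCocycle k I X n ⟨f, hf⟩ = I.extMk (f ≫ (I.cochainComplexXIso n n rfl).hom) (n + 1) rfl
      (comp_cochainComplexXIso_cocycle I X n f hf) := rfl

theorem extOfCocycle_surjective (n : ℕ) : Function.Surjective (extOfCocycle k I X n) := by
  intro x
  obtain ⟨f, hf, rfl⟩ := I.extMk_surjective x (n + 1) rfl
  have hf' : (f ≫ (I.cochainComplexXIso n n rfl).inv) ≫ I.cochainComplex.d n (n + 1) = 0 := by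
    rw [I.cochainComplex_d n (n + 1) n (n + 1) rfl (by push_cast; rfl), Category.assoc,
      Iso.inv_hom_id_assoc, ← Category.assoc, hf, zero_comp]
  refine ⟨⟨_, hf'⟩, (extOfCocycle_apply k I X n _ hf').trans ?_⟩
  congr 1
  rw [Category.assoc, Iso.inv_hom_id, Category.comp_id]

/-- Indexing by the integers makes `n = 0` uniform with the other degrees: the term in degree `-1`
is zero. -/
theorem extOfCocycle_eq_zero_iff (n : ℕ)
    (f : LinearMap.ker (Linear.rightComp k X (I.cochainComplex.d n (n + 1)))) :
    extOfCocycle k I X n f = 0 ↔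
      ∃ g : X ⟶ I.cochainComplex.X (n - 1), g ≫ I.cochainComplex.d (n - 1) n = f.1 := by
  obtain ⟨f, hf⟩ := f
  rw [extOfCocycle_apply k I X n f hf, ← I.extEquivCohomologyClass.apply_eq_iff_eq,
    InjectiveResolution.extEquivCohomologyClass_extMk,
    InjectiveResolution.extEquivCohomologyClass_zero,
    CochainComplex.HomComplex.CohomologyClass.mk_eq_zero_iff,
    CochainComplex.HomComplex.Cocycle.fromSingleMk_mem_coboundaries_iff _ _ _ _ _ ((n : ℤ) - 1)
      (by lia), Category.assoc, Iso.hom_inv_id, Category.comp_id]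

end ExtOfCochains

/-! ### Homology of a short complex of modules read off a map on cycles. -/

section Homology

theorem nonempty_homology_iso {R : Type u} [Ring R] (T : ShortComplex (ModuleCat.{u} R))
    (N : ModuleCat.{u} R) (τ : LinearMap.ker T.g.hom →ₗ[R] N) (hτ : Function.Surjective τ)
    (hτ' : ∀ x, τ x = 0 ↔ ∃ y, T.f.hom y = x.1) : Nonempty (T.homology ≅ N) := by
  have h : LinearMap.ker τ = LinearMap.range T.moduleCatToCycles := by
    ext x
    refine (hτ' x).trans (exists_congr fun y => ?_)
    exact (Subtype.ext_iff (a1 := T.moduleCatToCycles y) (a2 := x)).symm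
  exact ⟨T.moduleCatHomologyIso ≪≫ ((Submodule.quotEquivOfEq _ _ h.symm).trans
    (τ.quotKerEquivOfSurjective hτ)).toModuleIso⟩

end Homology

/-! ### The complex `Hom_{S^e}(S, I)` and its spectral sequence. -/

section SpectralSequence

variable {k S L : Type u} [Field k] [CommRing S] [Algebra k S] [LieRing L] [LieAlgebra k L]
  [Module S L] [LieRingModule L S] [LieRinehartRing S L] [LieRinehartAlgebra k S L]

variable {M : ModuleCat.{u} (Ae k (Env k S L))} (I : InjectiveResolution M)

/-- The complex of `U`-modules `Hom_{S^e}(S, I)`. -/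
def homComplex : CochainComplex (ModuleCat.{u} (Env k S L)) ℤ :=
  ((homFunctor k S L).mapHomologicalComplex (ComplexShape.up ℤ)).obj I.cochainComplex

instance : (homComplex I).IsStrictlyGE 0 := by
  rw [CochainComplex.isStrictlyGE_iff]
  intro i hi
  exact (homFunctor k S L).map_isZero (CochainComplex.isZero_of_isStrictlyGE _ 0 _ hi)

instance [Module.Projective S L] (n : ℤ) : Injective ((homComplex I).X n) :=
  injective_homFunctor_obj (I.cochainComplex.X n)

theorem baseHomEquiv_cocycle (n : ℕ) (ψ : base k S L ⟶ (homComplex I).X n)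
    (hψ : ψ ≫ (homComplex I).d n (n + 1) = 0) :
    baseHomEquiv (I.cochainComplex.X n) ψ ≫ I.cochainComplex.d n (n + 1) = 0 :=
  (baseHomEquiv_comp (I.cochainComplex.d n (n + 1)) ψ).symm.trans
    ((congrArg _ hψ).trans (map_zero _))

/-- The class in `H^n(U, M)` of a cocycle of `Hom_U(S, Hom_{S^e}(S, I))`. -/
def hochschildClass (n : ℕ) :
    LinearMap.ker (Linear.rightComp k (base k S L) ((homComplex I).d n (n + 1))) →ₗ[k]
      HH k (Env k S L) M n :=
  (extOfCocycle k I (regular k (Env k S L)) n).comp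
    (LinearMap.restrict (baseHomEquiv (I.cochainComplex.X n)).toLinearMap
      (baseHomEquiv_cocycle I n))

theorem hochschildClass_apply (n : ℕ) (ψ : base k S L ⟶ (homComplex I).X n)
    (hψ : ψ ≫ (homComplex I).d n (n + 1) = 0) :
    hochschildClass I n ⟨ψ, hψ⟩ = extOfCocycle k I _ n
      ⟨baseHomEquiv (I.cochainComplex.X n) ψ, baseHomEquiv_cocycle I n ψ hψ⟩ := rfl

theorem hochschildClass_surjective (n : ℕ) : Function.Surjective (hochschildClass I n) := by
  intro x
  obtain ⟨⟨f, hf⟩, rfl⟩ := extOfCocycle_surjective k I _ n x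
  obtain ⟨ψ, rfl⟩ := (baseHomEquiv (I.cochainComplex.X n)).surjective f
  have hψ : ψ ≫ (homComplex I).d n (n + 1) = 0 :=
    (baseHomEquiv (I.cochainComplex.X (n + 1))).injective
      ((baseHomEquiv_comp (I.cochainComplex.d n (n + 1)) ψ).trans
        (Eq.trans hf (map_zero (baseHomEquiv (I.cochainComplex.X (n + 1)))).symm))
  exact ⟨⟨ψ, hψ⟩, hochschildClass_apply I n ψ hψ⟩

/-- Naturality of `baseHomEquiv` identifies the complexes `Hom_U(S, Hom_{S^e}(S, I))` and
`Hom_{U^e}(U, I)`, so coboundaries correspond. -/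
theorem hochschildClass_eq_zero_iff (n : ℕ)
    (f : LinearMap.ker (Linear.rightComp k (base k S L) ((homComplex I).d n (n + 1)))) :
    hochschildClass I n f = 0 ↔
      ∃ g : base k S L ⟶ (homComplex I).X (n - 1), g ≫ (homComplex I).d (n - 1) n = f.1 := by
  obtain ⟨ψ, hψ⟩ := f
  rw [hochschildClass_apply I n ψ hψ]
  refine (extOfCocycle_eq_zero_iff k I _ n _).trans ?_
  constructor
  · rintro ⟨g, hg⟩
    obtain ⟨g, rfl⟩ := (baseHomEquiv (I.cochainComplex.X (n - 1))).surjective g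
    exact ⟨g, (baseHomEquiv (I.cochainComplex.X n)).injective
      ((baseHomEquiv_comp (I.cochainComplex.d (n - 1) n) g).trans hg)⟩
  · rintro ⟨g, hg⟩
    exact ⟨baseHomEquiv _ g,
      (baseHomEquiv_comp (I.cochainComplex.d (n - 1) n) g).symm.trans (congrArg _ hg)⟩

theorem toHom_cocycle (q : ℕ) (x : (homComplex I).X q)
    (hx : ((homComplex I).d q (q + 1)).hom x = 0) :
    (toHom x ≫ (res k S L).map (I.cochainComplexXIso q q rfl).hom) ≫
      (res k S L).map (I.cocomplex.d q (q + 1)) = 0 := by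
  have h : toHom x ≫ (res k S L).map (I.cochainComplex.d q (q + 1)) = 0 :=
    (toHom_map _ x).symm.trans ((congrArg toHom hx).trans (map_zero _))
  rw [I.cochainComplex_d q (q + 1) q (q + 1) rfl (by push_cast; rfl), (res k S L).map_comp,
    (res k S L).map_comp] at h
  rw [← cancel_mono ((res k S L).map
      (I.cochainComplexXIso (q + 1) (q + 1) (by push_cast; rfl)).inv),
    Category.assoc, Category.assoc, h, zero_comp]

variable [Module.Projective S L]

/-- Sending a cocycle to its class is `U`-linear by the formula for the action on classes, is
surjective, and kills exactly the coboundaries. The remaining work passes between indexing by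
natural numbers and by integers. -/
theorem nonempty_homology_homComplex_iso (q : ℕ) :
    letI := cohomologyModule M q
    Nonempty ((homComplex I).homology q ≅
      ModuleCat.of (Env k S L) (HH k S ((res k S L).obj M) q)) := by
  let := cohomologyModule M q
  let K := homComplex I
  let i := I.cochainComplexXIso q q rfl
  let τ : LinearMap.ker (K.sc' (q - 1) q (q + 1)).g.hom →ₗ[Env k S L]
      ModuleCat.of (Env k S L) (HH k S ((res k S L).obj M) q) :=
    { toFun := fun x => cocycleClass I q (toHom x.1 ≫ (res k S L).map i.hom)
        (toHom_cocycle I q x.1 x.2)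
      map_add' := fun x y => by
        refine Eq.trans ?_ (cocycleClass_add I q _ _ (toHom_cocycle I q x.1 x.2)
          (toHom_cocycle I q y.1 y.2) (by
            rw [Preadditive.add_comp, toHom_cocycle I q x.1 x.2, toHom_cocycle I q y.1 y.2,
              add_zero]))
        exact cocycleClass_congr I q _ _ (Preadditive.add_comp _ _ _ (toHom x.1) (toHom y.1) _)
      map_smul' := fun a x => by
        refine Eq.trans ?_
          (cohomologySMul_cocycleClass q I a _ (toHom_cocycle I q x.1 x.2)).symm
        exact cocycleClass_congr I q _ _ (homAction_comp _ a (toHom x.1)) }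
  have hτ : Function.Surjective τ := by
    intro x
    obtain ⟨f, hf, rfl⟩ := cocycleClass_surjective I q x
    refine ⟨⟨toHom.symm (f ≫ (res k S L).map i.inv), ?_⟩, ?_⟩
    · apply toHom.injective
      refine (toHom_map (I.cochainComplex.d q (q + 1)) _).trans ?_
      rw [AddEquiv.apply_symm_apply, I.cochainComplex_d q (q + 1) q (q + 1) rfl (by push_cast; rfl),
        Category.assoc, ← (res k S L).map_comp, Iso.inv_hom_id_assoc, (res k S L).map_comp,
        ← Category.assoc, hf, zero_comp]
      exact (map_zero toHom).symm
    · refine cocycleClass_congr I q _ _ ?_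
      rw [AddEquiv.apply_symm_apply, Category.assoc, ← (res k S L).map_comp, Iso.inv_hom_id,
        (res k S L).map_id, Category.comp_id]
  have hτ' (x) : τ x = 0 ↔ ∃ y, (K.sc' (q - 1) q (q + 1)).f.hom y = x.1 := by
    refine (cocycleClass_eq_zero_iff I q _ (toHom_cocycle I q x.1 x.2)).trans ?_
    have hi {f : regular k S ⟶ (res k S L).obj (I.cochainComplex.X q)}
        (h : f ≫ (res k S L).map i.hom = toHom x.1 ≫ (res k S L).map i.hom) : f = toHom x.1 :=
      (cancel_mono _).mp h
    constructor
    · rintro ⟨p, g, hg⟩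
      by_cases hp : p + 1 = q
      · let j := I.cochainComplexXIso ((q : ℤ) - 1) p (by lia)
        refine ⟨toHom.symm (g ≫ (res k S L).map j.inv), ?_⟩
        apply toHom.injective
        refine (toHom_map (I.cochainComplex.d (q - 1) q) _).trans ?_
        apply hi
        rw [AddEquiv.apply_symm_apply, I.cochainComplex_d (q - 1) q p q (by lia) rfl, ← hg,
          Category.assoc, Category.assoc, ← (res k S L).map_comp, ← (res k S L).map_comp]
        congr 2
        simp [i, j]
      · refine ⟨0, ?_⟩
        refine (map_zero _).trans (toHom.injective ((map_zero toHom).trans (hi ?_)))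
        rw [zero_comp, ← hg, I.cocomplex.shape p q (by simpa using hp), (res k S L).map_zero,
          comp_zero]
    · rintro ⟨y, hy⟩
      have hy' : toHom y ≫ (res k S L).map (I.cochainComplex.d (q - 1) q) = toHom x.1 :=
        (toHom_map (I.cochainComplex.d (q - 1) q) y).symm.trans (congrArg toHom hy)
      cases q with
      -- Here `y` lies in degree `-1`, where the complex vanishes, so the cocycle is zero.
      | zero =>
        refine ⟨0, 0, ?_⟩
        have h0 : I.cochainComplex.d ((0 : ℕ) - 1) (0 : ℕ) = 0 :=
          (CochainComplex.isZero_of_isStrictlyGE I.cochainComplex 0 _ (by simp)).eq_of_src _ _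
        rw [← hy', h0, (res k S L).map_zero, comp_zero, zero_comp, zero_comp]
      | succ p =>
        refine ⟨p, toHom y ≫ (res k S L).map
          (I.cochainComplexXIso (((p + 1 : ℕ) : ℤ) - 1) p (by push_cast; ring)).hom, ?_⟩
        rw [← hy', I.cochainComplex_d _ _ p (p + 1) (by push_cast; ring) rfl, Category.assoc,
          Category.assoc, ← (res k S L).map_comp, ← (res k S L).map_comp]
        congr 2
        simp
  obtain ⟨e⟩ := nonempty_homology_iso (K.sc' (q - 1) q (q + 1)) _ τ hτ hτ'
  exact ⟨ShortComplex.homologyMapIso (K.isoSc' (q - 1) q (q + 1) (by simp) (by simp)) ≪≫ e⟩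

variable (M) in
-- The general spectral sequence for `Hom_{S^e}(S, I)`: the abutment is `H^*(U, M)` through
-- `hochschildClass`, and the coefficients on the second page are replaced along an isomorphism of
-- `U`-modules.
theorem exists_spectralSequence_hochschild :
    ∃ E : E₂CohomologicalSpectralSequenceNat (ModuleCat.{u} k),
      (∀ p q : ℕ,
        letI := cohomologyModule M q
        Nonempty ((E.page 2 le_rfl).X (p, q) ≅ ModuleCat.of k (LRCohomology k S L
          (ModuleCat.of (Env k S L) (HH k S ((res k S L).obj M) q)) p))) ∧
      ConvergesTo E (fun n => ModuleCat.of k (HH k (Env k S L) M n)) := by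
  let I := InjectiveResolution.of M
  obtain ⟨E, hE, hE'⟩ := exists_spectralSequence (base k S L) (homComplex I)
    (fun n => ModuleCat.of k (HH k (Env k S L) M n)) (hochschildClass I)
    (hochschildClass_surjective I) (hochschildClass_eq_zero_iff I)
  refine ⟨E, fun p q => ?_, hE'⟩
  obtain ⟨e⟩ := hE p q
  obtain ⟨e'⟩ := nonempty_homology_homComplex_iso I q
  exact ⟨e ≪≫ (extCongr k (base k S L) e' p).toModuleIso⟩

end SpectralSequence

end LieRinehart

end

open LieRinehart in
theorem mainTheorem1 (k S L : Type u) [Field k] [CommRing S] [Algebra k S]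
    [LieRing L] [LieAlgebra k L] [Module S L] [LieRingModule L S]
    [LieRinehartRing S L] [LieRinehartAlgebra k S L] [Module.Projective S L] :
    -- an injective resolution `I` of the bimodule `M` over `U` computes `H^*(S, M)`
    (∀ (M : ModuleCat.{u} (Ae k (Env k S L))) (I : InjectiveResolution M) (q : ℕ),
      (∀ x : HH k S ((res k S L).obj M) q, ∃ f hf, cocycleClass I q f hf = x) ∧
      (∀ f hf, cocycleClass I q f hf = 0 ↔
        ∃ (p : ℕ) (g : regular k S ⟶ (res k S L).obj (I.cocomplex.X p)),
          g ≫ (res k S L).map (I.cocomplex.d p q) = f)) ∧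
    -- there are `U`-module structures on the spaces `H^q(S, M)`
    ∃ act : ∀ (M : ModuleCat.{u} (Ae k (Env k S L))) (q : ℕ),
        Module (Env k S L) (HH k S ((res k S L).obj M) q),
      -- induced by the action of `U` on `Hom_{S^e}(S, I^q)`
      (∀ (M : ModuleCat.{u} (Ae k (Env k S L))) (I : InjectiveResolution M) (q : ℕ)
        (a : Env k S L) (f : regular k S ⟶ (res k S L).obj (I.cocomplex.X q))
        (hf : f ≫ (res k S L).map (I.cocomplex.d q (q + 1)) = 0),
        letI := act M q
        a • cocycleClass I q f hf =
          cocycleClass I q (homAction _ a f) (homAction_cocycle _ a f hf)) ∧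
      -- natural in `M`
      (∀ (M N : ModuleCat.{u} (Ae k (Env k S L))) (g : M ⟶ N) (q : ℕ) (a : Env k S L)
        (x : HH k S ((res k S L).obj M) q),
        letI := act M q
        letI := act N q
        (a • x).comp (Ext.mk₀ ((res k S L).map g)) (add_zero q) =
          a • x.comp (Ext.mk₀ ((res k S L).map g)) (add_zero q)) ∧
      -- and for each `M` there is a spectral sequence
      ∀ M : ModuleCat.{u} (Ae k (Env k S L)),
        ∃ E : E₂CohomologicalSpectralSequenceNat (ModuleCat.{u} k),
          (∀ p q : ℕ,
            letI := act M q
            Nonempty ((E.page 2).X (p, q) ≅ ModuleCat.of k (LRCohomology k S L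
              (ModuleCat.of (Env k S L) (HH k S ((res k S L).obj M) q)) p))) ∧
          ConvergesTo E (fun n => ModuleCat.of k (HH k (Env k S L) M n)) := by
  refine ⟨fun M I q => ⟨cocycleClass_surjective I q, cocycleClass_eq_zero_iff I q⟩,
    fun M q => cohomologyModule M q, fun M I q a f hf => cohomologySMul_cocycleClass q I a f hf,
    fun M N g q a x => cohomologySMul_comp q g a x, fun M => exists_spectralSequence_hochschild M⟩
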